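/- Let $\mathbb{K}$ be a semiring and let $\mathcal{A}=\langle I,E,T\rangle$ be a $\mathbb{K}$-automaton over an alphabet $A$ with finite state set $Q$: $I,T\in\mathbb{K}^Q$, and $E(p,a,q)\in\mathbb{K}$ is the weight of the transition from $p$ to $q$ labelled by $a$ ($0$ if there is none). Let $n=|Q|$ and let $m$ be the (finite) number of transitions, i.e. of triples with $E(p,a,q)\neq 0$. For a map $\varphi:Q\to R$ let $X_\varphi$ be the $Q\times R$-matrix with entry $1$ at $(q,\varphi(q))$ and $0$ elsewhere. A surjective $\varphi$ is a morphism from $\mathcal{A}$ onto $\mathcal{B}=\langle J,F,U\rangle$ if $I X_\varphi=J$, $E X_\varphi=X_\varphi F$ and $T=X_\varphi U$; then $\mathcal{B}$ is a quotient of $\mathcal{A}$. The minimal quotient of $\mathcal{A}$ is the quotient (unique up to isomorphism) that has the least number of states among all quotients of $\mathcal{A}$ and is a quotient of every quotient of $\mathcal{A}$. The augmented automaton of $\mathcal{A}$ has two more states $i,t$ and one more letter $\$$, with transitions $i\to q$ of label $\$$ and weight $I_q$ and $q\to t$ of label $\$$ and weight $T_q$ for $q\in Q$. The signature of a state $p$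 with respect to a set $D$ of states is the map $\sigma_{p,D}: a\mapsto\sum_{q\in D}E(p,a,q)$ on $A\cup\{\$\}$, where $E$ is taken in the augmented automaton. $\mathcal{A}$ has simplifiable signatures if for all $C\subseteq D\subseteq Q$ and all $p,q\in Q$, $\sigma_{p,D}=\sigma_{q,D}$ and $\sigma_{p,C}=\sigma_{q,C}$ imply $\sigma_{p,D\setminus C}=\sigma_{q,D\setminus C}$. The Fast Predecessor Class Split Algorithm (FPCSA) maintains a partition of $Q\cup\{i,t\}$ and a queue of classes. It starts with the classes $\{i\},Q,\{t\}$ (without $Q$ if $Q=\emptyset$), all but $\{i\}$ being in the queue. While the queue is not empty, a class $D$ is extracted from it, the signatures with respect to $D$ of the predecessors of the states of $D$ are computed by running through the transitions that enter $D$, and every class $C$ is split into the subclasses of states with equal signature with respect to $D$. If a class $C$ that is split is in the queue, it is replaced there by its subclasses; otherwise all its subclasses except one of the largest (chosen arbitrarily) are put in the queue. At the end, the quotient automaton by the final partition is built. Classes are doubly linked lists, states with equal signature are gathered by means of hash maps, and time is the number of elementary steps, where an access to an array or pointer, to a hash map (linear in the length of the key, if the key is a list), an addition of weights, or a comparison of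 weights with $0$ is one step. Theorem (complexity of FPCSA). There is an absolute constant $c>0$ such that for every $\mathbb{K}$-automaton $\mathcal{A}$ with simplifiable signatures, given by the list of its states, the list of its transitions and the arrays $I$ and $T$, FPCSA halts, the automaton that it returns is the minimal quotient of $\mathcal{A}$, and the map that sends every state to its class in the final partition is a morphism from $\mathcal{A}$ onto it; moreover, if $n\geq 2$, the running time is at most $c\,(m+n)\log n$, i.e. it is in $O((m+n)\log n)$. -/

import Mathlib

/-! ### Weighted automata, morphisms, quotients -/

/-- A `K`-automaton `⟨I, E, T⟩` of dimension `Q` over the alphabet `A`: `E a p q` is the weight of the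
transition from `p` to `q` labelled by `a`, and it is `0` if there is no such transition. -/
structure WAut (K : Type*) (A : Type*) (Q : Type*) where
  I : Q → K
  E : A → Matrix Q Q K
  T : Q → K

/-- The amalgamation matrix of a map. -/
noncomputable def amalgamation (K : Type*) [Semiring K] {Q R : Type*} (φ : Q → R) : Matrix Q R K :=
  open Classical in Matrix.of fun q r => if φ q = r then 1 else 0

namespace WAut

section Morphisms

variable {K A Q R : Type*} [Semiring K] [Fintype Q] [Fintype R]

/-- `𝒜` is conjugate to `ℬ` by the transfer matrix `X`. (The entries of the adjacency matrices are
linear combinations of letters, so that the equation `E X = X F` is an equation for each letter.) -/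
def ConjugateBy (𝒜 : WAut K A Q) (ℬ : WAut K A R) (X : Matrix Q R K) : Prop :=
  Matrix.vecMul 𝒜.I X = ℬ.I ∧ (∀ a, 𝒜.E a * X = X * ℬ.E a) ∧ 𝒜.T = Matrix.mulVec X ℬ.T

/-- The surjective map `φ` is a morphism from `𝒜` onto `ℬ`. -/
def IsMorphism (𝒜 : WAut K A Q) (ℬ : WAut K A R) (φ : Q → R) : Prop :=
  Function.Surjective φ ∧ 𝒜.ConjugateBy ℬ (amalgamation K φ)

/-- `ℬ` is a quotient of `𝒜`. -/
def IsQuotient (ℬ : WAut K A R) (𝒜 : WAut K A Q) : Prop :=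
  ∃ φ : Q → R, 𝒜.IsMorphism ℬ φ

end Morphisms

/-- `ℬ` is the minimal quotient of `𝒜`: it is a quotient of `𝒜`, no quotient of `𝒜` has fewer states,
and it is a quotient of every quotient of `𝒜`. -/
def IsMinimalQuotient.{x, u₁, u₂, u₃, u₄} {K : Type u₁} {A : Type u₂} {Q : Type u₃} {R : Type u₄}
    [Semiring K] [Fintype Q] [Fintype R] (ℬ : WAut K A R) (𝒜 : WAut K A Q) : Prop :=
  ℬ.IsQuotient 𝒜 ∧
    ∀ (S : Type x) [Fintype S] (𝒞 : WAut K A S), 𝒞.IsQuotient 𝒜 →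
      Fintype.card R ≤ Fintype.card S ∧ ℬ.IsQuotient 𝒞

/-- The number of transitions of an automaton. -/
noncomputable def numTransitions {K A Q : Type*} [Semiring K] (𝒜 : WAut K A Q) : ℕ :=
  Set.ncard {e : Q × A × Q | 𝒜.E e.2.1 e.1 e.2.2 ≠ 0}

end WAut

/-! ### Augmented automata and signatures -/

/-- The states of the augmented automaton: the true states, a new initial state and a new
final state. -/
inductive Aug (Q : Type*) where
  | ini : Aug Q
  | state : Q → Aug Q
  | fin : Aug Q
  deriving DecidableEq

/-- The true states inside the states of the augmented automaton. -/
def Aug.emb (Q : Type*) : Q ↪ Aug Q := ⟨Aug.state, fun _ _ h => Aug.state.inj h⟩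

namespace WAut

variable {K A Q : Type*} [Semiring K]

/-- The transitions of the augmented automaton. The augmented alphabet is `Option A`, where `none` is
the marker. -/
def augE (𝒜 : WAut K A Q) : Aug Q → Option A → Aug Q → K
  | .ini, none, .state q => 𝒜.I q
  | .state p, some a, .state q => 𝒜.E a p q
  | .state p, none, .fin => 𝒜.T p
  | _, _, _ => 0

/-- The signature of the state `p` with respect to a set `D` of states. -/
def signature (𝒜 : WAut K A Q) (p : Aug Q) (D : Finset (Aug Q)) : Option A → K :=
  fun a => ∑ q ∈ D, 𝒜.augE p a q

/-- Simplifiable signatures: for sets `C ⊆ D` of true states and true states `p`, `q`, if the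
signatures of `p` and `q` agree with respect to `D` and to `C`, then they agree with respect to
`D \ C`. -/
def SimplifiableSignatures [DecidableEq Q] (𝒜 : WAut K A Q) : Prop :=
  ∀ D C : Finset Q, C ⊆ D → ∀ p q : Q,
    𝒜.signature (.state p) (D.map (Aug.emb Q)) = 𝒜.signature (.state q) (D.map (Aug.emb Q)) →
    𝒜.signature (.state p) (C.map (Aug.emb Q)) = 𝒜.signature (.state q) (C.map (Aug.emb Q)) →
    𝒜.signature (.state p) ((D \ C).map (Aug.emb Q)) =
      𝒜.signature (.state q) ((D \ C).map (Aug.emb Q))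

end WAut

/-! ### Step-counting programs

A program over a memory `σ` returns a value, a new memory and the number of elementary steps.
Steps are counted by the primitives `tick`, `get`, `put` only; each of the machine operations below
accesses one cell of an array, one entry of a hash map or one register, or performs one operation on
weights. -/

/-- Programs over the memory `σ` with a result in `α`. -/
def Prog (σ α : Type*) := σ → (α × σ) × ℕ

namespace Prog

variable {σ α β : Type*}

/-- Return a value; no step. -/
def pure (a : α) : Prog σ α := fun s => ((a, s), 0)

/-- Sequential composition; the step counts add up. -/
def bind (x : Prog σ α) (f : α → Prog σ β) : Prog σ β := fun s =>
  let r := x s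
  let r' := f r.1.1 r.1.2
  (r'.1, r.2 + r'.2)

/-- Sequential composition, ignoring the first result. -/
def seq (x : Prog σ α) (y : Prog σ β) : Prog σ β := x.bind fun _ => y

/-- `c` steps that do not touch the memory. -/
def tick (c : ℕ) : Prog σ Unit := fun s => (((), s), c)

/-- Reading from the memory; one step. -/
def get (f : σ → α) : Prog σ α := fun s => ((f s, s), 1)

/-- Writing to the memory; one step. -/
def put (f : σ → σ) : Prog σ Unit := fun s => (((), f s), 1)

/-- Run through a linked list; one step for every test of the loop, in addition to the body. -/
def forEach : List α → (α → Prog σ Unit) → Prog σ Unit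
  | [], _ => tick 1
  | x :: l, f => (tick 1).seq ((f x).seq (forEach l f))

/-- Run through a linked list while updating a register. -/
def foldEach : List α → β → (β → α → Prog σ β) → Prog σ β
  | [], b, _ => (tick 1).seq (pure b)
  | x :: l, b, f => (tick 1).seq ((f b x).bind fun b' => foldEach l b' f)

/-- The length of a linked list, computed by running through it. -/
def length (l : List α) : Prog σ ℕ := foldEach l 0 fun k _ => (tick 1).seq (pure (k + 1))

/-- `While guard body s s' t`: the loop `while guard do body`, started in the memory `s`, halts in the
memory `s'` after `t` steps. -/
inductive While (guard : Prog σ Bool) (body : Prog σ Unit) : σ → σ → ℕ → Prop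
  | done (s : σ) (h : (guard s).1.1 = false) :
      While guard body s (guard s).1.2 (guard s).2
  | step (s s' : σ) (t : ℕ) (h : (guard s).1.1 = true)
      (hrec : While guard body (body (guard s).1.2).1.2 s' t) :
      While guard body s s' ((guard s).2 + (body (guard s).1.2).2 + t)

end Prog

/-! ### The Fast Predecessor Class Split Algorithm -/

namespace FPCSA

/-- The input: the lists of the states and of the transitions `(p, a, k, q)` of an automaton (from `p` to
`q`, with label `a` and weight `k`), and the arrays of its initial and final functions. -/
structure Input (K A Q : Type*) where
  states : List Q
  trans : List (Q × A × K × Q)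
  I : Q → K
  T : Q → K

/-- The input `inp` is a description of the automaton `𝒜`; the order of the two lists is arbitrary. -/
structure Input.Describes {K A Q : Type*} [Semiring K] (inp : Input K A Q) (𝒜 : WAut K A Q) :
    Prop where
  states_nodup : inp.states.Nodup
  mem_states : ∀ q, q ∈ inp.states
  trans_nodup : inp.trans.Nodup
  mem_trans : ∀ p a k q, (p, a, k, q) ∈ inp.trans ↔ 𝒜.E a p q = k ∧ k ≠ 0
  I_eq : inp.I = 𝒜.I
  T_eq : inp.T = 𝒜.T

/-- A (linked) hash map: it can be accessed by key and run through. -/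
abbrev HMap (κ ν : Type*) := AList fun _ : κ => ν

/-- The memory. Classes are named by natural numbers: `0` is the class of the initial state of the
augmented automaton, `1` the class of its final state, `2` and larger numbers are classes of true
states. A class is a doubly linked list. -/
structure Mem (K A Q : Type*) where
  /-- the incoming transitions `(p, a, k)` of a state -/
  inc : Aug Q → List (Aug Q × Option A × K)
  /-- the class of a state -/
  cls : Aug Q → ℕ
  /-- successor and predecessor of a state in the list of its class -/
  next : Aug Q → Option (Aug Q)
  prev : Aug Q → Option (Aug Q)
  /-- first state and number of states of a class -/
  first : ℕ → Option (Aug Q)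
  size : ℕ → ℕ
  /-- number of classes -/
  numCls : ℕ
  /-- the queue consists of the classes at the places `head, …, tail - 1` of an array -/
  queue : ℕ → ℕ
  head : ℕ
  tail : ℕ
  /-- whether a class is in the queue -/
  queued : ℕ → Bool
  /-- for each letter, the pairs `(p, k)` met at the transitions that enter the splitter -/
  meet : HMap (Option A) (List (Aug Q × K))
  /-- the signatures with respect to the splitter, as lists of pairs of a letter and a weight -/
  sig : HMap (Aug Q) (List (Option A × K))
  /-- the states with a given class and a given nonzero signature -/
  groups : HMap (ℕ × List (Option A × K)) (List (Aug Q))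
  /-- for each class, the lists of its states with equal nonzero signature -/
  parts : HMap ℕ (List (List (Aug Q)))
  /-- the weights of the transitions of the (augmented) quotient -/
  quot : HMap (ℕ × Option A × ℕ) K

/-- The blank memory. -/
def Mem.blank (K A Q : Type*) : Mem K A Q where
  inc _ := []
  cls _ := 0
  next _ := none
  prev _ := none
  first _ := none
  size _ := 0
  numCls := 0
  queue _ := 0
  head := 0
  tail := 0
  queued _ := false
  meet := ∅
  sig := ∅
  groups := ∅
  parts := ∅
  quot := ∅

section Algorithm

open Prog

variable {K A Q : Type*} [Semiring K] [DecidableEq K] [DecidableEq A] [DecidableEq Q]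

local notation "M" => Prog (Mem K A Q)

/-! #### Machine operations -/

def getInc (q : Aug Q) : M (List (Aug Q × Option A × K)) := get fun s => s.inc q
def setInc (q : Aug Q) (l : List (Aug Q × Option A × K)) : M Unit :=
  put fun s => { s with inc := Function.update s.inc q l }
def getCls (p : Aug Q) : M ℕ := get fun s => s.cls p
def setCls (p : Aug Q) (c : ℕ) : M Unit := put fun s => { s with cls := Function.update s.cls p c }
def getNext (p : Aug Q) : M (Option (Aug Q)) := get fun s => s.next p
def setNext (p : Aug Q) (x : Option (Aug Q)) : M Unit :=
  put fun s => { s with next := Function.update s.next p x }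
def getPrev (p : Aug Q) : M (Option (Aug Q)) := get fun s => s.prev p
def setPrev (p : Aug Q) (x : Option (Aug Q)) : M Unit :=
  put fun s => { s with prev := Function.update s.prev p x }
def getFirst (c : ℕ) : M (Option (Aug Q)) := get fun s => s.first c
def setFirst (c : ℕ) (x : Option (Aug Q)) : M Unit :=
  put fun s => { s with first := Function.update s.first c x }
def getSize (c : ℕ) : M ℕ := get fun s => s.size c
def setSize (c k : ℕ) : M Unit := put fun s => { s with size := Function.update s.size c k }
def getNumCls : M ℕ := get fun s => s.numCls
def setNumCls (k : ℕ) : M Unit := put fun s => { s with numCls := k }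
def getQueue (j : ℕ) : M ℕ := get fun s => s.queue j
def setQueue (j c : ℕ) : M Unit := put fun s => { s with queue := Function.update s.queue j c }
def getHead : M ℕ := get fun s => s.head
def setHead (j : ℕ) : M Unit := put fun s => { s with head := j }
def getTail : M ℕ := get fun s => s.tail
def setTail (j : ℕ) : M Unit := put fun s => { s with tail := j }
def getQueued (c : ℕ) : M Bool := get fun s => s.queued c
def setQueued (c : ℕ) (b : Bool) : M Unit :=
  put fun s => { s with queued := Function.update s.queued c b }

def getMeet (a : Option A) : M (List (Aug Q × K)) := get fun s => (s.meet.lookup a).getD []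
def setMeet (a : Option A) (l : List (Aug Q × K)) : M Unit :=
  put fun s => { s with meet := s.meet.insert a l }
def getSig (p : Aug Q) : M (List (Option A × K)) := get fun s => (s.sig.lookup p).getD []
def setSig (p : Aug Q) (l : List (Option A × K)) : M Unit :=
  put fun s => { s with sig := s.sig.insert p l }
/-- The key contains a list, hence the access takes a time linear in the length of this list. -/
def getGroup (c : ℕ) (l : List (Option A × K)) : M (List (Aug Q)) :=
  (tick l.length).seq (get fun s => (s.groups.lookup (c, l)).getD [])
/-- The key contains a list, hence the access takes a time linear in the length of this list. -/
def setGroup (c : ℕ) (l : List (Option A × K)) (g : List (Aug Q)) : M Unit :=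
  (tick l.length).seq (put fun s => { s with groups := s.groups.insert (c, l) g })
def getParts (c : ℕ) : M (List (List (Aug Q))) := get fun s => (s.parts.lookup c).getD []
def setParts (c : ℕ) (l : List (List (Aug Q))) : M Unit :=
  put fun s => { s with parts := s.parts.insert c l }
def getQuot (x : ℕ × Option A × ℕ) : M K := get fun s => (s.quot.lookup x).getD 0
def setQuot (x : ℕ × Option A × ℕ) (k : K) : M Unit :=
  put fun s => { s with quot := s.quot.insert x k }

/-- Run through the entries of a hash map (read at the beginning of the loop). -/
def forEntries {κ ν : Type*} (f : Mem K A Q → HMap κ ν) (body : κ → ν → M Unit) : M Unit :=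
  (get fun s => (f s).entries).bind fun l => forEach l fun e => body e.1 e.2

/-- New empty hash maps for the treatment of the next splitter. -/
def clearTables : M Unit :=
  (put fun s => { s with meet := ∅ }).seq <|
  (put fun s => { s with sig := ∅ }).seq <|
  (put fun s => { s with groups := ∅ }).seq <|
  put fun s => { s with parts := ∅ }

def addWeights (k k' : K) : M K := get fun _ => k + k'
def isZeroWeight (k : K) : M Bool := get fun _ => decide (k = 0)

/-! #### Classes and queue -/

/-- Create a new empty class. -/
def newClass : M ℕ :=
  getNumCls.bind fun c =>
  (setNumCls (c + 1)).seq <|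
  (setFirst c none).seq <|
  (setSize c 0).seq <|
  (setQueued c false).seq <|
  pure c

/-- Delete the state `p` from the class `c`. -/
def unlink (c : ℕ) (p : Aug Q) : M Unit :=
  (getPrev p).bind fun x =>
  (getNext p).bind fun y =>
  (match x with
    | none => setFirst c y
    | some x' => setNext x' y).seq <|
  (match y with
    | none => tick 1
    | some y' => setPrev y' x).seq <|
  (getSize c).bind fun k =>
  setSize c (k - 1)

/-- Insert the state `p` at the beginning of the class `c`. -/
def link (c : ℕ) (p : Aug Q) : M Unit :=
  (getFirst c).bind fun y =>
  (setPrev p none).seq <|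
  (setNext p y).seq <|
  (match y with
    | none => tick 1
    | some y' => setPrev y' (some p)).seq <|
  (setFirst c (some p)).seq <|
  (setCls p c).seq <|
  (getSize c).bind fun k =>
  setSize c (k + 1)

/-- Run through the states of a class, given the first state and the number of states. -/
def walk (body : Aug Q → M Unit) : ℕ → Option (Aug Q) → M Unit
  | k + 1, some q =>
      (tick 1).seq <| (getNext q).bind fun y => (body q).seq (walk body k y)
  | _, _ => tick 1

def forClass (c : ℕ) (body : Aug Q → M Unit) : M Unit :=
  (getFirst c).bind fun x => (getSize c).bind fun k => walk body k x

/-- Put a class at the end of the queue. -/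
def enqueue (c : ℕ) : M Unit :=
  getTail.bind fun j =>
  (setQueue j c).seq <|
  (setTail (j + 1)).seq <|
  setQueued c true

/-- Extract the class at the beginning of the queue. -/
def dequeue : M ℕ :=
  getHead.bind fun j =>
  (getQueue j).bind fun c =>
  (setHead (j + 1)).seq <|
  (setQueued c false).seq <|
  pure c

def queueNonempty : M Bool :=
  getHead.bind fun j => getTail.bind fun k => (tick 1).seq (pure (decide (j < k)))

/-! #### Signatures with respect to the splitter -/

/-- For every transition from `p` that enters the class `d`, with label `a` and weight `k`, put `(p, k)`
into the list of the letter `a`. -/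
def collect (d : ℕ) : M Unit :=
  forClass d fun q =>
  (getInc q).bind fun l =>
  forEach l fun e =>
  (getMeet e.2.1).bind fun l' => setMeet e.2.1 ((e.1, e.2.2) :: l')

/-- Insert the pair of `a` and `k` into the signature of `p`. If the last inserted pair has the same letter
`a`, then the weights are added, and the pair is removed if the sum is zero. -/
def insertSig (p : Aug Q) (a : Option A) (k : K) : M Unit :=
  (getSig p).bind fun l =>
  match l with
  | [] => setSig p [(a, k)]
  | (a', k') :: l' =>
    (tick 1).seq <|
    if a' = a then
      (addWeights k' k).bind fun k'' =>
      (isZeroWeight k'').bind fun z =>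
      if z then setSig p l' else setSig p ((a, k'') :: l')
    else setSig p ((a, k) :: (a', k') :: l')

def computeSignatures : M Unit :=
  forEntries Mem.meet fun a l => forEach l fun e => insertSig e.1 a e.2

/-- Gather the states with the same class and the same nonzero signature. -/
def gather : M Unit :=
  (forEntries Mem.sig fun p l =>
    match l with
    | [] => tick 1
    | _ :: _ =>
      (getCls p).bind fun c =>
      (getGroup c l).bind fun g => setGroup c l (p :: g)).seq <|
  forEntries Mem.groups fun x g =>
    (getParts x.1).bind fun gs => setParts x.1 (g :: gs)

/-! #### Splitting -/

/-- Move the states of the list `g` from the class `c` to a new class. -/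
def splitOff (c : ℕ) (g : List (Aug Q)) : M ℕ :=
  newClass.bind fun e =>
  (forEach g fun p => (unlink c p).seq (link e p)).seq <|
  pure e

/-- The largest one of the class `c` and the classes of the list `l`; the function `tie` tells whether,
of two classes of equal size, the second one is preferred. -/
def largest (tie : ℕ → ℕ → Bool) (c : ℕ) (l : List ℕ) : M ℕ :=
  foldEach l c fun b e =>
  (getSize b).bind fun kb =>
  (getSize e).bind fun ke =>
  (tick 1).seq <|
  pure (if kb < ke ∨ (kb = ke ∧ tie b e = true) then e else b)

/-- Split the class `c`, where `gs` are the lists of its states with equal nonzero signature. The states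
with zero signature, if there are any, keep the name `c`, and otherwise those of the first list do. If `c`
is in the queue, then its subclasses replace it there, and otherwise all its subclasses but a
largest one are put in the queue. -/
def splitClass (tie : ℕ → ℕ → Bool) (c : ℕ) (gs : List (List (Aug Q))) : M Unit :=
  (foldEach gs 0 fun k g => (length g).bind fun k' => pure (k + k')).bind fun met =>
  (getSize c).bind fun k =>
  (tick 1).seq <|
  (foldEach (if met < k then gs else gs.tail) [] fun news g =>
    (splitOff c g).bind fun e => pure (e :: news)).bind fun news =>
  (getQueued c).bind fun b =>
  if b then forEach news enqueue
  else
    (largest tie c news).bind fun m =>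
    forEach (c :: news) fun e => if e = m then tick 1 else enqueue e

/-- One iteration: extract a class from the queue and split all the classes with respect to it. -/
def iteration (tie : ℕ → ℕ → Bool) : M Unit :=
  dequeue.bind fun d =>
  clearTables.seq <|
  (collect d).seq <|
  computeSignatures.seq <|
  gather.seq <|
  forEntries Mem.parts fun c gs => splitClass tie c gs

/-! #### Beginning and end -/

/-- Insert an incoming transition of the state `q`, unless its weight is zero. -/
def addInc (q p : Aug Q) (a : Option A) (k : K) : M Unit :=
  (isZeroWeight k).bind fun z =>
  if z then tick 1 else (getInc q).bind fun l => setInc q ((p, a, k) :: l)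

/-- The lists of incoming transitions of the augmented automaton. -/
def prepareTransitions (inp : Input K A Q) : M Unit :=
  (setInc .ini []).seq <|
  (setInc .fin []).seq <|
  (forEach inp.states fun q => setInc (.state q) []).seq <|
  (forEach inp.states fun q =>
    (get fun _ => inp.I q).bind fun k =>
    (addInc (.state q) .ini none k).seq <|
    (get fun _ => inp.T q).bind fun k' =>
    addInc .fin (.state q) none k').seq <|
  forEach inp.trans fun e => addInc (.state e.2.2.2) (.state e.1) (some e.2.1) e.2.2.1

/-- The first partition (one class for the initial state, one for the final state, and one for all the
true states, if there are any). All the classes but the one of the initial state are put in the queue. -/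
def preparePartition (inp : Input K A Q) : M Unit :=
  newClass.bind fun c₀ => (link c₀ .ini).seq <|
  newClass.bind fun c₁ => (link c₁ .fin).seq <|
  (match inp.states with
    | [] => tick 1
    | _ :: _ =>
      newClass.bind fun c₂ =>
      (forEach inp.states fun q => link c₂ (.state q)).seq (enqueue c₂)).seq <|
  enqueue c₁

/-- Add up, in the transitions of the quotient, the weights of those transitions that enter `q` and
leave the first state of some class. -/
def quotientStep (q : Aug Q) : M Unit :=
  (getCls q).bind fun d =>
  (getInc q).bind fun l =>
  forEach l fun e =>
  (getCls e.1).bind fun c =>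
  (getFirst c).bind fun x =>
  (tick 1).seq <|
  if x = some e.1 then
    (getQuot (c, e.2.1, d)).bind fun k =>
    (addWeights k e.2.2).bind fun k' => setQuot (c, e.2.1, d) k'
  else tick 1

/-- The transitions of the quotient by the final partition. -/
def buildQuotient (inp : Input K A Q) : M Unit :=
  (quotientStep .fin).seq (forEach inp.states fun q => quotientStep (.state q))

/-- `Run tie inp s t`: on the input `inp`, the algorithm halts with the memory `s` after `t` steps. -/
def Run (tie : ℕ → ℕ → Bool) (inp : Input K A Q) (s : Mem K A Q) (t : ℕ) : Prop :=
  let r₀ := ((prepareTransitions inp).seq (preparePartition inp)) (Mem.blank K A Q)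
  ∃ s₁ t₁, While queueNonempty (iteration tie) r₀.1.2 s₁ t₁ ∧
    s = (buildQuotient inp s₁).1.2 ∧ t = r₀.2 + t₁ + (buildQuotient inp s₁).2

/-- The automaton that is read off the memory at the end; its states are the classes of true states,
renumbered from `0`. -/
def output (s : Mem K A Q) : WAut K A (Fin (s.numCls - 2)) where
  I c := (s.quot.lookup (0, none, c.val + 2)).getD 0
  E a := Matrix.of fun c d => (s.quot.lookup (c.val + 2, some a, d.val + 2)).getD 0
  T c := (s.quot.lookup (c.val + 2, none, 1)).getD 0

end Algorithm

end FPCSA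

universe u v w x

/-! Correctness rests on congruences: equivalences on $Q$ whose equivalent states have the same
signature with respect to every union of classes. The kernel of a morphism is a congruence
(`IsMorphism.isCongruence`). The loop never separates states that some congruence identifies,
because a splitter, being a union of classes of the current partition, is a union of classes of the
congruence as well. So the final partition is coarser than the kernel of every morphism. If it is
moreover stable, that is, if states of one class have the same signature with respect to every class
except $\{i\}$, then its projection is a morphism (`isMorphism_output`), and it factors through
every other morphism (`IsMorphism.factor`), which is minimality.

Stability at the end is the delicate point, because one largest subclass is left out of the queue.
The invariant `LoopInv` attaches to each class $c$ of true states outside the queue a set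
$W\supseteq c$ that is a union of classes, all of them in the queue except $c$, such that the
partition is stable with respect to $W$. Extracting a class $d$ makes the partition stable with
respect to $d$. If $d\subseteq W$, simplifiable signatures give stability with respect to
$W\setminus d$, which takes the place of $W$; if $d$ is disjoint from $W$, nothing changes. If $c$
itself has just been extracted, or is a subclass of $d$, then $W=d$ serves. When the queue is empty,
$W=c$ (`LoopInv.step`, `exists_while_iteration`).

The time bound is Hopcroft's "smaller half" argument. An iteration with splitter $D$ costs
$O(\sum_{q\in D}(1+\mathrm{indeg}(q)))$ (`post_iteration`): each transition into $D$ is met once,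
and the signatures, groups and new classes that result from it have a total size linear in the
number of transitions met. When the class of a state enters the queue without replacing a queued
class, its size is at most half of what it was, since a disjoint subclass at least as large is left
out. Hence a state is in an extracted class at most $\log_2(\text{size})+1$ times. The potential
$\sum_p(1+\mathrm{indeg}(p))(\log_2(\text{size of the class of }p)+[\text{class queued}])$ pays for
everything (`extractions_step`, `potential_step`), and it is $O((m+n)\log n)$ at the start
(`potential_le`).

The rest is verification of the program: each routine has a lemma in Hoare style (`Post`) that gives
its effect and its cost together, and the lists, the queue and the hash maps are related to the
mathematical objects by `Linked`, `IsPartition`, `IsQueue` and `IsGrouping`. -/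

set_option linter.unusedSectionVars false

/-! ### Postconditions of step-counting programs -/

namespace Prog

variable {σ α β : Type*}

/-- Started in the memory `s`, the program `x` ends with a result, a memory and a number of steps
that satisfy `P`. -/
def Post (x : Prog σ α) (s : σ) (P : α → σ → ℕ → Prop) : Prop := P (x s).1.1 (x s).1.2 (x s).2

theorem Post.mono {x : Prog σ α} {s : σ} {P P' : α → σ → ℕ → Prop} (h : x.Post s P)
    (hP : ∀ a s' t, P a s' t → P' a s' t) : x.Post s P' := hP _ _ _ h

@[simp] theorem post_pure (a : α) (s : σ) (P : α → σ → ℕ → Prop) :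
    (pure a : Prog σ α).Post s P ↔ P a s 0 := Iff.rfl

@[simp] theorem post_bind (x : Prog σ α) (f : α → Prog σ β) (s : σ) (P : β → σ → ℕ → Prop) :
    (x.bind f).Post s P ↔ x.Post s fun a s' t => (f a).Post s' fun b s'' t' => P b s'' (t + t') :=
  Iff.rfl

@[simp] theorem post_seq (x : Prog σ α) (y : Prog σ β) (s : σ) (P : β → σ → ℕ → Prop) :
    (x.seq y).Post s P ↔ x.Post s fun _ s' t => y.Post s' fun b s'' t' => P b s'' (t + t') :=
  Iff.rfl

@[simp] theorem post_tick (c : ℕ) (s : σ) (P : Unit → σ → ℕ → Prop) :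
    (tick c : Prog σ Unit).Post s P ↔ P () s c := Iff.rfl

@[simp] theorem post_get (f : σ → α) (s : σ) (P : α → σ → ℕ → Prop) :
    (get f).Post s P ↔ P (f s) s 1 := Iff.rfl

@[simp] theorem post_put (f : σ → σ) (s : σ) (P : Unit → σ → ℕ → Prop) :
    (put f).Post s P ↔ P () (f s) 1 := Iff.rfl

/-- Rule for `foldEach`: the invariant `I` depends on the part of the list that has been run
through, and `c` bounds the cost of the body. -/
theorem post_foldEach {l : List α} {b : β} {f : β → α → Prog σ β} {s : σ}
    (I : List α → β → σ → Prop) (c : α → ℕ) (h0 : I [] b s)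
    (hs : ∀ pre x post b' s', l = pre ++ x :: post → I pre b' s' →
      (f b' x).Post s' fun b'' s'' t => I (pre ++ [x]) b'' s'' ∧ t ≤ c x) :
    (foldEach l b f).Post s fun b' s' t =>
      I l b' s' ∧ t ≤ 1 + (l.map fun x => 1 + c x).sum := by
  -- The induction is on the part of the list still to be visited, with the visited part as a
  -- parameter, so that the invariant can speak of the latter.
  suffices H : ∀ (post pre : List α) (b : β) (s : σ), l = pre ++ post → I pre b s →
      (foldEach post b f).Post s fun b' s' t =>
        I l b' s' ∧ t ≤ 1 + (post.map fun x => 1 + c x).sum from H l [] b s rfl h0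
  intro post
  induction post with
  | nil =>
    intro pre b s hl hI
    simp only [List.append_nil] at hl
    subst hl
    simpa [foldEach] using hI
  | cons x post ih =>
    intro pre b s hl hI
    simp only [foldEach, post_seq, post_bind, post_tick]
    refine (hs pre x post b s hl hI).mono ?_
    rintro b' s' t ⟨hI', ht⟩
    refine (ih (pre ++ [x]) b' s' (by simp [hl]) hI').mono ?_
    rintro b'' s'' t' ⟨hI'', ht'⟩
    refine ⟨hI'', ?_⟩
    simp only [List.map_cons, List.sum_cons]
    omega

theorem forEach_eq_foldEach (l : List α) (f : α → Prog σ Unit) :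
    forEach l f = foldEach l () fun _ x => f x := by
  induction l with
  | nil => rfl
  | cons x l ih => simp only [forEach, foldEach, ih]; rfl

/-- Rule for `forEach`. -/
theorem post_forEach {l : List α} {f : α → Prog σ Unit} {s : σ}
    (I : List α → σ → Prop) (c : α → ℕ) (h0 : I [] s)
    (hs : ∀ pre x post s', l = pre ++ x :: post → I pre s' →
      (f x).Post s' fun _ s'' t => I (pre ++ [x]) s'' ∧ t ≤ c x) :
    (forEach l f).Post s fun _ s' t => I l s' ∧ t ≤ 1 + (l.map fun x => 1 + c x).sum := by
  rw [forEach_eq_foldEach]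
  exact post_foldEach (fun pre _ s' => I pre s') c h0 fun pre x post _ s' => hs pre x post s'

theorem post_length (l : List α) (s : σ) :
    (length l).Post s fun k s' t => k = l.length ∧ s' = s ∧ t ≤ 1 + 2 * l.length := by
  refine (post_foldEach (fun pre k s' => k = pre.length ∧ s' = s) (fun _ => 1) ⟨rfl, rfl⟩
    ?_).mono ?_
  · rintro pre x post k s' - ⟨rfl, rfl⟩
    simp
  · rintro k s' t ⟨⟨rfl, rfl⟩, ht⟩
    refine ⟨rfl, rfl, ht.trans ?_⟩
    simp; omega

/-- Guard and body are functions of the memory. This turns the existence of one good run into a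
statement on all runs. -/
theorem While.deterministic {guard : Prog σ Bool} {body : Prog σ Unit} {s s₁ s₂ : σ} {t₁ t₂ : ℕ}
    (h₁ : While guard body s s₁ t₁) (h₂ : While guard body s s₂ t₂) : s₁ = s₂ ∧ t₁ = t₂ := by
  induction h₁ generalizing s₂ t₂ with
  | done s h =>
    cases h₂ with
    | done => exact ⟨rfl, rfl⟩
    | step _ _ _ h' => simp [h] at h'
  | step s s' t h _ ih =>
    cases h₂ with
    | done _ h' => simp [h] at h'
    | step _ _ _ _ h' =>
      obtain ⟨rfl, rfl⟩ := ih h'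
      exact ⟨rfl, rfl⟩

/-- Rule for loops: the body preserves the invariant `I`, and its cost is paid by a potential `Φ`. -/
theorem exists_while {guard : Prog σ Bool} {body : Prog σ Unit} (I : σ → Prop) (Φ : σ → ℕ)
    (g c : ℕ) (hg : ∀ s, I s → guard.Post s fun _ s' t => s' = s ∧ t ≤ g)
    (hb : ∀ s, I s → (guard s).1.1 = true →
      body.Post s fun _ s' t => I s' ∧ Φ s' < Φ s ∧ t + c * Φ s' ≤ c * Φ s) (s : σ) (hs : I s) :
    ∃ s' t, While guard body s s' t ∧ I s' ∧ (guard s').1.1 = false ∧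
      t ≤ (g + c) * Φ s + g := by
  induction hn : Φ s using Nat.strong_induction_on generalizing s with
  | _ n ih =>
    obtain ⟨h1, h2⟩ := hg s hs
    cases h : (guard s).1.1 with
    | false =>
      refine ⟨_, _, .done s h, ?_⟩
      rw [h1]
      exact ⟨hs, h, by omega⟩
    | true =>
      have hb' := hb s hs h
      obtain ⟨hI, hΦ, ht⟩ := hb'
      obtain ⟨s', t, hw, hI', hf, ht'⟩ := ih _ (hn ▸ hΦ) _ hI rfl
      refine ⟨s', _, .step s s' t h (by rw [h1]; exact hw), hI', hf, ?_⟩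
      rw [h1, ← hn]
      -- The potential drops by at least one per round, so one unit with price `g` pays for the test
      -- of the guard; the final `+ g` is the test that fails.
      have : Φ (body s).1.2 + 1 ≤ Φ s := hΦ
      nlinarith [Nat.mul_le_mul_left g this]

end Prog

/-! ### Hash maps -/

namespace FPCSA

open Prog

namespace HMap

variable {κ ν : Type*} [DecidableEq κ]

/-- The sum of a cost over the entries of a hash map. -/
def cost (m : HMap κ ν) (f : κ → ν → ℕ) : ℕ := (m.entries.map fun e => f e.1 e.2).sum

/-- An insertion erases the old entry of the key, if any. Its cost stands on the left-hand side,
which avoids truncated subtraction. -/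
theorem cost_insert (m : HMap κ ν) (f : κ → ν → ℕ) (k : κ) (v : ν) :
    cost (m.insert k v) f + ((m.lookup k).map (f k)).getD 0 = cost m f + f k v := by
  obtain ⟨l, hl⟩ := m
  simp only [cost, AList.insert, AList.lookup]
  suffices H : ((l.kerase k).map fun e => f e.1 e.2).sum + ((l.dlookup k).map (f k)).getD 0 =
      (l.map fun e => f e.1 e.2).sum by simp only [List.kinsert, List.map_cons, List.sum_cons]; omega
  clear hl
  induction l with
  | nil => simp
  | cons e l ih =>
    obtain ⟨k', v'⟩ := e
    by_cases h : k = k'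
    · subst h; simp [Nat.add_comm]
    · rw [List.kerase_cons_ne h, List.dlookup_cons_ne _ _ h]
      simp only [List.map_cons, List.sum_cons]
      omega

theorem getD_lookup_insert (m : HMap κ ν) (k k' : κ) (v d : ν) :
    ((m.insert k v).lookup k').getD d = if k' = k then v else (m.lookup k').getD d := by
  split_ifs with h
  · subst h; simp
  · rw [AList.lookup_insert_ne h]

theorem mem_entries_iff (m : HMap κ ν) (e : Sigma fun _ : κ => ν) :
    e ∈ m.entries ↔ m.lookup e.1 = some e.2 :=
  (AList.mem_lookup_iff (s := m) (a := e.1) (b := e.2)).symm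

/-- The hash map that gathers the values of a list of pairs by key. -/
def gatherFrom (m : HMap κ (List ν)) (l : List (κ × ν)) : HMap κ (List ν) :=
  l.foldl (fun m x => m.insert x.1 (x.2 :: (m.lookup x.1).getD [])) m

theorem gatherFrom_append (m : HMap κ (List ν)) (l l' : List (κ × ν)) :
    gatherFrom m (l ++ l') = gatherFrom (gatherFrom m l) l' := by
  simp [gatherFrom]

theorem gatherFrom_singleton (m : HMap κ (List ν)) (x : κ × ν) :
    gatherFrom m [x] = m.insert x.1 (x.2 :: (m.lookup x.1).getD []) := rfl

theorem getD_lookup_gatherFrom (l : List (κ × ν)) (k : κ) :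
    ((gatherFrom (∅ : HMap κ (List ν)) l).lookup k).getD [] =
      ((l.filter fun x => x.1 = k).map Prod.snd).reverse := by
  induction l using List.reverseRecOn with
  | nil => simp [gatherFrom]
  | append_singleton l x ih =>
    rw [gatherFrom_append, gatherFrom_singleton, getD_lookup_insert]
    split_ifs with h
    · subst h; simp [ih]
    · simp [ih, Ne.symm h]

theorem ne_nil_of_lookup_gatherFrom (l : List (κ × ν)) (k : κ) {g : List ν}
    (h : (gatherFrom (∅ : HMap κ (List ν)) l).lookup k = some g) : g ≠ [] := by
  induction l using List.reverseRecOn generalizing g with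
  | nil => simp [gatherFrom] at h
  | append_singleton l x ih =>
    rw [gatherFrom_append, gatherFrom_singleton] at h
    by_cases hk : k = x.1
    · subst hk; simp at h; simp [← h]
    · rw [AList.lookup_insert_ne hk] at h
      exact ih h

theorem lookup_gatherFrom (l : List (κ × ν)) {k : κ} {g : List ν}
    (h : (gatherFrom (∅ : HMap κ (List ν)) l).lookup k = some g) :
    g = ((l.filter fun x => x.1 = k).map Prod.snd).reverse := by
  rw [← getD_lookup_gatherFrom, h, Option.getD_some]

/-- Gathering only distributes the values over the keys, and loses none. This is how a cost is
carried from one table to the next. -/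
theorem cost_gatherFrom (l : List (κ × ν)) (w : ν → ℕ) :
    cost (gatherFrom (∅ : HMap κ (List ν)) l) (fun _ g => (g.map w).sum) =
      (l.map fun x => w x.2).sum := by
  induction l using List.reverseRecOn with
  | nil => simp [gatherFrom, cost]
  | append_singleton l x ih =>
    rw [gatherFrom_append, gatherFrom_singleton]
    have := cost_insert (gatherFrom (∅ : HMap κ (List ν)) l) (fun _ g => (g.map w).sum) x.1
      (x.2 :: ((gatherFrom (∅ : HMap κ (List ν)) l).lookup x.1).getD [])
    simp only [List.map_cons, List.sum_cons] at this
    simp only [List.map_append, List.sum_append, List.map_cons, List.map_nil, List.sum_cons,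
      List.sum_nil]
    cases h : (gatherFrom (∅ : HMap κ (List ν)) l).lookup x.1 with
    | none => simp [h] at this ⊢; omega
    | some g => simp [h] at this ⊢; omega

theorem cost_mono (m : HMap κ ν) {f f' : κ → ν → ℕ}
    (h : ∀ k v, m.lookup k = some v → f k v ≤ f' k v) : cost m f ≤ cost m f' := by
  refine List.sum_le_sum fun e he => h _ _ ?_
  exact (mem_entries_iff m e).1 he

end HMap

end FPCSA

/-! ### Classes as doubly linked lists -/

namespace FPCSA

open Prog

variable {K A Q : Type*}

/-- The lists `L c` are pairwise disjoint, and they are stored in the memory as doubly linked lists. -/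
structure Linked (s : Mem K A Q) (L : ℕ → List (Aug Q)) : Prop where
  nodup : ∀ c, (L c).Nodup
  disj : ∀ c c' p, p ∈ L c → p ∈ L c' → c = c'
  empty : ∀ c, s.numCls ≤ c → L c = []
  first : ∀ c < s.numCls, s.first c = (L c).head?
  size : ∀ c < s.numCls, s.size c = (L c).length
  next : ∀ c l₁ p l₂, L c = l₁ ++ p :: l₂ → s.next p = l₂.head?
  prev : ∀ c l₁ p l₂, L c = l₁ ++ p :: l₂ → s.prev p = l₁.getLast?

/-- The parts of the memory that are not used by the doubly linked lists are the same. -/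
structure SameOutsideLists (s s' : Mem K A Q) : Prop where
  inc : s'.inc = s.inc
  queue : s'.queue = s.queue
  head : s'.head = s.head
  tail : s'.tail = s.tail
  queued : s'.queued = s.queued
  quot : s'.quot = s.quot
  numCls : s'.numCls = s.numCls

theorem SameOutsideLists.trans {s s' s'' : Mem K A Q} (h : SameOutsideLists s s')
    (h' : SameOutsideLists s' s'') : SameOutsideLists s s'' where
  inc := h'.inc.trans h.inc
  queue := h'.queue.trans h.queue
  head := h'.head.trans h.head
  tail := h'.tail.trans h.tail
  queued := h'.queued.trans h.queued
  quot := h'.quot.trans h.quot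
  numCls := h'.numCls.trans h.numCls

variable [DecidableEq Q]

/-- A place of `q` in the shortened list is a place of `q` in the old one, with `p` put back. The
neighbours of `q` are the same in both, except for the two states that were adjacent to `p`. -/
theorem Linked.delete {s s' : Mem K A Q} {L : ℕ → List (Aug Q)} (h : Linked s L) {c : ℕ}
    {p : Aug Q} {l₁ l₂ : List (Aug Q)} (hL : L c = l₁ ++ p :: l₂)
    (hn : s'.numCls = s.numCls)
    (hfirst : ∀ x, s'.first x = if x = c ∧ l₁ = [] then l₂.head? else s.first x)
    (hsize : ∀ x, s'.size x = if x = c then s.size c - 1 else s.size x)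
    (hnext : ∀ q, s'.next q = if l₁.getLast? = some q then l₂.head? else s.next q)
    (hprev : ∀ q, s'.prev q = if l₂.head? = some q then l₁.getLast? else s.prev q) :
    Linked s' (Function.update L c (l₁ ++ l₂)) := by
  have hnd := h.nodup c
  rw [hL] at hnd
  have hsub : ∀ x q, q ∈ Function.update L c (l₁ ++ l₂) x → q ∈ L x := by
    intro x q hq
    by_cases hx : x = c
    · subst hx; simp at hq; rw [hL]; simp; tauto
    · simpa [hx] using hq
  have hclt : c < s.numCls := by
    by_contra hc
    have := h.empty c (by omega)
    simp [hL] at this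
  refine ⟨?_, ?_, ?_, ?_, ?_, ?_, ?_⟩
  · intro x
    by_cases hx : x = c
    · subst hx
      simp only [Function.update_self]
      grind
    · simpa [hx] using h.nodup x
  · intro x x' q hq hq'
    exact h.disj x x' q (hsub _ _ hq) (hsub _ _ hq')
  · intro x hx
    have hxc : x ≠ c := by omega
    simpa [hxc] using h.empty x (by omega)
  · intro x hx
    rw [hfirst]
    have := h.first x (by omega)
    by_cases hxc : x = c
    · subst hxc
      simp only [Function.update_self, true_and]
      cases l₁ with
      | nil => simp
      | cons y l => simp [this, hL]
    · simpa [hxc] using this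
  · intro x hx
    rw [hsize]
    have := h.size x (by omega)
    by_cases hxc : x = c
    · subst hxc
      simp [this, hL]
    · simpa [hxc] using this
  · intro x k₁ q k₂ hk
    rw [hnext]
    by_cases hxc : x = c
    · subst hxc
      simp only [Function.update_self] at hk
      rcases List.append_eq_append_iff.1 hk with ⟨r, rfl, hr⟩ | ⟨r, rfl, hr⟩
      · have hq : q ∈ l₂ := by rw [hr]; simp
        rw [if_neg, h.next x (l₁ ++ p :: r) q k₂ (by simp [hL, hr])]
        intro hq'
        have := List.mem_of_getLast? hq'
        grind
      · cases r with
        | nil =>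
          simp at hr
          have hq : q ∈ l₂ := by rw [← hr]; simp
          rw [if_neg, h.next x (k₁ ++ [p]) q k₂ (by simp [hL, hr])]
          intro hq'
          have := List.mem_of_getLast? hq'
          grind
        | cons z r =>
          -- Here `q` lies in `l₁`. It is its last element exactly if the rest `r` is empty, and
          -- that is the only state whose successor changes.
          simp at hr
          obtain ⟨rfl, rfl⟩ := hr
          cases r using List.reverseRecOn with
          | nil => simp
          | append_singleton r y =>
            rw [if_neg, h.next x k₁ q _ (by simp [hL]; rfl)]
            · simp
            · intro hq'
              rw [← List.cons_append, ← List.append_assoc, List.getLast?_concat] at hq'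
              grind
    · have hk' : L x = k₁ ++ q :: k₂ := by simpa [hxc] using hk
      rw [if_neg, h.next x k₁ q k₂ hk']
      intro hq'
      have h1 := List.mem_of_getLast? hq'
      exact hxc (h.disj x c q (by simp [hk']) (by simp [hL, h1]))
  · intro x k₁ q k₂ hk
    rw [hprev]
    by_cases hxc : x = c
    · subst hxc
      simp only [Function.update_self] at hk
      have hdec : (∃ r, l₁ = k₁ ++ q :: r) ∨ ∃ r, l₂ = r ++ q :: k₂ ∧ k₁ = l₁ ++ r := by
        rcases List.append_eq_append_iff.1 hk with ⟨r, h1, hr⟩ | ⟨r, h1, hr⟩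
        · exact .inr ⟨r, hr, h1⟩
        · cases r with
          | nil => simp at hr h1; exact .inr ⟨[], by simp [hr], by simp [h1]⟩
          | cons z r => simp at hr; exact .inl ⟨r, by simp [h1, hr.1]⟩
      rcases hdec with ⟨r, rfl⟩ | ⟨r, rfl, rfl⟩
      · rw [if_neg, h.prev x k₁ q (r ++ p :: l₂) (by simp [hL])]
        intro hq'
        have := List.mem_of_head? hq'
        grind
      · cases r with
        | nil => simp
        | cons y r =>
          rw [if_neg, h.prev x (l₁ ++ p :: y :: r) q _ (by simp [hL]; rfl)]
          · simp [List.getLast?_append, List.getLast?_cons]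
          · intro hq'
            simp at hq'
            grind
    · have hk' : L x = k₁ ++ q :: k₂ := by simpa [hxc] using hk
      rw [if_neg, h.prev x k₁ q k₂ hk']
      intro hq'
      have h1 := List.mem_of_head? hq'
      exact hxc (h.disj x c q (by simp [hk']) (by simp [hL, h1]))

theorem Linked.insert {s s' : Mem K A Q} {L : ℕ → List (Aug Q)} (h : Linked s L) {c : ℕ}
    {p : Aug Q} (hc : c < s.numCls) (hp : ∀ x, p ∉ L x)
    (hn : s'.numCls = s.numCls)
    (hfirst : s'.first = Function.update s.first c (some p))
    (hsize : s'.size = Function.update s.size c (s.size c + 1))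
    (hnext : s'.next = Function.update s.next p (L c).head?)
    (hprev : ∀ q, s'.prev q =
      if (L c).head? = some q then some p else if q = p then none else s.prev q) :
    Linked s' (Function.update L c (p :: L c)) := by
  have hmem : ∀ x q, q ∈ Function.update L c (p :: L c) x → q ∈ L x ∨ (x = c ∧ q = p) := by
    intro x q hq
    by_cases hx : x = c
    · subst hx; simp at hq; tauto
    · left; simpa [hx] using hq
  refine ⟨?_, ?_, ?_, ?_, ?_, ?_, ?_⟩
  · intro x
    by_cases hx : x = c
    · subst hx; simp [hp, h.nodup]
    · simpa [hx] using h.nodup x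
  · intro x x' q hq hq'
    rcases hmem _ _ hq with h1 | ⟨rfl, rfl⟩ <;> rcases hmem _ _ hq' with h2 | ⟨rfl, h2⟩
    · exact h.disj _ _ _ h1 h2
    · subst h2; exact absurd h1 (hp _)
    · exact absurd h2 (hp _)
    · rfl
  · intro x hx
    have hxc : x ≠ c := by omega
    simpa [hxc] using h.empty x (by omega)
  · intro x hx
    rw [hfirst]
    have := h.first x (by omega)
    by_cases hxc : x = c
    · subst hxc; simp
    · simpa [hxc] using this
  · intro x hx
    rw [hsize]
    have := h.size x (by omega)
    by_cases hxc : x = c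
    · subst hxc; simp [this]
    · simpa [hxc] using this
  · intro x k₁ q k₂ hk
    rw [hnext]
    by_cases hxc : x = c
    · subst hxc
      simp only [Function.update_self] at hk
      cases k₁ with
      | nil => simp at hk; simp [← hk.1, ← hk.2]
      | cons y k₁ =>
        simp at hk
        have hq : q ≠ p := by rintro rfl; exact hp x (by simp [hk.2])
        simpa [hq] using h.next x k₁ q k₂ hk.2
    · have hk' : L x = k₁ ++ q :: k₂ := by simpa [hxc] using hk
      have hq : q ≠ p := by rintro rfl; exact hp x (by simp [hk'])
      simpa [hq] using h.next x k₁ q k₂ hk'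
  · intro x k₁ q k₂ hk
    rw [hprev]
    by_cases hxc : x = c
    · subst hxc
      simp only [Function.update_self] at hk
      cases k₁ with
      | nil =>
        simp at hk
        rw [if_neg, if_pos hk.1.symm]
        · rfl
        · intro hq; exact hp x (by rw [hk.1]; exact List.mem_of_head? hq)
      | cons y k₁ =>
        simp at hk
        have hq : q ≠ p := by rintro rfl; exact hp x (by simp [hk.2])
        have hnd := h.nodup x
        rw [hk.2] at hnd
        cases k₁ with
        | nil => simp [hk.2, hk.1]
        | cons z k₁ =>
          have hzq : z ≠ q := by grind
          rw [if_neg (by simp [hk.2, hzq]), if_neg hq, h.prev x _ q k₂ hk.2]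
          simp [List.getLast?_cons]
    · have hk' : L x = k₁ ++ q :: k₂ := by simpa [hxc] using hk
      have hq : q ≠ p := by rintro rfl; exact hp x (by simp [hk'])
      rw [if_neg, if_neg hq, h.prev x k₁ q k₂ hk']
      intro hq'
      exact hxc (h.disj x c q (by simp [hk']) (List.mem_of_head? hq'))

theorem post_unlink {s : Mem K A Q} {L : ℕ → List (Aug Q)} (h : Linked s L) {c : ℕ} {p : Aug Q}
    (hp : p ∈ L c) :
    (unlink c p).Post s fun _ s' t => Linked s' (Function.update L c ((L c).erase p)) ∧
      SameOutsideLists s s' ∧ s'.cls = s.cls ∧ t ≤ 6 := by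
  obtain ⟨l₁, l₂, hp₁, hL, he⟩ := List.exists_erase_eq hp
  rw [he]
  have hx := h.prev c l₁ p l₂ hL
  have hy := h.next c l₁ p l₂ hL
  simp only [unlink, getPrev, getNext, post_bind, post_get, post_seq, hx, hy]
  rcases l₁.eq_nil_or_concat' with rfl | ⟨l₁, x, rfl⟩ <;> rcases l₂ with _ | ⟨y, l₂⟩ <;>
  · simp only [List.getLast?_nil, List.head?_nil, List.head?_cons, List.getLast?_concat, setFirst,
      setPrev, setNext, getSize, setSize, post_put, post_get, post_tick]
    refine ⟨h.delete hL rfl ?_ ?_ ?_ ?_, ⟨rfl, rfl, rfl, rfl, rfl, rfl, rfl⟩, trivial,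
      by omega⟩ <;>
    · intro z
      simp [Function.update_apply, @eq_comm _ z]

theorem post_link {s : Mem K A Q} {L : ℕ → List (Aug Q)} (h : Linked s L) {c : ℕ} {p : Aug Q}
    (hc : c < s.numCls) (hp : ∀ x, p ∉ L x) :
    (link c p).Post s fun _ s' t => Linked s' (Function.update L c (p :: L c)) ∧
      SameOutsideLists s s' ∧ s'.cls = Function.update s.cls p c ∧ t ≤ 8 := by
  have hf := h.first c hc
  simp only [link, getFirst, post_bind, post_get, post_seq, hf]
  rcases hL : L c with _ | ⟨y, l⟩ <;>
  · rw [← hL]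
    simp [setFirst, setPrev, setNext, getSize, setSize, setCls, hL]
    rw [← hL]
    refine ⟨h.insert hc hp rfl rfl rfl (by simp [hL]) ?_, ⟨rfl, rfl, rfl, rfl, rfl, rfl, rfl⟩⟩
    intro z
    simp [hL, Function.update_apply, eq_comm]

/-- The lists `L c` are the classes of the current partition, and they are stored in the memory. -/
structure IsPartition (s : Mem K A Q) (L : ℕ → List (Aug Q)) : Prop extends Linked s L where
  mem_iff : ∀ p c, p ∈ L c ↔ s.cls p = c

theorem IsPartition.cls_lt {s : Mem K A Q} {L : ℕ → List (Aug Q)} (h : IsPartition s L)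
    (p : Aug Q) : s.cls p < s.numCls := by
  by_contra hc
  have h1 := h.empty (s.cls p) (by omega)
  have h2 := (h.mem_iff p _).2 rfl
  simp [h1] at h2

/-- Between the two operations `p` lies in no list, so that the partition property fails there and
only `Linked` is available; this is why the two notions are separate. -/
theorem post_unlink_link {s : Mem K A Q} (h : ∃ L, IsPartition s L) {e : ℕ} {p : Aug Q}
    (he : e < s.numCls) (hpe : s.cls p ≠ e) :
    ((unlink (s.cls p) p).seq (link e p)).Post s fun _ s' t => (∃ L, IsPartition s' L) ∧
      SameOutsideLists s s' ∧ s'.cls = Function.update s.cls p e ∧ t ≤ 14 := by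
  obtain ⟨L, h⟩ := h
  rw [post_seq]
  have hp := (h.mem_iff p _).2 rfl
  refine (post_unlink h.toLinked hp).mono ?_
  rintro - s₁ t₁ ⟨h₁, hs₁, hc₁, ht₁⟩
  have hp' : ∀ x, p ∉ Function.update L (s.cls p) ((L (s.cls p)).erase p) x := by
    intro x
    by_cases hx : x = s.cls p
    · subst hx; simpa using (h.nodup _).not_mem_erase
    · simp only [Function.update_of_ne hx, h.mem_iff]; tauto
  refine (post_link h₁ (hs₁.numCls ▸ he) hp').mono ?_
  rintro - s₂ t₂ ⟨h₂, hs₂, hc₂, ht₂⟩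
  refine ⟨⟨_, h₂, ?_⟩, hs₁.trans hs₂, by rw [hc₂, hc₁], by omega⟩
  intro q c
  rw [hc₂, hc₁]
  have hnd := h.nodup (s.cls p)
  by_cases hce : c = e
  · subst hce
    by_cases hqp : q = p
    · subst hqp; simp
    · simp [hqp, Ne.symm hpe, h.mem_iff]
  · by_cases hcp : c = s.cls p
    · subst hcp
      by_cases hqp : q = p
      · subst hqp; simp [hce, hnd.not_mem_erase, Ne.symm hpe]
      · simp [hce, List.mem_erase_of_ne hqp, h.mem_iff, hqp]
    · by_cases hqp : q = p
      · subst hqp; simp [hce, hcp, h.mem_iff, Ne.symm hcp, Ne.symm hce]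
      · simp [hce, hcp, h.mem_iff, hqp]

/-- The family `L` stays the same, as it is already empty at the new name. An empty class is
admitted by `Linked`, and is filled at once by the callers. -/
theorem post_newClass {s : Mem K A Q} {L : ℕ → List (Aug Q)} (h : Linked s L) :
    newClass.Post s fun e s' t => e = s.numCls ∧ Linked s' L ∧ s'.cls = s.cls ∧
      s'.numCls = s.numCls + 1 ∧ s'.queued = Function.update s.queued s.numCls false ∧
      s'.inc = s.inc ∧ s'.queue = s.queue ∧ s'.head = s.head ∧ s'.tail = s.tail ∧
      s'.quot = s.quot ∧ t = 5 := by
  simp only [newClass, getNumCls, setNumCls, setFirst, setSize, setQueued, post_bind,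
    post_get, post_seq, post_put, post_pure]
  refine ⟨trivial, ⟨h.nodup, h.disj, fun c hc => h.empty c (by simp at hc; omega), ?_, ?_, h.next,
    h.prev⟩, by simp⟩ <;>
  · intro c hc
    by_cases hcn : c = s.numCls
    · subst hcn; simp [h.empty]
    · have hc' : c < s.numCls := by simp at hc; omega
      simp [h.first c hc', h.size c hc', hcn]

theorem post_splitOff {s : Mem K A Q} (h : ∃ L, IsPartition s L) {c : ℕ} {g : List (Aug Q)}
    (hc : c < s.numCls) (hg : g.Nodup) (hgc : ∀ p ∈ g, s.cls p = c) :
    (splitOff c g).Post s fun e s' t => e = s.numCls ∧ (∃ L, IsPartition s' L) ∧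
      (∀ p, s'.cls p = if p ∈ g then s.numCls else s.cls p) ∧
      s'.numCls = s.numCls + 1 ∧ s'.queued = Function.update s.queued s.numCls false ∧
      s'.inc = s.inc ∧ s'.queue = s.queue ∧ s'.head = s.head ∧ s'.tail = s.tail ∧
      s'.quot = s.quot ∧ t ≤ 6 + 15 * g.length := by
  obtain ⟨L, h⟩ := h
  simp only [splitOff, post_bind, post_seq, post_pure]
  refine (post_newClass h.toLinked).mono ?_
  rintro _ s₀ t₀ ⟨rfl, h₀, hcls, hnum, hqd, hinc, hq, hh, htl, hqt, rfl⟩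
  refine (post_forEach (fun pre s' => (∃ L, IsPartition s' L) ∧ SameOutsideLists s₀ s' ∧
    ∀ p, s'.cls p = if p ∈ pre then s.numCls else s.cls p) (fun _ => 14)
    ⟨⟨L, h₀, hcls ▸ h.mem_iff⟩, ⟨rfl, rfl, rfl, rfl, rfl, rfl, rfl⟩,
      by intro p; simp [hcls]⟩ ?_).mono ?_
  · rintro pre p post s₁ rfl ⟨h₁, hs₁, hc₁⟩
    have hpp : p ∉ pre := by grind
    have hpc : s₁.cls p = c := by rw [hc₁, if_neg hpp]; exact hgc p (by simp)
    rw [← hpc]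
    refine (post_unlink_link h₁ (by rw [hs₁.numCls]; omega) (by omega)).mono ?_
    rintro - s₂ t₂ ⟨h₂, hs₂, hc₂, ht₂⟩
    refine ⟨⟨h₂, hs₁.trans hs₂, ?_⟩, ht₂⟩
    intro q
    rw [hc₂]
    by_cases hqp : q = p
    · subst hqp; simp
    · simp [hqp, hc₁]
  · rintro - s₁ t₁ ⟨⟨h₁, hs₁, hc₁⟩, ht₁⟩
    refine ⟨rfl, h₁, hc₁, hs₁.numCls.trans hnum, hs₁.queued.trans hqd, hs₁.inc.trans hinc,
      hs₁.queue.trans hq, hs₁.head.trans hh, hs₁.tail.trans htl, hs₁.quot.trans hqt, ?_⟩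
    simp at ht₁
    omega

end FPCSA

/-! ### The queue, and the splitting of a class -/

namespace FPCSA

open Prog

variable {K A Q : Type*}

/-- The flags `queued` and the array `queue` agree, and no class is twice in the queue. -/
structure IsQueue (s : Mem K A Q) : Prop where
  le : s.head ≤ s.tail
  inj : ∀ i j, s.head ≤ i → i < s.tail → s.head ≤ j → j < s.tail → s.queue i = s.queue j → i = j
  queued_iff : ∀ c, c < s.numCls →
    (s.queued c = true ↔ ∃ j, s.head ≤ j ∧ j < s.tail ∧ s.queue j = c)
  lt : ∀ j, s.head ≤ j → j < s.tail → s.queue j < s.numCls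

/-- The memory stores a partition into nonempty classes and a queue of classes. -/
structure Good (s : Mem K A Q) : Prop where
  isPartition : ∃ L, IsPartition s L
  isQueue : IsQueue s
  nonempty : ∀ c < s.numCls, ∃ p, s.cls p = c

/-- The parts of the memory that are not used by the queue are the same. -/
structure SameOutsideQueue (s s' : Mem K A Q) : Prop where
  inc : s'.inc = s.inc
  cls : s'.cls = s.cls
  next : s'.next = s.next
  prev : s'.prev = s.prev
  first : s'.first = s.first
  size : s'.size = s.size
  numCls : s'.numCls = s.numCls
  head : s'.head = s.head
  quot : s'.quot = s.quot

theorem SameOutsideQueue.refl (s : Mem K A Q) : SameOutsideQueue s s :=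
  ⟨rfl, rfl, rfl, rfl, rfl, rfl, rfl, rfl, rfl⟩

theorem SameOutsideQueue.trans {s s' s'' : Mem K A Q} (h : SameOutsideQueue s s')
    (h' : SameOutsideQueue s' s'') : SameOutsideQueue s s'' where
  inc := h'.inc.trans h.inc
  cls := h'.cls.trans h.cls
  next := h'.next.trans h.next
  prev := h'.prev.trans h.prev
  first := h'.first.trans h.first
  size := h'.size.trans h.size
  numCls := h'.numCls.trans h.numCls
  head := h'.head.trans h.head
  quot := h'.quot.trans h.quot

theorem IsPartition.congr {s s' : Mem K A Q} {L : ℕ → List (Aug Q)} (h : IsPartition s L)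
    (hcls : s'.cls = s.cls) (hnext : s'.next = s.next) (hprev : s'.prev = s.prev)
    (hfirst : s'.first = s.first) (hsize : s'.size = s.size) (hnum : s'.numCls = s.numCls) :
    IsPartition s' L where
  nodup := h.nodup
  disj := h.disj
  empty := hnum ▸ h.empty
  first := hnum ▸ hfirst ▸ h.first
  size := hnum ▸ hsize ▸ h.size
  next := hnext ▸ h.next
  prev := hprev ▸ h.prev
  mem_iff := hcls ▸ h.mem_iff

theorem SameOutsideQueue.isPartition {s s' : Mem K A Q} {L : ℕ → List (Aug Q)}
    (h : SameOutsideQueue s s') (hs : IsPartition s L) : IsPartition s' L :=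
  hs.congr h.cls h.next h.prev h.first h.size h.numCls

theorem post_enqueue {s : Mem K A Q} (h : IsQueue s) {e : ℕ} (he : e < s.numCls)
    (hq : s.queued e = false) :
    (enqueue e).Post s fun _ s' t => IsQueue s' ∧ SameOutsideQueue s s' ∧
      s'.queued = Function.update s.queued e true ∧ t = 4 := by
  simp only [enqueue, getTail, setQueue, setTail, setQueued, post_bind, post_get, post_seq,
    post_put]
  have hne : ∀ j, s.head ≤ j → j < s.tail → s.queue j ≠ e := by
    intro j h1 h2 h3
    have := (h.queued_iff e he).2 ⟨j, h1, h2, h3⟩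
    simp [hq] at this
  have hle := h.le
  refine ⟨⟨?_, ?_, ?_, ?_⟩, ⟨rfl, rfl, rfl, rfl, rfl, rfl, rfl, rfl, rfl⟩, trivial, trivial⟩
  · simp; omega
  · intro i j hi hi' hj hj' hij
    simp only at hi hi' hj hj' hij
    by_cases h1 : i = s.tail <;> by_cases h2 : j = s.tail
    · omega
    · simp only [h1, Function.update_self, Function.update_of_ne h2] at hij
      exact absurd hij.symm (hne j hj (by omega))
    · simp only [h2, Function.update_self, Function.update_of_ne h1] at hij
      exact absurd hij (hne i hi (by omega))
    · simp only [Function.update_of_ne h1, Function.update_of_ne h2] at hij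
      exact h.inj i j hi (by omega) hj (by omega) hij
  · intro c hc
    simp only at hc ⊢
    by_cases hce : c = e
    · subst hce
      simp only [Function.update_self, true_iff]
      exact ⟨s.tail, hle, by omega, by simp⟩
    · rw [Function.update_of_ne hce, h.queued_iff c hc]
      constructor
      · rintro ⟨j, h1, h2, h3⟩
        exact ⟨j, h1, by omega, by rw [Function.update_of_ne (by omega), h3]⟩
      · rintro ⟨j, h1, h2, h3⟩
        by_cases hj : j = s.tail
        · subst hj; simp at h3; exact absurd h3.symm hce
        · rw [Function.update_of_ne hj] at h3
          exact ⟨j, h1, by omega, h3⟩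
  · intro j h1 h2
    simp only at h1 h2 ⊢
    by_cases hj : j = s.tail
    · subst hj; simpa using he
    · rw [Function.update_of_ne hj]; exact h.lt j h1 (by omega)

/-- The predicate `S` lets one lemma serve both loops of `splitClass`: the one that enqueues every
new class, and the one that leaves out a largest subclass. -/
theorem post_forEach_enqueue {s : Mem K A Q} (h : IsQueue s) {l : List ℕ} (S : ℕ → Prop)
    {f : ℕ → Prog (Mem K A Q) Unit} (hl : l.Nodup) (hlt : ∀ e ∈ l, e < s.numCls)
    (hq : ∀ e ∈ l, s.queued e = false) (hf : ∀ e ∈ l, S e → f e = enqueue e)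
    (hf' : ∀ e ∈ l, ¬ S e → f e = tick 1) :
    (forEach l f).Post s fun _ s' t => IsQueue s' ∧ SameOutsideQueue s s' ∧
      (∀ e, s'.queued e = true ↔ s.queued e = true ∨ (e ∈ l ∧ S e)) ∧ t ≤ 1 + 5 * l.length := by
  refine (post_forEach (fun pre s' => IsQueue s' ∧ SameOutsideQueue s s' ∧
      ∀ e, s'.queued e = true ↔ s.queued e = true ∨ (e ∈ pre ∧ S e)) (fun _ => 4)
      ⟨h, .refl s, by simp⟩ ?_).mono ?_
  · rintro pre x post s₁ rfl ⟨h₁, hs₁, hq₁⟩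
    by_cases hx : S x
    · rw [hf x (by simp) hx]
      have hxq : s₁.queued x = false := by
        rw [← Bool.not_eq_true, hq₁, hq x (by simp)]
        simp
        grind
      refine (post_enqueue h₁ (hs₁.numCls ▸ hlt x (by simp)) hxq).mono ?_
      rintro - s₂ t ⟨h₂, hs₂, hq₂, rfl⟩
      refine ⟨⟨h₂, hs₁.trans hs₂, ?_⟩, le_rfl⟩
      intro e
      rw [hq₂]
      by_cases hex : e = x
      · subst hex; simp [hx]
      · simp [hex, hq₁]
    · rw [hf' x (by simp) hx, post_tick]
      refine ⟨⟨h₁, hs₁, fun e => ?_⟩, by omega⟩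
      rw [hq₁]
      by_cases hex : e = x
      · subst hex; simp [hx]
      · simp [hex]
  · rintro - s₁ t ⟨⟨h₁, hs₁, hq₁⟩, ht⟩
    refine ⟨h₁, hs₁, hq₁, ?_⟩
    simp at ht
    omega

theorem post_largest (tie : ℕ → ℕ → Bool) (c : ℕ) (l : List ℕ) (s : Mem K A Q) :
    (largest tie c l).Post s fun m s' t => m ∈ c :: l ∧ (∀ e ∈ c :: l, s.size e ≤ s.size m) ∧
      s' = s ∧ t ≤ 1 + 4 * l.length := by
  refine (post_foldEach (fun pre m s' => m ∈ c :: pre ∧ (∀ e ∈ c :: pre, s.size e ≤ s.size m) ∧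
      s' = s) (fun _ => 3) ⟨by simp, by simp, rfl⟩ ?_).mono ?_
  · rintro pre x post m s' - ⟨hm, hmax, rfl⟩
    simp only [getSize, post_bind, post_get, post_seq, post_tick, post_pure]
    refine ⟨⟨?_, ?_, trivial⟩, by omega⟩
    · split_ifs
      · simp
      · simp at hm ⊢; tauto
    · intro e he
      have he' : e ∈ c :: pre ∨ e = x := by simp at he ⊢; tauto
      split_ifs with hif
      · rcases he' with he' | rfl
        · have := hmax e he'; omega
        · exact le_rfl
      · rcases he' with he' | rfl
        · exact hmax e he'
        · omega
  · rintro m s' t ⟨⟨hm, hmax, rfl⟩, ht⟩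
    refine ⟨hm, hmax, rfl, ?_⟩
    simp at ht
    omega

/-! ### Splitting a single class -/

/-- `gs` are the lists of the states of the class `c` with equal nonzero signature. -/
structure IsGrouping {β : Type*} (cls : Aug Q → ℕ) (c : ℕ) (σ : Aug Q → β) (z : β)
    (gs : List (List (Aug Q))) : Prop where
  ne_nil : gs ≠ []
  group_ne_nil : ∀ g ∈ gs, g ≠ []
  nodup : gs.flatten.Nodup
  mem_flatten : ∀ p, p ∈ gs.flatten ↔ cls p = c ∧ σ p ≠ z
  mem_group : ∀ g ∈ gs, ∀ p ∈ g, ∀ q, q ∈ g ↔ cls q = c ∧ σ q = σ p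

/-- The memory `s'` is obtained from `s` by splitting the class `c` according to `σ`. -/
structure IsSplit {β : Type*} (s s' : Mem K A Q) (c : ℕ) (σ : Aug Q → β) : Prop where
  good : Good s'
  inc : s'.inc = s.inc
  head : s'.head = s.head
  quot : s'.quot = s.quot
  numCls_le : s.numCls ≤ s'.numCls
  cls_other : ∀ p, s.cls p ≠ c → s'.cls p = s.cls p
  cls_self : ∀ p, s.cls p = c → s'.cls p = c ∨ s.numCls ≤ s'.cls p
  cls_iff : ∀ p q, s.cls p = c → s.cls q = c → (s'.cls p = s'.cls q ↔ σ p = σ q)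
  queued_other : ∀ e < s.numCls, e ≠ c → s'.queued e = s.queued e
  queued_self : s.queued c = true → ∀ p, s.cls p = c → s'.queued (s'.cls p) = true
  not_queued_self : s.queued c = false → ∃ m, ∀ p, s.cls p = c →
    (s'.cls p ≠ m → s'.queued (s'.cls p) = true) ∧
    (s'.queued (s'.cls p) = true → 2 * s'.size (s'.cls p) ≤ s.size c)

variable [DecidableEq Q]

/-- The groups `gs` have been moved to new classes, whose names are those of the list `news`. -/
structure Moved (s s' : Mem K A Q) (gs : List (List (Aug Q))) (news : List ℕ) : Prop where
  isPartition : ∃ L, IsPartition s' L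
  inc : s'.inc = s.inc
  queue : s'.queue = s.queue
  head : s'.head = s.head
  tail : s'.tail = s.tail
  quot : s'.quot = s.quot
  numCls_le : s.numCls ≤ s'.numCls
  queued : ∀ e < s.numCls, s'.queued e = s.queued e
  queued_new : ∀ e, s.numCls ≤ e → e < s'.numCls → s'.queued e = false
  cls_old : ∀ p, p ∉ gs.flatten → s'.cls p = s.cls p
  cls_new : ∀ p, p ∈ gs.flatten → s.numCls ≤ s'.cls p
  cls_iff : ∀ g ∈ gs, ∀ p ∈ g, ∀ q, s'.cls q = s'.cls p ↔ q ∈ g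
  nonempty : ∀ e, s.numCls ≤ e → e < s'.numCls → ∃ p, s'.cls p = e
  mem_news : ∀ e, e ∈ news ↔ s.numCls ≤ e ∧ e < s'.numCls
  nodup_news : news.Nodup
  length_news : news.length = gs.length

/-- The groups are disjoint, so when a group has its turn, its states are still in `c`. Every group
receives the next free name. -/
theorem post_moveGroups {s : Mem K A Q} (h : ∃ L, IsPartition s L) {c : ℕ}
    {gs : List (List (Aug Q))} (hc : c < s.numCls) (hne : ∀ g ∈ gs, g ≠ [])
    (hgs : gs.flatten.Nodup) (hgc : ∀ p ∈ gs.flatten, s.cls p = c) :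
    (foldEach gs [] fun news g =>
      (splitOff c g).bind fun e => pure (e :: news)).Post s fun news s' t =>
      Moved s s' gs news ∧ t ≤ 1 + (gs.map fun g => 7 + 15 * g.length).sum := by
  refine (post_foldEach (fun pre news s' => Moved s s' pre news) (fun g => 6 + 15 * g.length)
    ?_ ?_).mono ?_
  · exact ⟨h, rfl, rfl, rfl, rfl, rfl, le_rfl, fun _ _ => rfl, by intros; omega, by simp, by simp,
      by simp, by intros; omega, by intros; simp, by simp, by simp⟩
  · rintro pre g post news s₁ rfl h₁
    rw [post_bind]
    have hnd : (pre.flatten ++ (g ++ post.flatten)).Nodup := by simpa using hgs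
    have hgpre : ∀ p ∈ g, p ∉ pre.flatten := by
      intro p hp hp'
      exact (List.disjoint_of_nodup_append hnd) hp' (by simp [hp])
    have hgc' : ∀ p ∈ g, s₁.cls p = c := by
      intro p hp
      rw [h₁.cls_old p (hgpre p hp)]
      exact hgc p (by simp [hp])
    have hg : g.Nodup := by
      have := hnd.of_append_right
      exact this.of_append_left
    have hle := h₁.numCls_le
    refine (post_splitOff h₁.isPartition (by omega) hg hgc').mono ?_
    rintro _ s₂ t ⟨rfl, hp₂, hcls, hnum, hqd, hinc, hq, hh, ht, hqt, htime⟩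
    rw [post_pure]
    have hlt : ∀ p, s₁.cls p < s₁.numCls := h₁.isPartition.elim fun _ h => h.cls_lt
    refine ⟨⟨hp₂, hinc.trans h₁.inc, hq.trans h₁.queue, hh.trans h₁.head, ht.trans h₁.tail,
      hqt.trans h₁.quot, by omega, ?_, ?_, ?_, ?_, ?_, ?_, ?_, ?_, ?_⟩, by simpa using htime⟩
    · intro e he
      rw [hqd, Function.update_of_ne (by omega), h₁.queued e he]
    · intro e he he'
      rw [hqd]
      by_cases hen : e = s₁.numCls
      · subst hen; simp
      · rw [Function.update_of_ne hen, h₁.queued_new e he (by omega)]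
    · intro p hp
      simp at hp
      rw [hcls, if_neg hp.2, h₁.cls_old p (by simpa using hp.1)]
    · intro p hp
      rw [hcls]
      split_ifs with hpg
      · exact hle
      · exact h₁.cls_new p (by simp at hp ⊢; tauto)
    · intro g' hg' p hp q
      rw [hcls, hcls]
      have hltp := hlt p
      have hltq := hlt q
      rcases List.mem_append.1 hg' with hg' | hg'
      · have hpg : p ∉ g := fun hpg => hgpre p hpg (List.mem_flatten.2 ⟨g', hg', hp⟩)
        rw [if_neg hpg]
        split_ifs with hqg
        · constructor
          · intro; omega
          · intro hq; exact absurd (List.mem_flatten.2 ⟨g', hg', hq⟩) (hgpre q hqg)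
        · exact h₁.cls_iff g' hg' p hp q
      · simp at hg'
        subst hg'
        rw [if_pos hp]
        split_ifs with hqg
        · simp [hqg]
        · simp [hqg]; omega
    · intro e he he'
      by_cases hen : e = s₁.numCls
      · obtain ⟨p, hp⟩ := List.exists_mem_of_ne_nil g (hne g (by simp))
        exact ⟨p, by rw [hcls, if_pos hp, hen]⟩
      · obtain ⟨p, hp⟩ := h₁.nonempty e he (by omega)
        refine ⟨p, ?_⟩
        rw [hcls, if_neg, hp]
        intro hpg
        have := hgc' p hpg
        have := h₁.cls_old p (hgpre p hpg)
        omega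
    · intro e
      rw [List.mem_cons, h₁.mem_news]
      omega
    · rw [List.nodup_cons, h₁.mem_news]
      exact ⟨by omega, h₁.nodup_news⟩
    · simp [h₁.length_news]
  · rintro news s' t ⟨h', ht⟩
    refine ⟨h', ht.trans (le_of_eq ?_)⟩
    congr 3
    funext g
    omega

theorem IsPartition.length_le {s : Mem K A Q} {L : ℕ → List (Aug Q)} (h : IsPartition s L) {c : ℕ}
    (hc : c < s.numCls) {l : List (Aug Q)} (hl : l.Nodup) (hlc : ∀ p ∈ l, s.cls p = c) :
    l.length ≤ s.size c := by
  rw [h.size c hc]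
  exact (hl.subperm fun p hp => (h.mem_iff p c).2 (hlc p hp)).length_le

/-- The groups that are moved to new classes: all of them if some states of the class have zero
signature, and all but the first one otherwise. -/
theorem IsGrouping.moved {β : Type*} {s s₁ : Mem K A Q} {c : ℕ} {σ : Aug Q → β} {z : β}
    {gs : List (List (Aug Q))} {news : List ℕ} (hg : IsGrouping s.cls c σ z gs) (hs : Good s)
    (hc : c < s.numCls)
    (h₁ : Moved s s₁ (if gs.flatten.length < s.size c then gs else gs.tail) news) :
    (∀ p q, s.cls p = c → s.cls q = c → (s₁.cls p = s₁.cls q ↔ σ p = σ q)) ∧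
      ∃ p, s₁.cls p = c := by
  obtain ⟨L, hL⟩ := hs.isPartition
  have hlt := hL.cls_lt
  -- Both cases reduce to two facts on the states that are not moved: they all have the same
  -- signature, and there is at least one, so that the name `c` is still in use.
  have key : ∀ gs' : List (List (Aug Q)), gs' ⊆ gs → Moved s s₁ gs' news →
      (∀ p q, s.cls p = c → s.cls q = c → p ∉ gs'.flatten → q ∉ gs'.flatten → σ p = σ q) →
      (∃ p, s.cls p = c ∧ p ∉ gs'.flatten) →
      (∀ p q, s.cls p = c → s.cls q = c → (s₁.cls p = s₁.cls q ↔ σ p = σ q)) ∧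
      ∃ p, s₁.cls p = c := by
    rintro gs' hsub hm hout ⟨r, hr, hr'⟩
    refine ⟨?_, r, by rw [hm.cls_old r hr', hr]⟩
    have hin : ∀ p q, s.cls p = c → s.cls q = c → p ∈ gs'.flatten →
        (s₁.cls q = s₁.cls p ↔ σ q = σ p) := by
      intro p q hp hq hp'
      obtain ⟨g, hgg, hpg⟩ := List.mem_flatten.1 hp'
      rw [hm.cls_iff g hgg p hpg q, hg.mem_group g (hsub hgg) p hpg q]
      tauto
    intro p q hp hq
    by_cases hp' : p ∈ gs'.flatten
    · rw [eq_comm, hin p q hp hq hp', eq_comm]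
    · by_cases hq' : q ∈ gs'.flatten
      · exact hin q p hq hp hq'
      · rw [hm.cls_old p hp', hm.cls_old q hq', hp, hq]
        simpa using hout p q hp hq hp' hq'
  split_ifs at h₁ with hlen
  · refine key gs (List.Subset.refl _) h₁ ?_ ?_
    · intro p q hp hq hp' hq'
      rw [hg.mem_flatten] at hp' hq'
      simp [hp, hq] at hp' hq'
      rw [hp', hq']
    -- If no state stayed in `c`, then its list would be no longer than the groups together, against
    -- `hlen`.
    · by_contra hcon
      push Not at hcon
      rw [hL.size c hc] at hlen
      have := ((hL.nodup c).subperm fun p hp => hcon p ((hL.mem_iff p c).1 hp)).length_le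
      omega
  · have hall : ∀ p, s.cls p = c → p ∈ gs.flatten := by
      intro p hp
      -- The groups fill the whole class by counting, hence no state has zero signature, and those
      -- that stay form the first group.
      have hsub : gs.flatten.Subperm (L c) :=
        hg.nodup.subperm fun q hq => (hL.mem_iff q c).2 ((hg.mem_flatten q).1 hq).1
      rw [hL.size c hc] at hlen
      exact (hsub.perm_of_length_le (by omega)).mem_iff.2 ((hL.mem_iff p c).2 hp)
    obtain ⟨g, gs', rfl⟩ := List.exists_cons_of_ne_nil hg.ne_nil
    have hnd := hg.nodup
    rw [List.flatten_cons] at hnd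
    refine key gs' (by simp) h₁ ?_ ?_
    · intro p q hp hq hp' hq'
      have hpg := hall p hp
      have hqg := hall q hq
      rw [List.flatten_cons, List.mem_append] at hpg hqg
      exact (((hg.mem_group g (by simp) q (by tauto) p).1 (by tauto)).2)
    · obtain ⟨p, hp⟩ := List.exists_mem_of_ne_nil g (hg.group_ne_nil g (by simp))
      exact ⟨p, ((hg.mem_flatten p).1 (by simp [hp])).1,
        fun hp' => List.disjoint_of_nodup_append hnd hp hp'⟩

theorem post_splitClass {β : Type*} (tie : ℕ → ℕ → Bool) {s : Mem K A Q} (hs : Good s) {c : ℕ}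
    (hc : c < s.numCls) {σ : Aug Q → β} {z : β} {gs : List (List (Aug Q))}
    (hg : IsGrouping s.cls c σ z gs) :
    (splitClass tie c gs).Post s fun _ s' t => IsSplit s s' c σ ∧
      t ≤ 14 + (gs.map fun g => 18 + 17 * g.length).sum := by
  obtain ⟨L, hL⟩ := hs.isPartition
  have hlt := hL.cls_lt
  rw [splitClass, post_bind]
  refine (post_foldEach (fun pre k s' => k = pre.flatten.length ∧ s' = s)
    (fun g => 1 + 2 * g.length) ⟨rfl, rfl⟩ ?_).mono ?_
  · rintro pre g post k s' - ⟨rfl, rfl⟩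
    rw [post_bind]
    refine (post_length g s').mono ?_
    rintro _ _ t ⟨rfl, rfl, ht⟩
    simpa using ht
  rintro _ s' t₀ ⟨⟨rfl, hs'⟩, ht₀⟩
  subst s'
  simp only [post_bind, post_seq, getSize, post_get, post_tick, getQueued]
  set gs' := if gs.flatten.length < s.size c then gs else gs.tail with hgs'
  have hsub : gs'.Sublist gs := by
    rw [hgs']; split_ifs
    · exact List.Sublist.refl _
    · exact List.tail_sublist _
  have hsubf : gs'.flatten.Sublist gs.flatten := hsub.flatten
  refine (post_moveGroups hs.isPartition hc (fun g h => hg.group_ne_nil g (hsub.subset h))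
    (hg.nodup.sublist hsubf) fun p hp => ((hg.mem_flatten p).1 (hsubf.subset hp)).1).mono ?_
  rintro news s₁ t₁ ⟨h₁, ht₁⟩
  obtain ⟨hiff, hne⟩ := hg.moved hs hc (hgs' ▸ h₁)
  have ht₁' : (gs'.map fun g => 7 + 15 * g.length).sum ≤ (gs.map fun g => 7 + 15 * g.length).sum :=
    (hsub.map _).sum_le_sum (by simp)
  have hlen : news.length ≤ gs.length := h₁.length_news ▸ hsub.length_le
  -- Per group: counting its states, moving them, and 9 steps for the new class, of which 4 are for
  -- the search of a largest class and 5 for the loop that fills the queue.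
  have hsum : (gs.map fun g => 18 + 17 * g.length).sum =
      (gs.map fun g => 1 + (1 + 2 * g.length)).sum + (gs.map fun g => 7 + 15 * g.length).sum +
        9 * gs.length := by
    clear * -
    induction gs with
    | nil => rfl
    | cons g gs ih => simp only [List.map_cons, List.sum_cons, List.length_cons, ih]; omega
  have hle := h₁.numCls_le
  have hq₁ : IsQueue s₁ := by
    refine ⟨by rw [h₁.head, h₁.tail]; exact hs.isQueue.le,
      by rw [h₁.head, h₁.tail, h₁.queue]; exact hs.isQueue.inj, ?_, ?_⟩
    · intro e he
      rw [h₁.head, h₁.tail, h₁.queue]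
      by_cases hen : e < s.numCls
      · rw [h₁.queued e hen, hs.isQueue.queued_iff e hen]
      · rw [h₁.queued_new e (by omega) he]
        simp only [Bool.false_eq_true, false_iff]
        rintro ⟨j, hj, hj', rfl⟩
        exact hen (hs.isQueue.lt j hj hj')
    · rw [h₁.head, h₁.tail, h₁.queue]
      intro j hj hj'
      exact (hs.isQueue.lt j hj hj').trans_le hle
  have hother : ∀ p, s.cls p ≠ c → s₁.cls p = s.cls p := by
    intro p hp
    exact h₁.cls_old p fun hp' => hp ((hg.mem_flatten p).1 (hsubf.subset hp')).1
  have hself : ∀ p, s.cls p = c → s₁.cls p = c ∨ s.numCls ≤ s₁.cls p := by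
    intro p hp
    by_cases hp' : p ∈ gs'.flatten
    · exact .inr (h₁.cls_new p hp')
    · exact .inl (by rw [h₁.cls_old p hp', hp])
  have hnonempty : ∀ e < s₁.numCls, ∃ p, s₁.cls p = e := by
    intro e he
    by_cases hen : e < s.numCls
    · by_cases hec : e = c
      · rw [hec]; exact hne
      · obtain ⟨p, hp⟩ := hs.nonempty e hen
        exact ⟨p, by rw [hother p (by omega), hp]⟩
    · exact h₁.nonempty e (by omega) he
  have hlt₁ : ∀ p, s₁.cls p < s₁.numCls := h₁.isPartition.elim fun _ h => h.cls_lt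
  have hback : ∀ p, s₁.cls p = c ∨ s₁.cls p ∈ news → s.cls p = c := by
    intro p hp
    by_contra hpc
    rw [hother p hpc, h₁.mem_news] at hp
    have := hlt p
    omega
  have hfwd : ∀ p, s.cls p = c → s₁.cls p = c ∨ s₁.cls p ∈ news := by
    intro p hp
    rw [h₁.mem_news]
    have := hlt₁ p
    have := hself p hp
    omega
  cases hqc : s.queued c with
  | true =>
    rw [h₁.queued c hc, hqc, if_pos rfl]
    refine (post_forEach_enqueue hq₁ (fun _ => True) h₁.nodup_news
      (fun e he => ((h₁.mem_news e).1 he).2)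
      (fun e he => h₁.queued_new e ((h₁.mem_news e).1 he).1 ((h₁.mem_news e).1 he).2)
      (fun _ _ _ => rfl) (by simp)).mono ?_
    rintro - s₂ t₂ ⟨hq₂, hs₂, hqd₂, ht₂⟩
    refine ⟨⟨⟨h₁.isPartition.imp fun _ => hs₂.isPartition, hq₂, ?_⟩, hs₂.inc.trans h₁.inc,
      hs₂.head.trans h₁.head, hs₂.quot.trans h₁.quot, hs₂.numCls ▸ hle, ?_, ?_, ?_, ?_, ?_, ?_⟩,
      by omega⟩
    · rw [hs₂.numCls, hs₂.cls]; exact hnonempty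
    · rw [hs₂.cls]; exact hother
    · rw [hs₂.cls]; exact hself
    · rw [hs₂.cls]; exact hiff
    · intro e he hec
      rw [Bool.eq_iff_iff, hqd₂, h₁.queued e he, h₁.mem_news]
      simp; omega
    · intro _ p hp
      rw [hs₂.cls, hqd₂]
      rcases hfwd p hp with h | h
      · left; rw [h, h₁.queued c hc, hqc]
      · right; exact ⟨h, trivial⟩
    · intro h; simp [hqc] at h
  | false =>
    rw [h₁.queued c hc, hqc, if_neg (by simp), post_bind]
    refine (post_largest tie c news s₁).mono ?_
    rintro m s₁' t₂ ⟨hm, hmax, rfl, ht₂⟩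
    have hcnews : ∀ e ∈ c :: news, e < s₁'.numCls ∧ s₁'.queued e = false := by
      intro e he
      rcases List.mem_cons.1 he with rfl | he
      · exact ⟨by omega, by rw [h₁.queued e hc, hqc]⟩
      · have := (h₁.mem_news e).1 he
        exact ⟨this.2, h₁.queued_new e this.1 this.2⟩
    refine (post_forEach_enqueue hq₁ (fun e => e ≠ m)
      (List.nodup_cons.2 ⟨by rw [h₁.mem_news]; omega, h₁.nodup_news⟩)
      (fun e he => (hcnews e he).1) (fun e he => (hcnews e he).2)
      (fun _ _ h => if_neg h) (fun _ _ h => if_pos (not_not.1 h))).mono ?_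
    rintro - s₂ t₃ ⟨hq₂, hs₂, hqd₂, ht₃⟩
    refine ⟨⟨⟨h₁.isPartition.imp fun _ => hs₂.isPartition, hq₂, ?_⟩, hs₂.inc.trans h₁.inc,
      hs₂.head.trans h₁.head, hs₂.quot.trans h₁.quot, hs₂.numCls ▸ hle, ?_, ?_, ?_, ?_, ?_, ?_⟩,
      by simp only [List.length_cons] at ht₃; omega⟩
    · rw [hs₂.numCls, hs₂.cls]; exact hnonempty
    · rw [hs₂.cls]; exact hother
    · rw [hs₂.cls]; exact hself
    · rw [hs₂.cls]; exact hiff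
    · intro e he hec
      rw [Bool.eq_iff_iff, hqd₂, h₁.queued e he, List.mem_cons, h₁.mem_news]
      simp; omega
    · intro h; simp [hqc] at h
    · intro _
      refine ⟨m, fun p hp => ?_⟩
      rw [hs₂.cls, hqd₂, hs₂.size]
      have hp' : s₁'.cls p ∈ c :: news := by rw [List.mem_cons]; exact hfwd p hp
      refine ⟨fun h => .inr ⟨hp', h⟩, ?_⟩
      rintro (h | ⟨-, h⟩)
      · rw [(hcnews _ hp').2] at h; simp at h
      · have hmp := hmax _ hp'
        obtain ⟨L₁, hL₁⟩ := h₁.isPartition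
        have hsz := hL₁.size _ (hcnews _ hp').1
        have hsm := hL₁.size _ (hcnews _ hm).1
        -- The smaller half: an enqueued subclass and the class `m` are disjoint parts of the old
        -- class `c`, and `m` is at least as large. Twice the size of the subclass is thus at most
        -- the size of `c`.
        have hnd : (L₁ (s₁'.cls p) ++ L₁ m).Nodup := by
          refine (hL₁.nodup _).append (hL₁.nodup _) ?_
          intro q hq hq'
          exact h (hL₁.disj _ _ q hq hq')
        have := hL.length_le hc hnd (fun q hq => by
          apply hback
          rw [← List.mem_cons]
          rcases List.mem_append.1 hq with hq | hq
          · rwa [(hL₁.mem_iff _ _).1 hq]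
          · rwa [(hL₁.mem_iff _ _).1 hq])
        rw [List.length_append] at this
        omega

end FPCSA

/-! ### Signatures with respect to a splitter -/

namespace FPCSA

open Prog

variable {K A Q : Type*}

/-- The walk follows the pointers stored in the current memory, hence the condition that the
invariant keeps `next` unchanged. -/
theorem post_forClass {s : Mem K A Q} {L : ℕ → List (Aug Q)} (h : Linked s L) {d : ℕ}
    (hd : d < s.numCls) {body : Aug Q → Prog (Mem K A Q) Unit}
    (I : List (Aug Q) → Mem K A Q → Prop) (c : Aug Q → ℕ) (h0 : I [] s)
    (hnext : ∀ pre s', I pre s' → s'.next = s.next)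
    (hs : ∀ pre x post s', L d = pre ++ x :: post → I pre s' →
      (body x).Post s' fun _ s'' t => I (pre ++ [x]) s'' ∧ t ≤ c x) :
    (forClass d body).Post s fun _ s' t =>
      I (L d) s' ∧ t ≤ 3 + ((L d).map fun x => 2 + c x).sum := by
  simp only [forClass, getFirst, getSize, post_bind, post_get, h.first d hd, h.size d hd]
  suffices H : ∀ (post pre : List (Aug Q)) (s' : Mem K A Q), L d = pre ++ post → I pre s' →
      (walk body post.length post.head?).Post s' fun _ s'' t =>
        I (L d) s'' ∧ t ≤ 1 + (post.map fun x => 2 + c x).sum by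
    refine (H (L d) [] s rfl h0).mono ?_
    rintro - s' t ⟨h1, h2⟩
    exact ⟨h1, by omega⟩
  intro post
  induction post with
  | nil =>
    intro pre s' hl hI
    simp only [List.append_nil] at hl
    rw [hl]
    simpa [walk] using hI
  | cons x post ih =>
    intro pre s' hl hI
    simp only [List.length_cons, List.head?_cons, walk, getNext, post_seq, post_bind, post_tick,
      post_get]
    rw [hnext pre s' hI, h.next d pre x post hl]
    refine (hs pre x post s' hl hI).mono ?_
    rintro - s₁ t₁ ⟨hI₁, ht₁⟩
    refine (ih (pre ++ [x]) s₁ (by simp [hl]) hI₁).mono ?_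
    rintro - s₂ t₂ ⟨hI₂, ht₂⟩
    refine ⟨hI₂, ?_⟩
    simp only [List.map_cons, List.sum_cons]
    omega

variable [Semiring K] [DecidableEq K] [DecidableEq A] [DecidableEq Q]

/-- The sum of the weights of the pairs with first component `p`. -/
def pairSum (l : List (Aug Q × K)) (p : Aug Q) : K :=
  (l.map fun e => if e.1 = p then e.2 else 0).sum

theorem pairSum_append (l l' : List (Aug Q × K)) (p : Aug Q) :
    pairSum (l ++ l') p = pairSum l p + pairSum l' p := by simp [pairSum]

theorem pairSum_singleton (x : Aug Q × K) (p : Aug Q) :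
    pairSum [x] p = if x.1 = p then x.2 else 0 := by simp [pairSum]

/-- The list of letters and weights that represents the signature of `p`, if `es` is the list of the
pairs met for each letter. -/
def signatureList (es : List (Sigma fun _ : Option A => List (Aug Q × K))) (p : Aug Q) :
    List (Option A × K) :=
  es.foldl (fun b e => if pairSum e.2 p = 0 then b else (e.1, pairSum e.2 p) :: b) []

theorem signatureList_concat (es : List (Sigma fun _ : Option A => List (Aug Q × K)))
    (e : Sigma fun _ : Option A => List (Aug Q × K)) (p : Aug Q) :
    signatureList (es ++ [e]) p =
      if pairSum e.2 p = 0 then signatureList es p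
      else (e.1, pairSum e.2 p) :: signatureList es p := by simp [signatureList]

theorem fst_mem_of_mem_signatureList {es : List (Sigma fun _ : Option A => List (Aug Q × K))}
    {p : Aug Q} {x : Option A × K} (h : x ∈ signatureList es p) : x.1 ∈ es.map Sigma.fst := by
  induction es using List.reverseRecOn with
  | nil => simp [signatureList] at h
  | append_singleton es e ih =>
    rw [signatureList_concat] at h
    split_ifs at h
    · simpa using .inl (by simpa using ih h)
    · rcases List.mem_cons.1 h with rfl | h
      · simp
      · simpa using .inl (by simpa using ih h)

/-- The list is a normal form: the letters of `es` are distinct and come in a fixed order, and zero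
weights are left out. Hence equality of signatures can be tested by equality of hash keys, and the
zero signature is the empty list. -/
theorem signatureList_eq_iff {es : List (Sigma fun _ : Option A => List (Aug Q × K))}
    (hes : (es.map Sigma.fst).Nodup) (p q : Aug Q) :
    signatureList es p = signatureList es q ↔ ∀ e ∈ es, pairSum e.2 p = pairSum e.2 q := by
  induction es using List.reverseRecOn with
  | nil => simp [signatureList]
  | append_singleton es e ih =>
    rw [List.map_append, List.nodup_append] at hes
    have ih' := ih hes.1
    -- The letter of the last entry is new, so a list that starts with it cannot be equal to one
    -- built from the earlier entries.
    have hne : ∀ p (k : K) l, signatureList es p ≠ (e.1, k) :: l := by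
      intro p k l h
      have h1 : (e.1, k).1 ∈ es.map Sigma.fst :=
        fst_mem_of_mem_signatureList (p := p) (by rw [h]; simp)
      exact hes.2.2 _ h1 e.1 (by simp) rfl
    rw [signatureList_concat, signatureList_concat]
    simp only [List.mem_append, List.mem_singleton]
    constructor
    · intro h
      split_ifs at h with h1 h2 h2
      · rintro e' (he | rfl)
        · exact ih'.1 h e' he
        · rw [h1, h2]
      · exact absurd h (hne _ _ _)
      · exact absurd h.symm (hne _ _ _)
      · simp only [List.cons.injEq, Prod.mk.injEq, true_and] at h
        rintro e' (he | rfl)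
        · exact ih'.1 h.2 e' he
        · exact h.1
    · intro h
      rw [h e (.inr rfl), ih'.2 fun e' he => h e' (.inl he)]

/-- Here `w` is the sum of the weights met so far for the letter `a`, and `b` is the part of the
signature that belongs to other letters. If `w = 0`, no pair for `a` is present, and the sum `k` is
nonzero and must be stored. -/
theorem post_insertSig (p : Aug Q) (a : Option A) (k : K) (hk : k ≠ 0) (s : Mem K A Q)
    (w : K) (b : List (Option A × K)) (hb : ∀ x ∈ b, x.1 ≠ a)
    (hs : (s.sig.lookup p).getD [] = if w = 0 then b else (a, w) :: b) :
    (insertSig p a k).Post s fun _ s' t =>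
      s' = { s with sig := s.sig.insert p (if w + k = 0 then b else (a, w + k) :: b) } ∧
        t ≤ 5 := by
  simp only [insertSig, getSig, post_bind, post_get]
  rw [hs]
  split_ifs with h1 h2 h2
  · simp [h1, hk] at h2
  · subst h1
    cases b with
    | nil => simp [setSig]
    | cons x b =>
      have hx : x.1 ≠ a := hb x (by simp)
      simp [setSig, hx]
  · simp [addWeights, isZeroWeight, h2, setSig]
  · simp [addWeights, isZeroWeight, h2, setSig]

/-- The pairs are treated letter by letter, so that the pair to be updated is always at the head of
its list. Every pair met creates at most one key and lengthens one list by at most one, which is the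
factor 2 in the size of the table. -/
theorem post_computeSignatures (s : Mem K A Q) (hsig : s.sig = ∅)
    (hne : ∀ e ∈ s.meet.entries, ∀ x ∈ e.2, x.2 ≠ 0) :
    computeSignatures.Post s fun _ s' t => s' = { s with sig := s'.sig } ∧
      (∀ p, (s'.sig.lookup p).getD [] = signatureList s.meet.entries p) ∧
      HMap.cost s'.sig (fun _ l => 1 + l.length) ≤ 2 * HMap.cost s.meet (fun _ l => l.length) ∧
      t ≤ 2 + HMap.cost s.meet (fun _ l => 2 + 6 * l.length) := by
  simp only [computeSignatures, forEntries, post_bind, post_get]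
  refine (post_forEach (fun pre s' => s' = { s with sig := s'.sig } ∧
      (∀ p, (s'.sig.lookup p).getD [] = signatureList pre p) ∧
      HMap.cost s'.sig (fun _ l => 1 + l.length) ≤ 2 * (pre.map fun e => e.2.length).sum)
      (fun e => 1 + 6 * e.2.length) ?_ ?_).mono ?_
  · refine ⟨rfl, ?_, ?_⟩ <;> simp [hsig, signatureList, HMap.cost]
  · rintro esPre e esPost s₁ hes ⟨hs₁, hsig₁, hcost₁⟩
    have hnd : (s.meet.entries.map Sigma.fst).Nodup := s.meet.nodupKeys
    refine (post_forEach (fun pre s' => s' = { s with sig := s'.sig } ∧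
      (∀ p, (s'.sig.lookup p).getD [] = if pairSum pre p = 0 then signatureList esPre p
        else (e.1, pairSum pre p) :: signatureList esPre p) ∧
      HMap.cost s'.sig (fun _ l => 1 + l.length) ≤
        2 * ((esPre.map fun e => e.2.length).sum + pre.length))
      (fun _ => 5) ⟨hs₁, by simpa [pairSum] using hsig₁, by simpa using hcost₁⟩ ?_).mono ?_
    · rintro pre ⟨p, k⟩ post s₂ hpre ⟨hs₂, hsig₂, hcost₂⟩
      refine (post_insertSig p e.1 k (hne e (by simp [hes]) (p, k) (by simp [hpre])) s₂ _ _ ?_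
        (hsig₂ p)).mono ?_
      · intro x hx hxe
        have hx' := fst_mem_of_mem_signatureList hx
        rw [hes, List.map_append, List.nodup_append] at hnd
        exact hnd.2.2 _ hx' e.1 (by simp) hxe
      · rintro - s₃ t ⟨hs₃, ht⟩
        refine ⟨⟨?_, ?_, ?_⟩, ht⟩
        · rw [hs₃, hs₂]
        · intro q
          rw [hs₃]
          simp only
          rw [HMap.getD_lookup_insert, pairSum_append]
          by_cases hq : q = p
          · subst hq
            simp [pairSum_singleton]
          · simp [pairSum_singleton, Ne.symm hq, hq, hsig₂]
        · rw [hs₃]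
          simp only
          have hins := HMap.cost_insert s₂.sig (fun _ l => 1 + l.length) p
            (if pairSum pre p + k = 0 then signatureList esPre p
              else (e.1, pairSum pre p + k) :: signatureList esPre p)
          have hp := hsig₂ p
          have hlen : (if pairSum pre p + k = 0 then signatureList esPre p
              else (e.1, pairSum pre p + k) :: signatureList esPre p).length ≤
              ((s₂.sig.lookup p).getD []).length + 1 := by
            rw [hp]; split_ifs <;> grind
          rw [List.length_append, List.length_singleton]
          cases hl : s₂.sig.lookup p with
          | none => simp [hl] at hins hlen; omega
          | some l => simp [hl] at hins hlen; omega
    · rintro - s₂ t ⟨⟨hs₂, hsig₂, hcost₂⟩, ht⟩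
      refine ⟨⟨hs₂, ?_, ?_⟩, ?_⟩
      · intro p
        rw [hsig₂, signatureList_concat]
      · simpa using hcost₂
      · simp at ht; omega
  · rintro - s₁ t ⟨⟨hs₁, hsig₁, hcost₁⟩, ht⟩
    refine ⟨hs₁, hsig₁, hcost₁, ?_⟩
    have : (s.meet.entries.map fun x => 1 + (1 + 6 * x.2.length)).sum =
        HMap.cost s.meet (fun _ l => 2 + 6 * l.length) := by
      unfold HMap.cost
      congr 2
      funext e
      dsimp only
      omega
    omega

/-- The pairs of a letter and of the origin and weight of a transition, for a list of transitions. -/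
def byLetter (l : List (Aug Q × Option A × K)) : List (Option A × Aug Q × K) :=
  l.map fun e => (e.2.1, e.1, e.2.2)

theorem post_collect {s : Mem K A Q} {L : ℕ → List (Aug Q)} (h : Linked s L) {d : ℕ}
    (hd : d < s.numCls) :
    (collect d).Post s fun _ s' t =>
      s' = { s with meet := HMap.gatherFrom s.meet (byLetter ((L d).flatMap s.inc)) } ∧
      t ≤ 3 + ((L d).map fun q => 4 + 3 * (s.inc q).length).sum := by
  refine (post_forClass h hd (fun pre s' =>
    s' = { s with meet := HMap.gatherFrom s.meet (byLetter (pre.flatMap s.inc)) })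
    (fun q => 2 + 3 * (s.inc q).length) rfl ?_ ?_).mono ?_
  · rintro pre s' rfl; rfl
  · rintro pre q post s₁ - rfl
    simp only [getInc, post_bind, post_get]
    refine (post_forEach (fun pre' s' =>
      s' = { s with meet := HMap.gatherFrom s.meet (byLetter (pre.flatMap s.inc ++ pre')) })
      (fun _ => 2) (by simp) ?_).mono ?_
    · rintro pre' e post' s₂ - rfl
      simp only [getMeet, setMeet, post_bind, post_get, post_put]
      refine ⟨?_, le_rfl⟩
      simp only [byLetter, List.map_append, HMap.gatherFrom_append, List.map_cons, List.map_nil,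
        HMap.gatherFrom_singleton]
    · rintro - s₂ t ⟨rfl, ht⟩
      refine ⟨by simp, ?_⟩
      simp at ht; omega
  · rintro - s₁ t ⟨rfl, ht⟩
    refine ⟨rfl, ht.trans (le_of_eq ?_)⟩
    congr 3
    funext q
    omega

theorem length_byLetter (l : List (Aug Q × Option A × K)) : (byLetter l).length = l.length := by
  simp [byLetter]

/-- The states with nonzero signature, with their class and signature. -/
def keyed (cls : Aug Q → ℕ) (l : List (Sigma fun _ : Aug Q => List (Option A × K))) :
    List ((ℕ × List (Option A × K)) × Aug Q) :=
  (l.filter fun e => e.2 ≠ []).map fun e => ((cls e.1, e.2), e.1)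

/-- The groups of states with equal class and equal nonzero signature. -/
def groupsOf (cls : Aug Q → ℕ) (sig : HMap (Aug Q) (List (Option A × K))) :
    HMap (ℕ × List (Option A × K)) (List (Aug Q)) :=
  HMap.gatherFrom ∅ (keyed cls sig.entries)

/-- For each class, the list of its groups. -/
def partsOf (groups : HMap (ℕ × List (Option A × K)) (List (Aug Q))) :
    HMap ℕ (List (List (Aug Q))) :=
  HMap.gatherFrom ∅ (groups.entries.map fun e => (e.1.1, e.2))

theorem post_gather (s : Mem K A Q) (hg : s.groups = ∅) (hp : s.parts = ∅) :
    gather.Post s fun _ s' t =>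
      s' = { s with groups := groupsOf s.cls s.sig, parts := partsOf (groupsOf s.cls s.sig) } ∧
      t ≤ 4 + HMap.cost s.sig (fun _ l => 4 + 2 * l.length) +
        HMap.cost (groupsOf s.cls s.sig) fun _ _ => 3 := by
  simp only [gather, forEntries, post_bind, post_get, post_seq]
  refine (post_forEach (fun pre s' => s' =
      { s with groups := HMap.gatherFrom ∅ (keyed s.cls pre) }) (fun e => 3 + 2 * e.2.length) ?_ ?_).mono ?_
  · simp [keyed, HMap.gatherFrom, ← hg]
  · rintro pre ⟨p, l⟩ post s₁ - rfl
    cases l with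
    | nil => simp [keyed]
    | cons x l =>
      simp [getCls, getGroup, setGroup, keyed, HMap.gatherFrom_append,
        HMap.gatherFrom_singleton]
      omega
  · rintro - s₁ t₁ ⟨rfl, ht₁⟩
    refine (post_forEach (fun pre s' => s' = { s with
      groups := groupsOf s.cls s.sig,
      parts := HMap.gatherFrom ∅ (pre.map fun e => (e.1.1, e.2)) }) (fun e => 2) ?_ ?_).mono ?_
    · simp [HMap.gatherFrom, ← hp, groupsOf]
    · rintro pre e post s₁ - rfl
      simp [getParts, setParts, HMap.gatherFrom_append, HMap.gatherFrom_singleton]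
    · rintro - s₂ t₂ ⟨rfl, ht₂⟩
      refine ⟨rfl, ?_⟩
      have h1 : (s.sig.entries.map fun x => 1 + (3 + 2 * x.2.length)).sum =
          HMap.cost s.sig (fun _ l => 4 + 2 * l.length) := by
        unfold HMap.cost
        congr 2
        funext e
        dsimp only
        omega
      have h2 : t₂ ≤ 1 + HMap.cost (groupsOf s.cls s.sig) fun _ _ => 3 := ht₂
      omega

/-! ### Groups of states with equal class and equal nonzero signature -/

section Grouping

variable {cls : Aug Q → ℕ} {sig : HMap (Aug Q) (List (Option A × K))}
  {σ : Aug Q → List (Option A × K)}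

theorem mem_keyed (hsig : ∀ p, (sig.lookup p).getD [] = σ p)
    (x : (ℕ × List (Option A × K)) × Aug Q) :
    x ∈ keyed cls sig.entries ↔ x.1 = (cls x.2, σ x.2) ∧ σ x.2 ≠ [] := by
  obtain ⟨x, p⟩ := x
  simp only [keyed, List.mem_map, List.mem_filter, HMap.mem_entries_iff, decide_eq_true_eq]
  constructor
  · rintro ⟨e, ⟨he, hne⟩, heq⟩
    simp only [Prod.mk.injEq] at heq
    obtain ⟨rfl, rfl⟩ := heq
    have := hsig e.1
    rw [he, Option.getD_some] at this
    exact ⟨by rw [this], this ▸ hne⟩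
  · rintro ⟨rfl, hne⟩
    refine ⟨⟨p, σ p⟩, ⟨?_, hne⟩, rfl⟩
    have := hsig p
    cases h : sig.lookup p with
    | none => rw [h] at this; exact absurd this.symm hne
    | some l => rw [h] at this; exact congrArg some this

theorem mem_group_iff (hsig : ∀ p, (sig.lookup p).getD [] = σ p) {c : ℕ}
    {l : List (Option A × K)} (p : Aug Q) :
    p ∈ ((groupsOf cls sig).lookup (c, l)).getD [] ↔ cls p = c ∧ σ p = l ∧ l ≠ [] := by
  simp only [groupsOf, HMap.getD_lookup_gatherFrom, List.mem_reverse, List.mem_map,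
    List.mem_filter, decide_eq_true_eq]
  constructor
  · rintro ⟨x, ⟨hx, hk⟩, rfl⟩
    rw [mem_keyed hsig] at hx
    rw [hk, Prod.mk.injEq] at hx
    exact ⟨hx.1.1.symm, hx.1.2.symm, hx.1.2 ▸ hx.2⟩
  · rintro ⟨rfl, rfl, hne⟩
    exact ⟨((cls p, σ p), p), ⟨(mem_keyed hsig _).2 ⟨rfl, hne⟩, rfl⟩, rfl⟩

theorem nodup_group {x : ℕ × List (Option A × K)} {g : List (Aug Q)}
    (h : (groupsOf cls sig).lookup x = some g) : g.Nodup := by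
  rw [HMap.lookup_gatherFrom _ h, List.nodup_reverse]
  have h1 : ((keyed cls sig.entries).map Prod.snd).Nodup := by
    simp only [keyed, List.map_map]
    have h2 : (sig.entries.map Sigma.fst).Nodup := sig.nodupKeys
    exact h2.sublist ((List.filter_sublist).map _)
  exact h1.sublist ((List.filter_sublist).map _)

/-- The groups listed for `c` are the entries with keys `(c, l)`. Different entries have different
signatures `l`, whence disjointness. -/
theorem isGrouping_of_lookup (hsig : ∀ p, (sig.lookup p).getD [] = σ p) {c : ℕ}
    {gs : List (List (Aug Q))} (h : (partsOf (groupsOf cls sig)).lookup c = some gs) :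
    IsGrouping cls c σ [] gs := by
  have hgs := HMap.lookup_gatherFrom _ h
  have hmem : ∀ g, g ∈ gs ↔ ∃ l, (groupsOf cls sig).lookup (c, l) = some g := by
    intro g
    rw [hgs]
    simp only [List.mem_reverse, List.mem_map, List.mem_filter, decide_eq_true_eq]
    constructor
    · rintro ⟨x, ⟨⟨e, he, rfl⟩, rfl⟩, rfl⟩
      exact ⟨e.1.2, (HMap.mem_entries_iff _ _).1 he⟩
    · rintro ⟨l, hl⟩
      exact ⟨(c, g), ⟨⟨⟨(c, l), g⟩, (HMap.mem_entries_iff _ _).2 hl, rfl⟩, rfl⟩, rfl⟩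
  have hgrp : ∀ {l g}, (groupsOf cls sig).lookup (c, l) = some g → ∀ p,
      p ∈ g ↔ cls p = c ∧ σ p = l ∧ l ≠ [] := by
    intro l g hl p
    rw [← mem_group_iff hsig, hl, Option.getD_some]
  refine ⟨HMap.ne_nil_of_lookup_gatherFrom _ _ h, ?_, ?_, ?_, ?_⟩
  · intro g hg
    obtain ⟨l, hl⟩ := (hmem g).1 hg
    exact HMap.ne_nil_of_lookup_gatherFrom _ _ hl
  · rw [List.nodup_flatten]
    refine ⟨fun g hg => ((hmem g).1 hg).elim fun l hl => nodup_group hl, ?_⟩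
    rw [hgs, List.pairwise_reverse, List.pairwise_map, List.pairwise_filter, List.pairwise_map]
    have hnd : ((groupsOf cls sig).entries.map Sigma.fst).Nodup := (groupsOf cls sig).nodupKeys
    have hnd' := List.pairwise_map.1 hnd
    refine hnd'.imp_of_mem ?_
    rintro ⟨⟨c₁, l₁⟩, g₁⟩ ⟨⟨c₂, l₂⟩, g₂⟩ h₁ h₂ hne hc₁ hc₂
    simp only [decide_eq_true_eq] at hc₁ hc₂
    subst hc₁ hc₂
    rw [HMap.mem_entries_iff] at h₁ h₂
    intro p hp₂ hp₁
    have e₁ := ((hgrp h₁ p).1 hp₁).2.1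
    have e₂ := ((hgrp h₂ p).1 hp₂).2.1
    exact hne (by simp [← e₁, ← e₂])
  · intro p
    rw [List.mem_flatten]
    constructor
    · rintro ⟨g, hg, hp⟩
      obtain ⟨l, hl⟩ := (hmem g).1 hg
      have := (hgrp hl p).1 hp
      exact ⟨this.1, this.2.1 ▸ this.2.2⟩
    · rintro ⟨hc, hne⟩
      have hp := (mem_group_iff (cls := cls) hsig (c := c) (l := σ p) p).2 ⟨hc, rfl, hne⟩
      cases hl : (groupsOf cls sig).lookup (c, σ p) with
      | none => simp [hl] at hp
      | some g => exact ⟨g, (hmem g).2 ⟨_, hl⟩, by simpa [hl] using hp⟩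
  · intro g hg p hp q
    obtain ⟨l, hl⟩ := (hmem g).1 hg
    have hp' := (hgrp hl p).1 hp
    rw [hgrp hl q, hp'.2.1]
    tauto

/-- By contraposition, a class that is not listed contains only states with zero signature, and may
be left as it is. -/
theorem exists_lookup_partsOf (hsig : ∀ p, (sig.lookup p).getD [] = σ p) {p : Aug Q}
    (hp : σ p ≠ []) : ∃ gs, (partsOf (groupsOf cls sig)).lookup (cls p) = some gs := by
  have hp := (mem_group_iff (cls := cls) hsig p).2 ⟨rfl, rfl, hp⟩
  cases hl : (groupsOf cls sig).lookup (cls p, σ p) with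
  | none => simp [hl] at hp
  | some g =>
    cases hgs : (partsOf (groupsOf cls sig)).lookup (cls p) with
    | some gs => exact ⟨gs, rfl⟩
    | none =>
      have h1 := HMap.getD_lookup_gatherFrom
        ((groupsOf cls sig).entries.map fun e => (e.1.1, e.2)) (cls p)
      have h2 : g ∈ ([] : List (List (Aug Q))) := by
        rw [← Option.getD_none (a := ([] : List (List (Aug Q)))), ← hgs, partsOf, h1]
        simp only [List.mem_reverse, List.mem_map, List.mem_filter, decide_eq_true_eq]
        exact ⟨(cls p, g), ⟨⟨⟨(cls p, σ p), g⟩, (HMap.mem_entries_iff _ _).2 hl, rfl⟩, rfl⟩, rfl⟩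
      simp at h2

/-- No group is empty, so the fixed cost of a group is charged to its states; a state lies in at
most one group. -/
theorem cost_groupsOf (cls : Aug Q → ℕ) (sig : HMap (Aug Q) (List (Option A × K))) (x y : ℕ) :
    HMap.cost (groupsOf cls sig) (fun _ g => x + y * g.length) ≤
      HMap.cost sig fun _ _ => x + y := by
  have h1 := HMap.cost_gatherFrom (keyed cls sig.entries) fun _ => x + y
  have h2 : HMap.cost (groupsOf cls sig) (fun _ g => x + y * g.length) ≤
      HMap.cost (groupsOf cls sig) (fun _ g => (g.map fun _ => x + y).sum) := by
    refine HMap.cost_mono _ fun k g hg => ?_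
    have := List.length_pos_of_ne_nil (HMap.ne_nil_of_lookup_gatherFrom _ _ hg)
    simp
    nlinarith
  refine h2.trans (h1.le.trans ?_)
  simp only [keyed, List.map_map, HMap.cost]
  refine ((List.filter_sublist).map _).sum_le_sum (by simp)

theorem cost_partsOf (groups : HMap (ℕ × List (Option A × K)) (List (Aug Q))) (x y z : ℕ) :
    HMap.cost (partsOf groups) (fun _ gs => x + (gs.map fun g => y + z * g.length).sum) ≤
      HMap.cost groups fun _ g => (x + y) + z * g.length := by
  have h1 := HMap.cost_gatherFrom (groups.entries.map fun e => (e.1.1, e.2))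
    fun g => (x + y) + z * g.length
  have h2 : HMap.cost (partsOf groups) (fun _ gs => x + (gs.map fun g => y + z * g.length).sum) ≤
      HMap.cost (partsOf groups) (fun _ gs => (gs.map fun g => (x + y) + z * g.length).sum) := by
    refine HMap.cost_mono _ fun k gs hgs => ?_
    obtain ⟨g, gs', rfl⟩ :=
      List.exists_cons_of_ne_nil (HMap.ne_nil_of_lookup_gatherFrom _ _ hgs)
    have : (gs'.map fun g => y + z * g.length).sum ≤
        (gs'.map fun g => (x + y) + z * g.length).sum := List.sum_le_sum fun g _ => by omega
    simp only [List.map_cons, List.sum_cons]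
    omega
  refine h2.trans (h1.le.trans (le_of_eq ?_))
  simp [HMap.cost, Function.comp_def]

end Grouping

end FPCSA

/-! ### One iteration -/

theorem Aug.injective_toOption (Q : Type*) : Function.Injective
    (fun x : Aug Q => match x with
      | .ini => none
      | .fin => some none
      | .state q => some (some q)) := by
  intro x y h
  cases x <;> cases y <;> simp_all

instance Aug.instFinite (Q : Type*) [Finite Q] : Finite (Aug Q) :=
  Finite.of_injective _ (Aug.injective_toOption Q)

noncomputable instance Aug.instFintype (Q : Type*) [Finite Q] : Fintype (Aug Q) :=
  Fintype.ofFinite _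

theorem Aug.sum_eq {Q : Type*} [DecidableEq Q] [Fintype Q] {R : Type*} [AddCommMonoid R] (f : Aug Q → R) :
    ∑ p, f p = f .ini + (f .fin + ∑ q, f (.state q)) := by
  have h : (Finset.univ : Finset (Aug Q)) =
      insert .ini (insert .fin (Finset.univ.map (Aug.emb Q))) := by
    ext p
    cases p with
    | ini => simp
    | fin => simp
    | state q => simpa using ⟨q, rfl⟩
  rw [h, Finset.sum_insert (by simp [Aug.emb]), Finset.sum_insert (by simp [Aug.emb]),
    Finset.sum_map]
  rfl

theorem Aug.card_eq {Q : Type*} [DecidableEq Q] [Fintype Q] : Fintype.card (Aug Q) = Fintype.card Q + 2 := by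
  rw [Fintype.card_eq_sum_ones, Aug.sum_eq]
  simp
  omega

namespace FPCSA

open Prog

variable {K A Q : Type*} [DecidableEq Q] [Finite Q]

/-- The set of the states of a class. -/
noncomputable def classSet (s : Mem K A Q) (c : ℕ) : Finset (Aug Q) :=
  Finset.univ.filter fun p => s.cls p = c

@[simp] theorem mem_classSet (s : Mem K A Q) (c : ℕ) (p : Aug Q) :
    p ∈ classSet s c ↔ s.cls p = c := by simp [classSet]

theorem IsPartition.toFinset_eq {s : Mem K A Q} {L : ℕ → List (Aug Q)} (h : IsPartition s L)
    (c : ℕ) : (L c).toFinset = classSet s c := by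
  ext p
  simp [h.mem_iff]

theorem IsPartition.sum_eq {s : Mem K A Q} {L : ℕ → List (Aug Q)} (h : IsPartition s L)
    (c : ℕ) {R : Type*} [AddCommMonoid R] (f : Aug Q → R) :
    ((L c).map f).sum = ∑ q ∈ classSet s c, f q := by
  rw [← h.toFinset_eq, List.sum_toFinset f (h.nodup c)]

theorem Good.size_eq {s : Mem K A Q} (h : Good s) {c : ℕ} (hc : c < s.numCls) :
    s.size c = (classSet s c).card := by
  obtain ⟨L, hL⟩ := h.isPartition
  rw [hL.size c hc, ← hL.toFinset_eq, List.toFinset_card_of_nodup (hL.nodup c)]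

theorem Good.cls_lt {s : Mem K A Q} (h : Good s) (p : Aug Q) : s.cls p < s.numCls :=
  h.isPartition.elim fun _ hL => hL.cls_lt p

theorem Good.size_le {s s' : Mem K A Q} (h : Good s) (h' : Good s') {p : Aug Q}
    (hcls : ∀ q, s'.cls q = s'.cls p → s.cls q = s.cls p) :
    s'.size (s'.cls p) ≤ s.size (s.cls p) := by
  rw [h.size_eq (h.cls_lt p), h'.size_eq (h'.cls_lt p)]
  refine Finset.card_le_card fun q hq => ?_
  rw [mem_classSet] at hq ⊢
  exact hcls q hq

/-- The memory `s'` is obtained from `s` by splitting the classes that satisfy `P` according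
to `σ`. -/
structure IsRefinement {β : Type*} (s s' : Mem K A Q) (σ : Aug Q → β) (P : ℕ → Prop) : Prop where
  good : Good s'
  inc : s'.inc = s.inc
  head : s'.head = s.head
  quot : s'.quot = s.quot
  numCls_le : s.numCls ≤ s'.numCls
  cls_cases : ∀ p, s'.cls p = s.cls p ∨ s.numCls ≤ s'.cls p
  cls_of_not : ∀ p, ¬ P (s.cls p) → s'.cls p = s.cls p
  cls_eq : ∀ p q, s'.cls p = s'.cls q → s.cls p = s.cls q
  cls_iff : ∀ p q, P (s.cls p) → s.cls p = s.cls q → (s'.cls p = s'.cls q ↔ σ p = σ q)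
  queued_of_not : ∀ e < s.numCls, ¬ P e → s'.queued e = s.queued e
  queued : ∀ p, s.queued (s.cls p) = true → s'.queued (s'.cls p) = true
  not_queued : ∀ c < s.numCls, s.queued c = false → ∃ m, ∀ p, s.cls p = c →
    (s'.cls p ≠ m → s'.queued (s'.cls p) = true) ∧
    (s'.queued (s'.cls p) = true → 2 * s'.size (s'.cls p) ≤ s.size c)

theorem IsRefinement.refl {β : Type*} {s : Mem K A Q} (hs : Good s) (σ : Aug Q → β) {P : ℕ → Prop}
    (hP : ∀ c, ¬ P c) : IsRefinement s s σ P where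
  good := hs
  inc := rfl
  head := rfl
  quot := rfl
  numCls_le := le_rfl
  cls_cases _ := .inl rfl
  cls_of_not _ _ := rfl
  cls_eq _ _ h := h
  cls_iff _ _ h := absurd h (hP _)
  queued_of_not _ _ _ := rfl
  queued _ h := h
  not_queued c _ h := ⟨c, fun p hp => ⟨fun hp' => absurd hp hp', fun hp' => by
    rw [hp, h] at hp'; exact absurd hp' (by simp)⟩⟩

theorem IsRefinement.cls_eq_iff {β : Type*} {s s₁ : Mem K A Q} {σ : Aug Q → β} {P : ℕ → Prop}
    (h : IsRefinement s s₁ σ P) {c : ℕ} (hc : c < s.numCls) (hP : ¬ P c) (p : Aug Q) :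
    s₁.cls p = c ↔ s.cls p = c := by
  constructor
  · intro hp
    rcases h.cls_cases p with h' | h' <;> omega
  · rintro rfl
    exact h.cls_of_not p hP

theorem IsRefinement.split {β : Type*} {s s₁ s₂ : Mem K A Q} {σ : Aug Q → β} {P P' : ℕ → Prop}
    (hs : Good s) (h : IsRefinement s s₁ σ P) {c : ℕ} (hc : c < s.numCls) (hP : ¬ P c)
    (h' : IsSplit s₁ s₂ c σ) (hP' : ∀ e, P' e ↔ P e ∨ e = c) : IsRefinement s s₂ σ P' := by
  have hiff := h.cls_eq_iff hc hP
  have hle := h.numCls_le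
  have hle' := h'.numCls_le
  have hcls₁ : ∀ p, s₁.cls p < s₁.numCls := h.good.cls_lt
  -- States outside `c` keep their class, because the names given to parts of `c` are either `c` or
  -- new; the two inclusions of classes yield equality of the sizes.
  have hsize : ∀ p, s.cls p ≠ c → s₂.size (s₂.cls p) = s₁.size (s₁.cls p) := by
    intro p hp
    have hp₁ : s₁.cls p ≠ c := by rwa [Ne, hiff]
    refine le_antisymm (h.good.size_le h'.good ?_) (h'.good.size_le h.good ?_)
    · intro q hq
      rw [h'.cls_other p hp₁] at hq
      by_cases hqc : s₁.cls q = c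
      · have := h'.cls_self q hqc
        have := hcls₁ p
        omega
      · rwa [h'.cls_other q hqc] at hq
    · intro q hq
      rw [h'.cls_other p hp₁, h'.cls_other q (by omega), hq]
  have hq₂ : ∀ p, s.cls p ≠ c → s₂.queued (s₂.cls p) = s₁.queued (s₁.cls p) := by
    intro p hp
    have hp₁ : s₁.cls p ≠ c := by rwa [Ne, hiff]
    rw [h'.cls_other p hp₁, h'.queued_other _ (hcls₁ p) hp₁]
  have hcls_eq : ∀ p q, s₂.cls p = s₂.cls q → s₁.cls p = s₁.cls q := by
    intro p q hpq
    have := hcls₁ p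
    have := hcls₁ q
    by_cases hp : s₁.cls p = c <;> by_cases hq : s₁.cls q = c
    · rw [hp, hq]
    · have := h'.cls_self p hp
      have := h'.cls_other q hq
      omega
    · have := h'.cls_self q hq
      have := h'.cls_other p hp
      omega
    · rwa [h'.cls_other p hp, h'.cls_other q hq] at hpq
  refine ⟨h'.good, h'.inc.trans h.inc, h'.head.trans h.head, h'.quot.trans h.quot, by omega,
    ?_, ?_, ?_, ?_, ?_, ?_, ?_⟩
  · intro p
    by_cases hp : s₁.cls p = c
    · rcases h'.cls_self p hp with hp' | hp'
      · left; rw [hp', (hiff p).1 hp]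
      · right; omega
    · rw [h'.cls_other p hp]; exact h.cls_cases p
  · intro p hp
    rw [hP'] at hp
    push Not at hp
    rw [h'.cls_other p (by rw [Ne, hiff]; exact hp.2), h.cls_of_not p hp.1]
  · intro p q hpq
    exact h.cls_eq p q (hcls_eq p q hpq)
  · intro p q hp hpq
    rw [hP'] at hp
    by_cases hpc : s.cls p = c
    · exact h'.cls_iff p q ((hiff p).2 hpc) ((hiff q).2 (hpq ▸ hpc))
    · rw [h'.cls_other p (by rwa [Ne, hiff]), h'.cls_other q (by rwa [Ne, hiff, ← hpq])]
      exact h.cls_iff p q (by tauto) hpq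
  · intro e he hPe
    rw [hP'] at hPe
    push Not at hPe
    rw [h'.queued_other e (by omega) hPe.2, h.queued_of_not e he hPe.1]
  · intro p hp
    by_cases hpc : s.cls p = c
    · refine h'.queued_self ?_ p ((hiff p).2 hpc)
      rw [h.queued_of_not c hc hP, ← hpc, hp]
    · rw [hq₂ p hpc]; exact h.queued p hp
  · intro e he hqe
    by_cases hec : e = c
    · subst hec
      obtain ⟨m, hm⟩ := h'.not_queued_self (by rw [h.queued_of_not e hc hP, hqe])
      refine ⟨m, fun p hp => ?_⟩
      have hp₁ := (hiff p).2 hp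
      refine ⟨(hm p hp₁).1, fun hq => ((hm p hp₁).2 hq).trans ?_⟩
      have := hs.size_le h.good (p := p) (fun q hq => h.cls_eq q p hq)
      rwa [hp₁, hp] at this
    · obtain ⟨m, hm⟩ := h.not_queued e he hqe
      refine ⟨m, fun p hp => ?_⟩
      have hpc : s.cls p ≠ c := by omega
      rw [hq₂ p hpc, hsize p hpc, h'.cls_other p (by rwa [Ne, hiff])]
      exact hm p hp

theorem IsGrouping.congr {β : Type*} {cls cls' : Aug Q → ℕ} {c : ℕ} {σ : Aug Q → β} {z : β}
    {gs : List (List (Aug Q))} (h : IsGrouping cls c σ z gs) (hcls : ∀ p, cls' p = c ↔ cls p = c) :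
    IsGrouping cls' c σ z gs where
  ne_nil := h.ne_nil
  group_ne_nil := h.group_ne_nil
  nodup := h.nodup
  mem_flatten p := by rw [hcls, h.mem_flatten]
  mem_group g hg p hp q := by rw [hcls, h.mem_group g hg p hp]

/-- The table of parts is read once, before any splitting. It remains valid throughout: a class not
yet treated keeps its name and its states, since all the names that are created are new. -/
theorem post_splitClasses {β : Type*} (tie : ℕ → ℕ → Bool) {s : Mem K A Q} (hs : Good s)
    {σ : Aug Q → β} {z : β}
    (hg : ∀ c gs, s.parts.lookup c = some gs → IsGrouping s.cls c σ z gs) :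
    (forEntries Mem.parts fun c gs => splitClass tie c gs).Post s fun _ s' t =>
      IsRefinement s s' σ (fun c => ∃ gs, s.parts.lookup c = some gs) ∧
      t ≤ 2 + HMap.cost s.parts fun _ gs => 15 + (gs.map fun g => 18 + 17 * g.length).sum := by
  simp only [forEntries, post_bind, post_get]
  refine (post_forEach (fun pre s' => IsRefinement s s' σ (fun c => c ∈ pre.map Sigma.fst))
    (fun e => 14 + (e.2.map fun g => 18 + 17 * g.length).sum) (.refl hs σ (by simp)) ?_).mono ?_
  · rintro pre ⟨c, gs⟩ post s₁ hpre h₁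
    have hnd : (s.parts.entries.map Sigma.fst).Nodup := s.parts.nodupKeys
    rw [hpre, List.map_append, List.nodup_append] at hnd
    have hP : c ∉ pre.map Sigma.fst := fun hc => hnd.2.2 c hc c (by simp) rfl
    have hgc := hg c gs ((HMap.mem_entries_iff _ ⟨c, gs⟩).1 (by rw [hpre]; simp))
    have hc : c < s.numCls := by
      obtain ⟨g, hgg⟩ := List.exists_mem_of_ne_nil _ hgc.ne_nil
      obtain ⟨p, hp⟩ := List.exists_mem_of_ne_nil _ (hgc.group_ne_nil g hgg)
      have := (hgc.mem_flatten p).1 (List.mem_flatten.2 ⟨g, hgg, hp⟩)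
      rw [← this.1]
      exact hs.cls_lt p
    refine (post_splitClass tie h₁.good (hc.trans_le h₁.numCls_le)
      (hgc.congr (h₁.cls_eq_iff hc hP))).mono ?_
    rintro - s₂ t ⟨h₂, ht⟩
    exact ⟨h₁.split hs hc hP h₂ (by simp), ht⟩
  · rintro - s₁ t ⟨h₁, ht⟩
    have hP : (fun c => c ∈ s.parts.entries.map Sigma.fst) =
        fun c => ∃ gs, s.parts.lookup c = some gs := by
      funext c
      rw [eq_iff_iff]
      constructor
      · intro hc
        obtain ⟨⟨c, gs⟩, he, rfl⟩ := List.mem_map.1 hc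
        exact ⟨gs, (HMap.mem_entries_iff _ ⟨c, gs⟩).1 he⟩
      · rintro ⟨gs, h⟩
        exact List.mem_map.2 ⟨⟨c, gs⟩, (HMap.mem_entries_iff _ ⟨c, gs⟩).2 h, rfl⟩
    rw [hP] at h₁
    refine ⟨h₁, ?_⟩
    have : (s.parts.entries.map fun x =>
        1 + (14 + (x.2.map fun g => 18 + 17 * g.length).sum)).sum =
        HMap.cost s.parts fun _ gs => 15 + (gs.map fun g => 18 + 17 * g.length).sum := by
      unfold HMap.cost
      congr 2
      funext e
      dsimp only
      omega
    omega

variable [Semiring K] [DecidableEq K] [DecidableEq A]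

/-- The lists `inc` are the lists of incoming transitions of the augmented automaton. -/
structure IsIncoming (inc : Aug Q → List (Aug Q × Option A × K)) (𝒜 : WAut K A Q) : Prop where
  ne_zero : ∀ q, ∀ e ∈ inc q, e.2.2 ≠ 0
  sum_eq : ∀ p a q,
    ((inc q).map fun e => if e.1 = p ∧ e.2.1 = a then e.2.2 else 0).sum = 𝒜.augE p a q

theorem pairSum_lookup_byLetter (l : List (Aug Q × Option A × K)) (p : Aug Q) (a : Option A) :
    pairSum (((HMap.gatherFrom ∅ (byLetter l)).lookup a).getD []) p =
      (l.map fun e => if e.1 = p ∧ e.2.1 = a then e.2.2 else 0).sum := by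
  rw [HMap.getD_lookup_gatherFrom]
  simp only [pairSum, List.map_reverse, List.sum_reverse, byLetter]
  induction l with
  | nil => simp
  | cons e l ih =>
    by_cases ha : e.2.1 = a
    · simp only [List.map_cons, List.sum_cons, ha, and_true, ← ih]
      rw [List.filter_cons_of_pos (by simp)]
      simp
    · simp only [List.map_cons, List.sum_cons, ha, and_false, if_false, zero_add, ← ih]
      rw [List.filter_cons_of_neg (by simpa using ha)]

/-- Summing the pairs met for a letter gives the weight of all the transitions into the class. For a
letter not met both sums are empty, so the comparison over the entries of the table is a comparison
over all the letters. -/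
theorem signatureList_eq_iff_signature {𝒜 : WAut K A Q} {s : Mem K A Q}
    {L : ℕ → List (Aug Q)} (h : IsPartition s L) (hinc : IsIncoming s.inc 𝒜) (d : ℕ)
    (p q : Aug Q) :
    signatureList (HMap.gatherFrom ∅ (byLetter ((L d).flatMap s.inc))).entries p =
      signatureList (HMap.gatherFrom ∅ (byLetter ((L d).flatMap s.inc))).entries q ↔
    𝒜.signature p (classSet s d) = 𝒜.signature q (classSet s d) := by
  set m := HMap.gatherFrom ∅ (byLetter ((L d).flatMap s.inc)) with hm
  have hsum : ∀ p a, pairSum ((m.lookup a).getD []) p = 𝒜.signature p (classSet s d) a := by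
    intro p a
    rw [hm, pairSum_lookup_byLetter, WAut.signature, ← h.sum_eq, List.flatMap, List.map_flatten,
      List.sum_flatten]
    simp [Function.comp_def, hinc.sum_eq]
  rw [signatureList_eq_iff m.nodupKeys]
  constructor
  · intro he
    funext a
    rw [← hsum, ← hsum]
    cases ha : m.lookup a with
    | none => simp [pairSum]
    | some l => exact he ⟨a, l⟩ ((HMap.mem_entries_iff _ _).2 ha)
  · intro he e hem
    have h1 := hsum p e.1
    have h2 := hsum q e.1
    rw [(HMap.mem_entries_iff _ _).1 hem, Option.getD_some] at h1 h2
    rw [h1, h2, he]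

/-- The memory `s'` is obtained from `s` by extracting the class `d` from the queue and splitting the
classes according to the signatures with respect to `d`. -/
structure IsStep (𝒜 : WAut K A Q) (s s' : Mem K A Q) (d : ℕ) : Prop where
  good : Good s'
  inc : s'.inc = s.inc
  quot : s'.quot = s.quot
  numCls_le : s.numCls ≤ s'.numCls
  cls_cases : ∀ p, s'.cls p = s.cls p ∨ s.numCls ≤ s'.cls p
  cls_iff : ∀ p q, s'.cls p = s'.cls q ↔ s.cls p = s.cls q ∧
    𝒜.signature p (classSet s d) = 𝒜.signature q (classSet s d)
  queued : ∀ p, s.cls p ≠ d → s.queued (s.cls p) = true → s'.queued (s'.cls p) = true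
  not_queued : ∀ c < s.numCls, c = d ∨ s.queued c = false → ∃ m, ∀ p, s.cls p = c →
    (s'.cls p ≠ m → s'.queued (s'.cls p) = true) ∧
    (s'.queued (s'.cls p) = true → 2 * s'.size (s'.cls p) ≤ s.size c)

theorem Good.dequeue {s s' : Mem K A Q} (hs : Good s) (hq : s.head < s.tail)
    (hcls : s'.cls = s.cls) (hnext : s'.next = s.next) (hprev : s'.prev = s.prev)
    (hfirst : s'.first = s.first) (hsize : s'.size = s.size) (hnum : s'.numCls = s.numCls)
    (hhead : s'.head = s.head + 1) (htail : s'.tail = s.tail) (hqueue : s'.queue = s.queue)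
    (hqueued : s'.queued = Function.update s.queued (s.queue s.head) false) : Good s' where
  isPartition := hs.isPartition.imp fun _ h => h.congr hcls hnext hprev hfirst hsize hnum
  nonempty := by rw [hnum, hcls]; exact hs.nonempty
  isQueue := by
    refine ⟨by omega, ?_, ?_, ?_⟩
    · intro i j hi hi' hj hj' hij
      rw [hqueue] at hij
      exact hs.isQueue.inj i j (by omega) (by omega) (by omega) (by omega) hij
    · intro c hc
      rw [hnum] at hc
      rw [hqueued, hqueue, hhead, htail]
      by_cases hcd : c = s.queue s.head
      · subst hcd
        simp only [Function.update_self, Bool.false_eq_true, false_iff]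
        rintro ⟨j, h1, h2, h3⟩
        have := hs.isQueue.inj j s.head (by omega) h2 le_rfl hq h3
        omega
      · rw [Function.update_of_ne hcd, hs.isQueue.queued_iff c hc]
        constructor
        · rintro ⟨j, h1, h2, h3⟩
          refine ⟨j, ?_, h2, h3⟩
          rcases h1.lt_or_eq with h1 | rfl
          · exact h1
          · exact absurd h3.symm hcd
        · rintro ⟨j, h1, h2, h3⟩
          exact ⟨j, by omega, h2, h3⟩
    · intro j h1 h2
      rw [hqueue, hnum]
      exact hs.isQueue.lt j (by omega) (by omega)

theorem post_iteration (tie : ℕ → ℕ → Bool) {𝒜 : WAut K A Q} {s : Mem K A Q} (hs : Good s)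
    (hinc : IsIncoming s.inc 𝒜) (hq : s.head < s.tail) :
    (iteration tie).Post s fun _ s' t => IsStep 𝒜 s s' (s.queue s.head) ∧
      t ≤ 125 * ∑ q ∈ classSet s (s.queue s.head), (1 + (s.inc q).length) := by
  set d := s.queue s.head with hd
  have hdlt : d < s.numCls := hs.isQueue.lt _ le_rfl hq
  simp only [iteration, post_bind, post_seq, dequeue, getHead, getQueue, setHead, setQueued,
    post_get, post_put, post_pure, clearTables]
  rw [← hd]
  generalize hs₀' : ({ s with
    head := s.head + 1
    queued := Function.update s.queued d false
    meet := ∅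
    sig := ∅
    groups := ∅
    parts := ∅ } : Mem K A Q) = s₀
  have hs₀ : Good s₀ := by
    subst hs₀'; exact hs.dequeue hq rfl rfl rfl rfl rfl rfl rfl rfl rfl rfl
  have hcls₀ : s₀.cls = s.cls := by subst hs₀'; rfl
  have hinc₀ : s₀.inc = s.inc := by subst hs₀'; rfl
  have hnum₀ : s₀.numCls = s.numCls := by subst hs₀'; rfl
  have hmeet₀ : s₀.meet = ∅ := by subst hs₀'; rfl
  have hsig₀ : s₀.sig = ∅ := by subst hs₀'; rfl
  have hgroups₀ : s₀.groups = ∅ := by subst hs₀'; rfl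
  have hparts₀ : s₀.parts = ∅ := by subst hs₀'; rfl
  have hquot₀ : s₀.quot = s.quot := by subst hs₀'; rfl
  have hsize₀ : s₀.size = s.size := by subst hs₀'; rfl
  have hqueued₀ : s₀.queued = Function.update s.queued d false := by subst hs₀'; rfl
  have hclass₀ : classSet s₀ d = classSet s d := by rw [classSet, hcls₀, classSet]
  clear hs₀'
  obtain ⟨L, hL⟩ := hs₀.isPartition
  have hL₀ : ∀ f : Aug Q → ℕ, ((L d).map f).sum = ∑ q ∈ classSet s d, f q := by
    intro f; rw [hL.sum_eq, hclass₀]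
  refine (post_collect hL.toLinked (hnum₀ ▸ hdlt)).mono ?_
  rintro - s₁ t₁ ⟨hs₁, ht₁⟩
  rw [hmeet₀] at hs₁
  set m := HMap.gatherFrom ∅ (byLetter ((L d).flatMap s₀.inc)) with hm
  set N := ∑ q ∈ classSet s d, (s.inc q).length with hN
  have hcm : HMap.cost m (fun _ l => l.length) = N := by
    have := HMap.cost_gatherFrom (byLetter ((L d).flatMap s₀.inc)) fun _ => 1
    simp only [List.map_const', List.sum_replicate, smul_eq_mul, mul_one] at this
    rw [hm, this, length_byLetter, List.length_flatMap, hL₀, hinc₀]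
  have hne : ∀ e ∈ s₁.meet.entries, ∀ x ∈ e.2, x.2 ≠ 0 := by
    intro e he x hx
    rw [hs₁] at he
    rw [HMap.lookup_gatherFrom _ ((HMap.mem_entries_iff _ _).1 he)] at hx
    simp only [byLetter, List.mem_reverse, List.mem_map, List.mem_filter, List.mem_flatMap] at hx
    obtain ⟨_, ⟨⟨y, ⟨q, -, hy⟩, rfl⟩, -⟩, rfl⟩ := hx
    rw [hinc₀] at hy
    exact hinc.ne_zero q y hy
  refine (post_computeSignatures s₁ (by rw [hs₁]; exact hsig₀) hne).mono ?_
  rintro - s₂ t₂ ⟨hs₂, hsig₂, hcost₂, ht₂⟩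
  have hmeet₁ : s₁.meet = m := by rw [hs₁]
  rw [hmeet₁] at hsig₂ hcost₂ ht₂
  set S := s₂.sig with hS
  have hs₂' : s₂ = { s₀ with meet := m, sig := S } := by rw [hs₂, hs₁]
  refine (post_gather s₂ (by rw [hs₂']; exact hgroups₀) (by rw [hs₂']; exact hparts₀)).mono ?_
  rintro - s₃ t₃ ⟨hs₃, ht₃⟩
  rw [← hS] at hs₃ ht₃
  have hcls₂ : s₂.cls = s.cls := by rw [hs₂']; exact hcls₀
  rw [hcls₂] at hs₃ ht₃
  set G := groupsOf s.cls S with hG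
  have hs₃' : s₃ = { s₀ with meet := m, sig := S, groups := G, parts := partsOf G } := by
    rw [hs₃, hs₂', ← hcls₀]
  have hgood₃ : Good s₃ := by
    rw [hs₃']
    exact ⟨hs₀.isPartition.imp fun _ h => h.congr rfl rfl rfl rfl rfl rfl,
      ⟨hs₀.isQueue.le, hs₀.isQueue.inj, hs₀.isQueue.queued_iff, hs₀.isQueue.lt⟩, hs₀.nonempty⟩
  have hcls₃ : s₃.cls = s.cls := by rw [hs₃']; exact hcls₀
  have hparts₃ : s₃.parts = partsOf G := by rw [hs₃']
  have hnum₃ : s₃.numCls = s.numCls := by rw [hs₃']; exact hnum₀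
  have hqueued₃ : s₃.queued = Function.update s.queued d false := by rw [hs₃']; exact hqueued₀
  have hsize₃ : s₃.size = s.size := by rw [hs₃']; exact hsize₀
  refine (post_splitClasses tie hgood₃ (σ := signatureList m.entries) (z := []) ?_).mono ?_
  · intro c gs hgs
    rw [hparts₃] at hgs
    rw [hcls₃]
    exact isGrouping_of_lookup hsig₂ hgs
  rintro - s₄ t₄ ⟨h₄, ht₄⟩
  rw [hparts₃] at h₄ ht₄
  have hsigiff : ∀ p q, signatureList m.entries p = signatureList m.entries q ↔
      𝒜.signature p (classSet s d) = 𝒜.signature q (classSet s d) := by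
    intro p q
    rw [hm, signatureList_eq_iff_signature hL (hinc₀ ▸ hinc) d p q, hclass₀]
  constructor
  · refine ⟨h₄.good, by rw [h₄.inc, hs₃']; exact hinc₀, by rw [h₄.quot, hs₃']; exact hquot₀,
      hnum₃ ▸ h₄.numCls_le, by rw [← hcls₃, ← hnum₃]; exact h₄.cls_cases, ?_, ?_, ?_⟩
    · intro p q
      rw [← hsigiff, ← hcls₃]
      constructor
      · intro hpq
        have hpq' := h₄.cls_eq p q hpq
        refine ⟨hpq', ?_⟩
        by_cases hP : ∃ gs, (partsOf G).lookup (s₃.cls p) = some gs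
        · exact (h₄.cls_iff p q hP hpq').1 hpq
        -- An unlisted class is not split, and need not be: all its states have zero signature.
        · have h0 : ∀ r, s₃.cls r = s₃.cls p → signatureList m.entries r = [] := by
            intro r hr
            by_contra hr'
            refine hP ?_
            rw [← hr, hcls₃]
            exact exists_lookup_partsOf hsig₂ hr'
          rw [h0 p rfl, h0 q hpq'.symm]
      · rintro ⟨hpq, hσ⟩
        by_cases hP : ∃ gs, (partsOf G).lookup (s₃.cls p) = some gs
        · exact (h₄.cls_iff p q hP hpq).2 hσ
        · rw [h₄.cls_of_not p hP, h₄.cls_of_not q (hpq ▸ hP), hpq]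
    · intro p hp hp'
      refine h₄.queued p ?_
      rw [hcls₃, hqueued₃, Function.update_of_ne hp, hp']
    · intro c hc hcd
      -- The splitter `d` was removed from the queue before the splitting, so its own subclasses are
      -- treated like those of a class that was not queued.
      have := h₄.not_queued c (hnum₃ ▸ hc) (by
        rw [hqueued₃]
        by_cases h : c = d
        · subst h; simp
        · rw [Function.update_of_ne h]; tauto)
      rwa [hcls₃, hsize₃] at this
  -- Nonemptiness of the splitter absorbs the additive constants. The factor of `N` is 3 for the
  -- collection, 8 for the signatures, 8 + 6 for the groups and 100 for the splitting, in total 125.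
  · have hpos : 0 < (classSet s d).card := by
      obtain ⟨p, hp⟩ := hs.nonempty d hdlt
      exact Finset.card_pos.2 ⟨p, by simpa using hp⟩
    have hsum : ∑ q ∈ classSet s d, (1 + (s.inc q).length) = (classSet s d).card + N := by
      rw [Finset.sum_add_distrib]; simp [hN]
    have ht₁' : t₁ ≤ 3 + (4 * (classSet s d).card + 3 * N) := by
      refine ht₁.trans (le_of_eq ?_)
      rw [hL₀, hinc₀, Finset.sum_add_distrib, ← Finset.mul_sum]
      simp [hN, Nat.mul_comm]
    have ht₂' : HMap.cost m (fun _ l => 2 + 6 * l.length) ≤ 8 * N := by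
      rw [← hcm]
      have : 8 * HMap.cost m (fun _ l => l.length) = HMap.cost m (fun _ l => 8 * l.length) := by
        simp [HMap.cost, List.sum_map_mul_left]
      rw [this]
      refine HMap.cost_mono _ fun k l hl => ?_
      have := List.length_pos_of_ne_nil (HMap.ne_nil_of_lookup_gatherFrom _ _ hl)
      omega
    have hconst : ∀ k, HMap.cost S (fun _ _ => k) ≤ k * (2 * N) := by
      intro k
      rw [← hcm]
      refine le_trans ?_ (Nat.mul_le_mul_left k hcost₂)
      have : k * HMap.cost S (fun _ l => 1 + l.length) =
          HMap.cost S (fun _ l => k * (1 + l.length)) := by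
        simp [HMap.cost, List.sum_map_mul_left]
      rw [this]
      refine HMap.cost_mono _ fun _ l _ => ?_
      nlinarith
    have ht₃' : HMap.cost S (fun _ l => 4 + 2 * l.length) ≤ 4 * (2 * N) := by
      rw [← hcm]
      refine le_trans ?_ (Nat.mul_le_mul_left 4 hcost₂)
      have : 4 * HMap.cost S (fun _ l => 1 + l.length) =
          HMap.cost S (fun _ l => 4 * (1 + l.length)) := by
        simp [HMap.cost, List.sum_map_mul_left]
      rw [this]
      refine HMap.cost_mono _ fun _ l _ => ?_
      omega
    have ht₃'' : HMap.cost G (fun _ _ => 3) ≤ 3 * (2 * N) := by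
      have := cost_groupsOf s.cls S 3 0
      simp only [zero_mul, add_zero] at this
      exact this.trans (hconst 3)
    have ht₄' := (cost_partsOf G 15 18 17).trans ((cost_groupsOf s.cls S 33 17).trans (hconst 50))
    rw [hsum]
    omega

end FPCSA

/-! ### The main loop -/

namespace WAut

variable {K A Q : Type*} [Semiring K]

/-- `r` implies equality of the signatures with respect to the sets that are unions of classes of `r`. -/
def IsCongruence (𝒜 : WAut K A Q) (r : Q → Q → Prop) : Prop :=
  ∀ p q, r p q → ∀ D : Finset (Aug Q), (∀ x y, r x y → (Aug.state x ∈ D ↔ Aug.state y ∈ D)) →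
    𝒜.signature (.state p) D = 𝒜.signature (.state q) D

end WAut

namespace FPCSA

open Prog

variable {K A Q : Type*} [DecidableEq Q] [Finite Q] [Semiring K] [DecidableEq K] [DecidableEq A]

/-- States in the same class have the same signature with respect to `D`. -/
def IsStable (𝒜 : WAut K A Q) (cls : Aug Q → ℕ) (D : Finset (Aug Q)) : Prop :=
  ∀ p q, cls p = cls q → 𝒜.signature p D = 𝒜.signature q D

/-- The invariant of the main loop. -/
structure LoopInv (𝒜 : WAut K A Q) (s : Mem K A Q) : Prop where
  good : Good s
  isIncoming : IsIncoming s.inc 𝒜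
  quot : s.quot = ∅
  two_le : 2 ≤ s.numCls
  cls_ini : ∀ p, s.cls p = 0 ↔ p = .ini
  cls_fin : ∀ p, s.cls p = 1 ↔ p = .fin
  congr : ∀ r, 𝒜.IsCongruence r → ∀ p q, r p q → s.cls (.state p) = s.cls (.state q)
  stable_fin : s.queued 1 = false → IsStable 𝒜 s.cls (classSet s 1)
  stable : ∀ c, 2 ≤ c → c < s.numCls → s.queued c = false → ∃ W : Finset Q,
    (∀ q, s.cls (.state q) = c → q ∈ W) ∧
    (∀ q ∈ W, s.cls (.state q) = c ∨ s.queued (s.cls (.state q)) = true) ∧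
    (∀ q q', s.cls (.state q) = s.cls (.state q') → q ∈ W → q' ∈ W) ∧
    IsStable 𝒜 s.cls (W.map (Aug.emb Q))

theorem LoopInv.exists_state {𝒜 : WAut K A Q} {s : Mem K A Q} (h : LoopInv 𝒜 s) {p : Aug Q}
    (hp : 2 ≤ s.cls p) : ∃ q, p = .state q := by
  cases p with
  | ini => have := (h.cls_ini .ini).2 rfl; omega
  | fin => have := (h.cls_fin .fin).2 rfl; omega
  | state q => exact ⟨q, rfl⟩

theorem LoopInv.two_le_cls {𝒜 : WAut K A Q} {s : Mem K A Q} (h : LoopInv 𝒜 s) (q : Q) :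
    2 ≤ s.cls (.state q) := by
  have h0 := h.cls_ini (.state q)
  have h1 := h.cls_fin (.state q)
  simp only [reduceCtorEq, iff_false] at h0 h1
  omega

/-- The classes of the two added states are singletons, so only true states matter; these are the
only ones that simplifiability speaks of. -/
theorem LoopInv.stable_of_states {𝒜 : WAut K A Q} {s : Mem K A Q} (h : LoopInv 𝒜 s)
    {cls : Aug Q → ℕ} (hcls : ∀ p q, cls p = cls q → s.cls p = s.cls q) {D : Finset (Aug Q)}
    (hD : ∀ p q, cls (.state p) = cls (.state q) →
      𝒜.signature (.state p) D = 𝒜.signature (.state q) D) : IsStable 𝒜 cls D := by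
  intro p q hpq
  have h' := hcls p q hpq
  cases p with
  | ini => rw [(h.cls_ini .ini).2 rfl] at h'; rw [(h.cls_ini q).1 h'.symm]
  | fin => rw [(h.cls_fin .fin).2 rfl] at h'; rw [(h.cls_fin q).1 h'.symm]
  | state p =>
    obtain ⟨q, rfl⟩ := h.exists_state (h' ▸ h.two_le_cls p)
    exact hD p q hpq

theorem LoopInv.classSet_eq_map {𝒜 : WAut K A Q} {s : Mem K A Q} (h : LoopInv 𝒜 s) {c : ℕ}
    (hc : 2 ≤ c) {W : Finset Q} (hW : ∀ q, q ∈ W ↔ s.cls (.state q) = c) :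
    W.map (Aug.emb Q) = classSet s c := by
  ext p
  rw [Finset.mem_map, mem_classSet]
  constructor
  · rintro ⟨q, hq, rfl⟩
    exact (hW q).1 hq
  · intro hp
    obtain ⟨q, rfl⟩ := h.exists_state (hp ▸ hc)
    exact ⟨q, (hW q).2 hp, rfl⟩

/-- A class `c'` outside the queue after the step comes either from `d` or from a class `c` that was
not queued before. In the first case `d` itself is the new witness, in the second the old witness
without the states of `d`. -/
theorem LoopInv.step {𝒜 : WAut K A Q} (hsimp : 𝒜.SimplifiableSignatures) {s s' : Mem K A Q}
    (h : LoopInv 𝒜 s) {d : ℕ} (hd : d < s.numCls) (hs : IsStep 𝒜 s s' d) : LoopInv 𝒜 s' := by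
  classical
  have := Fintype.ofFinite Q
  have htwo := h.two_le
  have hle := hs.numCls_le
  have hcls : ∀ p q, s'.cls p = s'.cls q → s.cls p = s.cls q := fun p q hpq =>
    ((hs.cls_iff p q).1 hpq).1
  -- New names are at least 2, so only the old state of class 0 or 1 can carry this name, and it
  -- does, since no class is empty.
  have hsmall : ∀ c x, c < 2 → (∀ p, s.cls p = c ↔ p = x) → ∀ p, s'.cls p = c ↔ p = x := by
    intro c x hc hx p
    have hback : ∀ p, s'.cls p = c → p = x := by
      intro p hp
      rcases hs.cls_cases p with h1 | h1
      · exact (hx p).1 (by omega)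
      · omega
    refine ⟨hback p, ?_⟩
    rintro rfl
    obtain ⟨q, hq⟩ := hs.good.nonempty c (by omega)
    rw [← hback q hq]
    exact hq
  have hini := hsmall 0 _ (by omega) h.cls_ini
  have hfin := hsmall 1 _ (by omega) h.cls_fin
  refine ⟨hs.good, hs.inc ▸ h.isIncoming, hs.quot.trans h.quot, by omega, hini, hfin, ?_, ?_, ?_⟩
  · intro r hr p q hpq
    rw [hs.cls_iff]
    refine ⟨h.congr r hr p q hpq, hr p q hpq _ fun x y hxy => ?_⟩
    rw [mem_classSet, mem_classSet, h.congr r hr x y hxy]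
  · intro hq
    have hset : classSet s' 1 = classSet s 1 := by ext p; simp [hfin, h.cls_fin]
    rw [hset]
    intro p q hpq
    by_cases hd1 : d = 1
    · subst hd1
      exact ((hs.cls_iff p q).1 hpq).2
    · refine h.stable_fin ?_ p q (hcls p q hpq)
      by_contra hq1
      have := hs.queued .fin (by rw [(h.cls_fin _).2 rfl]; omega)
        (by rw [(h.cls_fin _).2 rfl]; simpa using hq1)
      rw [(hfin _).2 rfl, hq] at this
      simp at this
  · intro c' hc' hc'lt hq'
    obtain ⟨p₀, hp₀⟩ := hs.good.nonempty c' hc'lt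
    have hp₀2 : 2 ≤ s.cls p₀ := by
      have h0 := h.cls_ini p₀
      have h1 := h.cls_fin p₀
      rw [← hini] at h0
      rw [← hfin] at h1
      omega
    have hcase : s.cls p₀ = d ∨ s.queued (s.cls p₀) = false := by
      by_contra hcon
      push Not at hcon
      have := hs.queued p₀ hcon.1 (by simpa using hcon.2)
      rw [hp₀, hq'] at this
      simp at this
    obtain ⟨m, hm⟩ := hs.not_queued _ (h.good.cls_lt p₀) hcase
    -- All subclasses other than `m` are queued, so `c'` is the one left out.
    have hmc : c' = m := by
      by_contra hne
      have := (hm p₀ rfl).1 (by omega)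
      rw [hp₀, hq'] at this
      simp at this
    subst hmc
    by_cases hcd : s.cls p₀ = d
    · rw [hcd] at hm hp₀2
      refine ⟨Finset.univ.filter fun q => s.cls (.state q) = d, ?_, ?_, ?_, ?_⟩
      · intro q hq
        have := hcls (.state q) p₀ (by omega)
        simp [this, hcd]
      · intro q hq
        have hq : s.cls (.state q) = d := by simpa using hq
        by_cases hqc : s'.cls (.state q) = c'
        · exact .inl hqc
        · exact .inr ((hm _ hq).1 hqc)
      · intro q q' hqq hq
        have hq : s.cls (.state q) = d := by simpa using hq
        simp [← hcls _ _ hqq, hq]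
      · rw [h.classSet_eq_map hp₀2 (by simp)]
        exact fun p q hpq => ((hs.cls_iff p q).1 hpq).2
    · obtain ⟨W, hW1, hW2, hW3, hW4⟩ := h.stable _ hp₀2 (h.good.cls_lt p₀) (by tauto)
      refine ⟨W.filter fun q => s.cls (.state q) ≠ d, ?_, ?_, ?_, ?_⟩
      · intro q hq
        have := hcls (.state q) p₀ (by omega)
        rw [Finset.mem_filter]
        exact ⟨hW1 q this, by omega⟩
      · intro q hq
        rw [Finset.mem_filter] at hq
        by_cases hqc : s'.cls (.state q) = c'
        · exact .inl hqc
        · right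
          rcases hW2 q hq.1 with hq1 | hq1
          · exact (hm _ hq1).1 hqc
          · exact hs.queued _ hq.2 hq1
      · intro q q' hqq hq
        rw [Finset.mem_filter] at hq ⊢
        have := hcls _ _ hqq
        exact ⟨hW3 q q' this hq.1, by rw [← this]; exact hq.2⟩
      -- As `W` is a union of classes, `d` is contained in it or disjoint from it. Simplifiability
      -- is needed in the first case only.
      · by_cases hex : ∃ q ∈ W, s.cls (.state q) = d
        · obtain ⟨q₀, hq₀, hq₀d⟩ := hex
          set C := Finset.univ.filter fun q => s.cls (.state q) = d with hC
          have hCW : C ⊆ W := by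
            intro q hq
            have hq : s.cls (.state q) = d := by simpa [hC] using hq
            exact hW3 q₀ q (by omega) hq₀
          have hWC : (W.filter fun q => s.cls (.state q) ≠ d) = W \ C := by
            ext q; simp [hC]
          rw [hWC]
          refine h.stable_of_states hcls fun p q hpq => hsimp W C hCW p q ?_ ?_
          · exact hW4 _ _ (hcls _ _ hpq)
          · rw [h.classSet_eq_map (hq₀d ▸ h.two_le_cls q₀) (W := C) (by simp [hC])]
            exact ((hs.cls_iff _ _).1 hpq).2
        · have : (W.filter fun q => s.cls (.state q) ≠ d) = W := by
            refine Finset.filter_true_of_mem fun q hq hqd => hex ⟨q, hq, hqd⟩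
          rw [this]
          exact fun p q hpq => hW4 p q (hcls p q hpq)

/-! ### The potential of the smaller-half argument -/

/-- The number of extractions of the class of a state that can still happen, at most. -/
def extractions (s : Mem K A Q) (p : Aug Q) : ℕ :=
  Nat.log 2 (s.size (s.cls p)) + if s.queued (s.cls p) = true then 1 else 0

/-- The potential that pays for the iterations. -/
noncomputable def potential (s : Mem K A Q) : ℕ :=
  ∑ p : Aug Q, (1 + (s.inc p).length) * extractions s p

/-- If the class of `p` is extracted or was not queued, then its subclass is queued only with at
most half the size: the logarithm drops by one and pays for the queue bit. If the class was queued
and stays there, sizes can only decrease. -/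
theorem extractions_step {𝒜 : WAut K A Q} {s s' : Mem K A Q} (h : Good s) {d : ℕ}
    (hq : s.queued d = true) (hs : IsStep 𝒜 s s' d) (p : Aug Q) :
    extractions s' p + (if s.cls p = d then 1 else 0) ≤ extractions s p := by
  have hsize := h.size_le hs.good (p := p) fun q hq => ((hs.cls_iff q p).1 hq).1
  have hmono := Nat.log_mono_right (b := 2) hsize
  have hpos : s'.size (s'.cls p) ≠ 0 := by
    rw [hs.good.size_eq (hs.good.cls_lt p)]
    exact (Finset.card_pos.2 ⟨p, by simp⟩).ne'
  have key : (s.cls p = d ∨ s.queued (s.cls p) = false) →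
      extractions s' p ≤ Nat.log 2 (s.size (s.cls p)) := by
    intro hc
    obtain ⟨m, hm⟩ := hs.not_queued _ (h.cls_lt p) hc
    unfold extractions
    split_ifs with hq'
    · have := Nat.log_mono_right (b := 2) ((hm p rfl).2 hq')
      rwa [Nat.mul_comm, Nat.log_mul_base (by omega) hpos] at this
    · simpa using hmono
  by_cases hpd : s.cls p = d
  · have := key (.inl hpd)
    rw [if_pos hpd]
    unfold extractions at this ⊢
    rw [hpd] at this ⊢
    rw [if_pos hq]
    omega
  · rw [if_neg hpd]
    cases hqp : s.queued (s.cls p) with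
    | false =>
      have := key (.inr hqp)
      unfold extractions at this ⊢
      omega
    | true =>
      unfold extractions
      rw [if_pos hqp]
      split_ifs <;> omega

theorem potential_step {𝒜 : WAut K A Q} {s s' : Mem K A Q} (h : Good s) {d : ℕ}
    (hq : s.queued d = true) (hs : IsStep 𝒜 s s' d) :
    potential s' + ∑ q ∈ classSet s d, (1 + (s.inc q).length) ≤ potential s := by
  unfold potential classSet
  rw [Finset.sum_filter, ← Finset.sum_add_distrib, hs.inc]
  refine Finset.sum_le_sum fun p _ => ?_
  have := Nat.mul_le_mul_left (1 + (s.inc p).length) (extractions_step h hq hs p)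
  rw [Nat.mul_add] at this
  split_ifs at this ⊢ <;> omega

/-- The main loop halts, with a stable partition that is coarser than all the congruences. -/
theorem exists_while_iteration (tie : ℕ → ℕ → Bool) {𝒜 : WAut K A Q}
    (hsimp : 𝒜.SimplifiableSignatures) {s : Mem K A Q} (h : LoopInv 𝒜 s) :
    ∃ s' t, While queueNonempty (iteration tie) s s' t ∧ LoopInv 𝒜 s' ∧ s'.inc = s.inc ∧
      (∀ c, 1 ≤ c → c < s'.numCls → IsStable 𝒜 s'.cls (classSet s' c)) ∧
      t ≤ 128 * potential s + 3 := by
  have hguard : ∀ s : Mem K A Q, queueNonempty.Post s fun b s' t =>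
      b = decide (s.head < s.tail) ∧ s' = s ∧ t ≤ 3 := by
    intro s; simp [queueNonempty, getHead, getTail]
  obtain ⟨s', t, hw, ⟨hI, hinc⟩, hend, ht⟩ := exists_while (guard := queueNonempty)
    (body := iteration tie) (fun s' => LoopInv 𝒜 s' ∧ s'.inc = s.inc) potential 3 125
    (fun s _ => (hguard s).mono fun _ _ _ h => h.2) (by
      rintro s₁ ⟨h₁, hinc₁⟩ hg
      have hlt : s₁.head < s₁.tail := by
        have h2 := (hguard s₁).1
        rw [hg] at h2
        simpa using h2.symm
      refine (post_iteration tie h₁.good h₁.isIncoming hlt).mono ?_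
      rintro - s₂ t ⟨h₂, ht⟩
      have hd := h₁.good.isQueue.lt _ le_rfl hlt
      have hq : s₁.queued (s₁.queue s₁.head) = true :=
        (h₁.good.isQueue.queued_iff _ hd).2 ⟨_, le_rfl, hlt, rfl⟩
      have hpot := potential_step h₁.good hq h₂
      have hpos : 0 < ∑ q ∈ classSet s₁ (s₁.queue s₁.head), (1 + (s₁.inc q).length) := by
        obtain ⟨p, hp⟩ := h₁.good.nonempty _ hd
        exact Finset.sum_pos (fun _ _ => by omega) ⟨p, by simpa using hp⟩
      exact ⟨⟨h₁.step hsimp hd h₂, h₂.inc.trans hinc₁⟩, by omega, by omega⟩) s ⟨h, rfl⟩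
  refine ⟨s', t, hw, hI, hinc, ?_, ht⟩
  have hempty : ¬ s'.head < s'.tail := by
    have h2 := (hguard s').1
    rw [hend] at h2
    simpa using h2.symm
  have hnq : ∀ c < s'.numCls, s'.queued c = false := by
    intro c hc
    rw [← Bool.not_eq_true, hI.good.isQueue.queued_iff c hc]
    rintro ⟨j, h1, h2, -⟩
    omega
  intro c hc1 hc
  by_cases hc2 : c = 1
  · subst hc2; exact hI.stable_fin (hnq 1 hc)
  -- With an empty queue, the states of `W` cannot lie in a queued class, so `W` is the class `c`
  -- itself.
  · obtain ⟨W, hW1, hW2, -, hW4⟩ := hI.stable c (by omega) hc (hnq c hc)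
    rwa [hI.classSet_eq_map (W := W) (c := c) (by omega)] at hW4
    intro q
    refine ⟨fun hq => ?_, hW1 q⟩
    rcases hW2 q hq with h' | h'
    · exact h'
    · rw [hnq _ (hI.good.cls_lt _)] at h'
      simp at h'

end FPCSA

/-! ### Preparation -/

namespace FPCSA

open Prog

variable {K A Q : Type*} [DecidableEq Q] [Semiring K] [DecidableEq K] [DecidableEq A]

/-- Add a list of transitions `(q, p, a, k)`, from `p` to `q`, to the lists of incoming transitions. -/
def addIncs (inc : Aug Q → List (Aug Q × Option A × K)) (l : List (Aug Q × Aug Q × Option A × K)) :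
    Aug Q → List (Aug Q × Option A × K) :=
  l.foldl (fun inc e => if e.2.2.2 = 0 then inc else
    Function.update inc e.1 (e.2 :: inc e.1)) inc

theorem addIncs_append (inc : Aug Q → List (Aug Q × Option A × K))
    (l l' : List (Aug Q × Aug Q × Option A × K)) :
    addIncs inc (l ++ l') = addIncs (addIncs inc l) l' := by simp [addIncs]

theorem post_addInc (q p : Aug Q) (a : Option A) (k : K) (s : Mem K A Q) :
    (addInc q p a k).Post s fun _ s' t =>
      s' = { s with inc := addIncs s.inc [(q, p, a, k)] } ∧ t ≤ 3 := by
  by_cases hk : k = 0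
  · simp [addInc, isZeroWeight, hk, addIncs]
  · simp [addInc, isZeroWeight, hk, addIncs, getInc, setInc]

/-- The transitions of the augmented automaton, in the form `(q, p, a, k)`, some of them with
weight zero. -/
def Input.augTrans (inp : Input K A Q) : List (Aug Q × Aug Q × Option A × K) :=
  (inp.states.flatMap fun q =>
    [(.state q, .ini, none, inp.I q), (.fin, .state q, none, inp.T q)]) ++
  inp.trans.map fun e => (.state e.2.2.2, .state e.1, some e.2.1, e.2.2.1)

theorem post_prepareTransitions (inp : Input K A Q) :
    (prepareTransitions inp).Post (Mem.blank K A Q) fun _ s' t =>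
      s' = { Mem.blank K A Q with inc := addIncs (fun _ => []) inp.augTrans } ∧
      t ≤ 5 + 11 * inp.states.length + 4 * inp.trans.length := by
  have hset : ∀ q : Aug Q, (setInc q []).Post (Mem.blank K A Q) fun _ s' t =>
      s' = Mem.blank K A Q ∧ t = 1 := by
    intro q
    simp only [setInc, post_put, Mem.blank, and_true]
    congr
    exact Function.update_eq_self q _
  simp only [prepareTransitions, post_seq]
  refine (hset _).mono ?_
  rintro - _ _ ⟨rfl, rfl⟩
  refine (hset _).mono ?_
  rintro - _ _ ⟨rfl, rfl⟩
  refine (post_forEach (fun _ s' => s' = Mem.blank K A Q) (fun _ => 1) rfl ?_).mono ?_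
  · rintro - q - _ - rfl
    exact (hset _).mono fun _ _ _ h => ⟨h.1, h.2.le⟩
  rintro - _ t₁ ⟨rfl, ht₁⟩
  refine (post_forEach (fun pre s' => s' = { Mem.blank K A Q with
    inc := addIncs (fun _ => []) (pre.flatMap fun q =>
      [(.state q, .ini, none, inp.I q), (.fin, .state q, none, inp.T q)]) }) (fun _ => 8)
    (by simp [addIncs, Mem.blank]) ?_).mono ?_
  · rintro pre q post _ - rfl
    simp only [post_bind, post_get, post_seq]
    refine (post_addInc _ _ _ _ _).mono ?_
    rintro - _ t ⟨rfl, ht⟩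
    refine (post_addInc _ _ _ _ _).mono ?_
    rintro - _ t' ⟨rfl, ht'⟩
    refine ⟨?_, by omega⟩
    simp only [List.flatMap_append, List.flatMap_cons, List.flatMap_nil, List.append_nil,
      ← addIncs_append, List.append_assoc, List.cons_append, List.nil_append]
  rintro - _ t₂ ⟨rfl, ht₂⟩
  refine (post_forEach (fun pre s' => s' = { Mem.blank K A Q with
    inc := addIncs (fun _ => []) ((inp.states.flatMap fun q =>
      [(.state q, .ini, none, inp.I q), (.fin, .state q, none, inp.T q)]) ++
      pre.map fun e => (.state e.2.2.2, .state e.1, some e.2.1, e.2.2.1)) }) (fun _ => 3)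
    (by simp) ?_).mono ?_
  · rintro pre e post _ - rfl
    refine (post_addInc _ _ _ _ _).mono ?_
    rintro - _ t ⟨rfl, ht⟩
    refine ⟨?_, ht⟩
    simp only [← addIncs_append, List.append_assoc, List.map_append, List.map_cons, List.map_nil]
  rintro - _ t₃ ⟨rfl, ht₃⟩
  refine ⟨rfl, ?_⟩
  simp only [List.map_const', List.sum_replicate, smul_eq_mul] at ht₁ ht₂ ht₃
  omega

theorem addIncs_ne_zero (l : List (Aug Q × Aug Q × Option A × K)) (q : Aug Q) :
    ∀ e ∈ addIncs (fun _ => []) l q, e.2.2 ≠ 0 := by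
  induction l using List.reverseRecOn with
  | nil => simp [addIncs]
  | append_singleton l x ih =>
    rw [addIncs_append]
    simp only [addIncs, List.foldl_cons, List.foldl_nil] at ih ⊢
    split_ifs with hx
    · exact ih
    · by_cases hq : q = x.1
      · subst hq
        simp only [Function.update_self, List.mem_cons]
        rintro e (rfl | he)
        · exact hx
        · exact ih e he
      · rwa [Function.update_of_ne hq]

/-- The transitions of weight zero that are skipped contribute nothing to the sums, so the lists
represent the same weights. -/
theorem sum_addIncs (l : List (Aug Q × Aug Q × Option A × K)) (p : Aug Q) (a : Option A)
    (q : Aug Q) :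
    ((addIncs (fun _ => []) l q).map fun e => if e.1 = p ∧ e.2.1 = a then e.2.2 else 0).sum =
      (l.map fun e => if e.1 = q ∧ e.2.1 = p ∧ e.2.2.1 = a then e.2.2.2 else 0).sum := by
  induction l using List.reverseRecOn with
  | nil => simp [addIncs]
  | append_singleton l x ih =>
    rw [addIncs_append, List.map_append, List.sum_append, ← ih]
    set inc := addIncs (fun _ => []) l
    simp only [addIncs, List.foldl_cons, List.foldl_nil, List.map_cons, List.map_nil,
      List.sum_cons, List.sum_nil, add_zero]
    split_ifs with hx hx' hx'
    · rw [hx, add_zero]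
    · rw [add_zero]
    · obtain ⟨rfl, rfl, rfl⟩ := hx'
      simp [add_comm]
    · by_cases hq : q = x.1
      · subst hq
        simp only [true_and] at hx'
        simp [hx']
      · rw [Function.update_of_ne hq, add_zero]

theorem sum_length_addIncs_le [Finite Q] (l : List (Aug Q × Aug Q × Option A × K)) :
    ∑ q, (addIncs (fun _ => []) l q).length ≤ l.length := by
  induction l using List.reverseRecOn with
  | nil => simp [addIncs]
  | append_singleton l x ih =>
    rw [addIncs_append, List.length_append, List.length_singleton]
    set inc := addIncs (fun _ => []) l
    simp only [addIncs, List.foldl_cons, List.foldl_nil]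
    split_ifs with hx
    · omega
    · have : ∀ q, (Function.update inc x.1 (x.2 :: inc x.1) q).length =
          (inc q).length + if q = x.1 then 1 else 0 := by
        intro q
        by_cases hq : q = x.1
        · subst hq; simp
        · simp [hq]
      simp only [this, Finset.sum_add_distrib, Finset.sum_ite_eq', Finset.mem_univ, if_true]
      omega

/-! ### The described input and the first partition -/

section Describes

variable [Fintype Q] {𝒜 : WAut K A Q} {inp : Input K A Q}

theorem Input.Describes.sum_states (h : inp.Describes 𝒜) {R : Type*} [AddCommMonoid R]
    (f : Q → R) : (inp.states.map f).sum = ∑ q, f q := by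
  rw [← List.sum_toFinset f h.states_nodup]
  congr
  ext q
  simp [h.mem_states]

theorem Input.Describes.length_states (h : inp.Describes 𝒜) :
    inp.states.length = Fintype.card Q := by
  have := h.sum_states fun _ => 1
  simpa using this

/-- A weight is determined by origin, label and end, so forgetting it is injective on the list. -/
theorem Input.Describes.length_trans (h : inp.Describes 𝒜) :
    inp.trans.length = 𝒜.numTransitions := by
  have himg : {e : Q × A × Q | 𝒜.E e.2.1 e.1 e.2.2 ≠ 0} =
      ((inp.trans.toFinset.image fun e => (e.1, e.2.1, e.2.2.2) : Finset (Q × A × Q)) :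
        Set (Q × A × Q)) := by
    ext ⟨p, a, q⟩
    simp only [Set.mem_ofPred_eq, Finset.coe_image, Set.mem_image, Finset.mem_coe,
      List.mem_toFinset, Prod.mk.injEq]
    constructor
    · intro hne
      exact ⟨(p, a, 𝒜.E a p q, q), (h.mem_trans _ _ _ _).2 ⟨rfl, hne⟩, rfl, rfl, rfl⟩
    · rintro ⟨⟨p', a', k, q'⟩, he, rfl, rfl, rfl⟩
      have := (h.mem_trans _ _ _ _).1 he
      rw [this.1]
      exact this.2
  rw [WAut.numTransitions, himg, Set.ncard_coe_finset, Finset.card_image_of_injOn,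
    List.toFinset_card_of_nodup h.trans_nodup]
  rintro ⟨p, a, k, q⟩ he ⟨p', a', k', q'⟩ he' heq
  simp only [Finset.mem_coe, List.mem_toFinset] at he he'
  simp only [Prod.mk.injEq] at heq
  obtain ⟨rfl, rfl, rfl⟩ := heq
  rw [((h.mem_trans _ _ _ _).1 he).1.symm, ((h.mem_trans _ _ _ _).1 he').1.symm]

theorem Input.Describes.sum_trans (h : inp.Describes 𝒜) (p : Q) (a : A) (q : Q) :
    (inp.trans.map fun e => if e.2.2.2 = q ∧ e.1 = p ∧ e.2.1 = a then e.2.2.1 else 0).sum =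
      𝒜.E a p q := by
  rw [← List.sum_toFinset _ h.trans_nodup, Finset.sum_eq_single (p, a, 𝒜.E a p q, q)]
  · simp
  · rintro ⟨p', a', k, q'⟩ he hne
    rw [if_neg]
    rintro ⟨rfl, rfl, rfl⟩
    rw [List.mem_toFinset, h.mem_trans] at he
    exact hne (by rw [he.1])
  · intro hn
    rw [List.mem_toFinset, h.mem_trans] at hn
    simp only [true_and, not_not] at hn
    simp [hn]

theorem Input.Describes.isIncoming (h : inp.Describes 𝒜) :
    IsIncoming (addIncs (fun _ => []) inp.augTrans) 𝒜 where
  ne_zero := addIncs_ne_zero _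
  sum_eq p a q := by
    rw [sum_addIncs, Input.augTrans, List.map_append, List.sum_append, List.flatMap,
      List.map_flatten, List.sum_flatten, List.map_map, List.map_map, List.map_map, h.sum_states]
    simp only [Function.comp_def, List.map_cons, List.map_nil, List.sum_cons, List.sum_nil,
      add_zero, h.I_eq, h.T_eq]
    cases p <;> cases a <;> cases q <;> simp [WAut.augE]
    · exact h.sum_trans _ _ _

theorem Input.Describes.sum_length_inc_le (h : inp.Describes 𝒜) :
    ∑ q, (addIncs (fun _ => []) inp.augTrans q).length ≤
      2 * Fintype.card Q + 𝒜.numTransitions := by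
  refine (sum_length_addIncs_le _).trans (le_of_eq ?_)
  rw [← h.length_states, ← h.length_trans, Input.augTrans, List.length_append, List.length_map,
    List.length_flatMap]
  simp [Nat.mul_comm]

theorem isQueue_of_empty {s : Mem K A Q} (h : s.head = s.tail) (hq : ∀ c, s.queued c = false) :
    IsQueue s where
  le := h.le
  inj _ _ _ _ := by omega
  queued_iff c _ := by
    rw [hq]
    simp only [Bool.false_eq_true, false_iff]
    rintro ⟨j, h1, h2, -⟩
    omega
  lt _ _ _ := by omega

/-- Every class but that of the initial state is queued, so the stability conditions are vacuous;
all true states share a class, so every congruence is respected. The two cases differ in whether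
that class exists. -/
theorem post_preparePartition (h : inp.Describes 𝒜) {s : Mem K A Q}
    (hinc : IsIncoming s.inc 𝒜) (hs : s = { Mem.blank K A Q with inc := s.inc }) :
    (preparePartition inp).Post s fun _ s' t => LoopInv 𝒜 s' ∧ s'.inc = s.inc ∧
      t ≤ 41 + 9 * inp.states.length := by
  have hL : Linked s fun _ => [] := by
    rw [hs]
    exact ⟨by simp, by simp, by simp, by simp [Mem.blank], by simp [Mem.blank], by simp, by simp⟩
  have hnum : s.numCls = 0 := by rw [hs]; rfl
  have hhead : s.head = s.tail := by rw [hs]; rfl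
  have hqueued : ∀ c, s.queued c = false := by rw [hs]; intro; rfl
  have hquot : s.quot = ∅ := by rw [hs]; rfl
  clear hs
  simp only [preparePartition, post_bind, post_seq]
  refine (post_newClass hL).mono ?_
  rintro _ s₁ t₁ ⟨rfl, hL₁, hc₁, hn₁, hq₁, hi₁, -, hh₁, htl₁, hqt₁, rfl⟩
  refine (post_link hL₁ (by omega) (p := .ini) (by simp)).mono ?_
  rintro - s₂ t₂ ⟨hL₂, hS₂, hc₂, ht₂⟩
  refine (post_newClass hL₂).mono ?_
  rintro _ s₃ t₃ ⟨rfl, hL₃, hc₃, hn₃, hq₃, hi₃, -, hh₃, htl₃, hqt₃, rfl⟩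
  have hn₂ : s₂.numCls = 1 := by rw [hS₂.numCls, hn₁, hnum]
  rw [hn₂] at hn₃
  refine (post_link hL₃ (c := s₂.numCls) (p := .fin) (by omega) ?_).mono ?_
  · intro x
    by_cases hx : x = s.numCls
    · subst hx; simp
    · simp [hx]
  rintro - s₄ t₄ ⟨hL₄, hS₄, hc₄, ht₄⟩
  rw [hnum, hn₂] at hL₄
  simp only [ne_eq, one_ne_zero, not_false_eq_true, Function.update_of_ne] at hL₄
  set L₄ : ℕ → List (Aug Q) := Function.update (Function.update (fun _ => []) 0 [.ini]) 1 [.fin]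
    with hL₄def
  have hn₄ : s₄.numCls = 2 := by rw [hS₄.numCls, hn₃]
  have hq₄ : ∀ c, s₄.queued c = false := by
    intro c
    rw [hS₄.queued, hq₃, hS₂.queued, hq₁]
    simp [Function.update_apply, hqueued]
  have hh₄ : s₄.head = s₄.tail := by
    rw [hS₄.head, hh₃, hS₂.head, hh₁, hS₄.tail, htl₃, hS₂.tail, htl₁, hhead]
  have hini₄ : s₄.cls .ini = 0 := by
    rw [hc₄, hc₃, hc₂, hnum]; simp
  have hfin₄ : s₄.cls .fin = 1 := by
    rw [hc₄, hn₂]; simp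
  have hinc₄ : s₄.inc = s.inc := by rw [hS₄.inc, hi₃, hS₂.inc, hi₁]
  have hquot₄ : s₄.quot = ∅ := by rw [hS₄.quot, hqt₃, hS₂.quot, hqt₁, hquot]
  cases hst : inp.states with
  | nil =>
    have hQ : ∀ q : Q, False := fun q => by simpa [hst] using h.mem_states q
    rw [post_tick]
    refine (post_enqueue (isQueue_of_empty hh₄ hq₄) (e := s₂.numCls) (by omega) (hq₄ _)).mono ?_
    rintro - s₅ t₅ ⟨hQ₅, hS₅, hqd₅, rfl⟩
    rw [hn₂] at hqd₅
    have hini : ∀ p, s₅.cls p = 0 ↔ p = .ini := by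
      intro p; rw [hS₅.cls]; cases p with
      | ini => simp [hini₄]
      | fin => simp [hfin₄]
      | state q => exact (hQ q).elim
    have hfin : ∀ p, s₅.cls p = 1 ↔ p = .fin := by
      intro p; rw [hS₅.cls]; cases p with
      | ini => simp [hini₄]
      | fin => simp [hfin₄]
      | state q => exact (hQ q).elim
    have hpart : IsPartition s₄ L₄ := by
      refine ⟨hL₄, fun p c => ?_⟩
      cases p with
      | ini => rw [hini₄, hL₄def]; simp only [Function.update_apply]; split_ifs <;> simp <;> omega
      | fin => rw [hfin₄, hL₄def]; simp only [Function.update_apply]; split_ifs <;> simp <;> omega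
      | state q => exact (hQ q).elim
    have hn₅ : s₅.numCls = 2 := by rw [hS₅.numCls, hn₄]
    refine ⟨⟨⟨⟨L₄, hS₅.isPartition hpart⟩, hQ₅, ?_⟩, ?_, by rw [hS₅.quot, hquot₄], by omega, hini,
      hfin, ?_, ?_, ?_⟩, by rw [hS₅.inc, hinc₄], by simp; omega⟩
    · intro c hc
      obtain rfl | rfl : c = 0 ∨ c = 1 := by omega
      · exact ⟨_, (hini _).2 rfl⟩
      · exact ⟨_, (hfin _).2 rfl⟩
    · rw [hS₅.inc, hinc₄]; exact hinc
    · intro _ _ p; exact (hQ p).elim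
    · simp [hqd₅]
    · intros; omega
  | cons q₀ states =>
    simp only [post_bind, post_seq]
    refine (post_newClass hL₄).mono ?_
    rintro _ s₅ t₅ ⟨rfl, hL₅, hc₅, hn₅, hq₅, hi₅, -, hh₅, htl₅, hqt₅, rfl⟩
    rw [hn₄] at hn₅ ⊢
    rw [← hst]
    refine (post_forEach (fun pre s' =>
      Linked s' (Function.update L₄ 2 (pre.map Aug.state).reverse) ∧ SameOutsideLists s₅ s' ∧
      s'.cls .ini = 0 ∧ s'.cls .fin = 1 ∧ ∀ q ∈ pre, s'.cls (.state q) = 2) (fun _ => 8)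
      ⟨?_, ⟨rfl, rfl, rfl, rfl, rfl, rfl, rfl⟩, hc₅ ▸ hini₄, hc₅ ▸ hfin₄, by simp⟩ ?_).mono ?_
    · have : Function.update L₄ 2 (([] : List Q).map Aug.state).reverse = L₄ := by
        rw [Function.update_eq_iff]; simp [hL₄def]
      rw [this]; exact hL₅
    · rintro pre q post s' hpre ⟨hL', hS', hi', hf', hc'⟩
      have hnd := h.states_nodup
      rw [hpre] at hnd
      refine (post_link hL' (c := 2) (p := .state q) (by rw [hS'.numCls]; omega) ?_).mono ?_
      · intro x
        by_cases hx : x = 2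
        · subst hx
          simp only [Function.update_self, List.mem_reverse, List.mem_map]
          rintro ⟨q', hq', heq⟩
          cases heq
          grind
        · rw [Function.update_of_ne hx, hL₄def]
          simp only [Function.update_apply]
          split_ifs <;> simp
      · rintro - s'' t ⟨hL'', hS'', hc'', ht⟩
        refine ⟨⟨?_, hS'.trans hS'', ?_, ?_, ?_⟩, ht⟩
        · simpa using hL''
        · simp [hc'', hi']
        · simp [hc'', hf']
        · intro q' hq'
          rw [hc'']
          by_cases hqq : q' = q
          · subst hqq; simp
          · have : q' ∈ pre := by simpa [hqq] using hq'
            simp [hqq, hc' q' this]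
    rintro - s₆ t₆ ⟨⟨hL₆, hS₆, hini₆, hfin₆, hst₆⟩, ht₆⟩
    have hn₆ : s₆.numCls = 3 := by rw [hS₆.numCls, hn₅]
    have hq₆ : ∀ c, s₆.queued c = false := by
      intro c
      rw [hS₆.queued, hq₅]
      simp [Function.update_apply, hq₄]
    have hh₆ : s₆.head = s₆.tail := by rw [hS₆.head, hS₆.tail, hh₅, htl₅, hh₄]
    refine (post_enqueue (isQueue_of_empty hh₆ hq₆) (e := 2) (by omega) (hq₆ _)).mono ?_
    rintro - s₇ t₇ ⟨hQ₇, hS₇, hqd₇, rfl⟩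
    have hn₇ : s₇.numCls = 3 := by rw [hS₇.numCls, hn₆]
    refine (post_enqueue hQ₇ (e := s₂.numCls) (by omega) ?_).mono ?_
    · rw [hn₂, hqd₇]; simp [hq₆]
    rintro - s₈ t₈ ⟨hQ₈, hS₈, hqd₈, rfl⟩
    rw [hn₂, hqd₇] at hqd₈
    have hn₈ : s₈.numCls = 3 := by rw [hS₈.numCls, hn₇]
    have hcls₈ : s₈.cls = s₆.cls := by rw [hS₈.cls, hS₇.cls]
    have hst' : ∀ q, s₆.cls (.state q) = 2 := fun q => hst₆ q (h.mem_states q)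
    have hini : ∀ p, s₈.cls p = 0 ↔ p = .ini := by
      intro p; rw [hcls₈]; cases p <;> simp [hini₆, hfin₆, hst']
    have hfin : ∀ p, s₈.cls p = 1 ↔ p = .fin := by
      intro p; rw [hcls₈]; cases p <;> simp [hini₆, hfin₆, hst']
    have hpart : IsPartition s₆ (Function.update L₄ 2 (inp.states.map Aug.state).reverse) := by
      refine ⟨hL₆, fun p c => ?_⟩
      cases p with
      | ini =>
        rw [hini₆, hL₄def]; simp only [Function.update_apply]; split_ifs <;> simp <;> omega
      | fin =>
        rw [hfin₆, hL₄def]; simp only [Function.update_apply]; split_ifs <;> simp <;> omega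
      | state q =>
        rw [hst', hL₄def]; simp only [Function.update_apply]
        split_ifs <;> simp [h.mem_states] <;> omega
    refine ⟨⟨⟨⟨_, hS₈.isPartition (hS₇.isPartition hpart)⟩, hQ₈, ?_⟩, ?_, ?_, by omega, hini,
      hfin, ?_, ?_, ?_⟩, ?_, ?_⟩
    · intro c hc
      obtain rfl | rfl | rfl : c = 0 ∨ c = 1 ∨ c = 2 := by omega
      · exact ⟨_, (hini _).2 rfl⟩
      · exact ⟨_, (hfin _).2 rfl⟩
      · exact ⟨.state q₀, by rw [hcls₈, hst']⟩
    · rw [hS₈.inc, hS₇.inc, hS₆.inc, hi₅, hinc₄]; exact hinc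
    · rw [hS₈.quot, hS₇.quot, hS₆.quot, hqt₅, hquot₄]
    · intro r _ p q _
      rw [hcls₈, hst', hst']
    · simp [hqd₈]
    · intro c hc2 hc hq
      obtain rfl : c = 2 := by omega
      simp [hqd₈] at hq
    · rw [hS₈.inc, hS₇.inc, hS₆.inc, hi₅, hinc₄]
    · simp only [List.map_const', List.sum_replicate, smul_eq_mul] at ht₆
      omega

end Describes

end FPCSA

/-! ### The quotient -/

namespace FPCSA

open Prog

variable {K A Q : Type*} [DecidableEq Q] [Semiring K] [DecidableEq K] [DecidableEq A]

/-- The weight that is added to the transitions of the quotient from the class `c` with label `a`, when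
the transitions of the list `l` are run through. -/
def firstSum (s : Mem K A Q) (l : List (Aug Q × Option A × K)) (c : ℕ) (a : Option A) : K :=
  (l.map fun e => if (s.cls e.1 = c ∧ s.first c = some e.1) ∧ e.2.1 = a then e.2.2 else 0).sum

theorem post_quotientStep (q : Aug Q) (s : Mem K A Q) :
    (quotientStep q).Post s fun _ s' t => s' = { s with quot := s'.quot } ∧
      (∀ c a d, (s'.quot.lookup (c, a, d)).getD 0 =
        (s.quot.lookup (c, a, d)).getD 0 +
          if s.cls q = d then firstSum s (s.inc q) c a else 0) ∧
      t ≤ 3 + 7 * (s.inc q).length := by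
  simp only [quotientStep, getCls, getInc, post_bind, post_get]
  refine (post_forEach (fun pre s' => s' = { s with quot := s'.quot } ∧
    ∀ c a d, (s'.quot.lookup (c, a, d)).getD 0 = (s.quot.lookup (c, a, d)).getD 0 +
      if s.cls q = d then firstSum s pre c a else 0) (fun _ => 6)
    ⟨rfl, by simp [firstSum]⟩ ?_).mono ?_
  · rintro pre e post s₁ - ⟨hs₁, hq₁⟩
    have hcls : s₁.cls = s.cls := by rw [hs₁]
    have hfirst : s₁.first = s.first := by rw [hs₁]
    have hconcat : ∀ c a, firstSum s (pre ++ [e]) c a = firstSum s pre c a +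
        if (s.cls e.1 = c ∧ s.first c = some e.1) ∧ e.2.1 = a then e.2.2 else 0 := by
      intro c a; simp [firstSum]
    simp only [post_get, post_bind, post_seq, getFirst, post_tick, hcls, hfirst]
    by_cases hif : s.first (s.cls e.1) = some e.1
    · rw [if_pos hif]
      simp only [getQuot, addWeights, setQuot, post_get, post_bind, post_put]
      refine ⟨⟨by rw [hs₁], ?_⟩, by omega⟩
      intro c a d
      rw [HMap.getD_lookup_insert, hconcat]
      by_cases hkey : (c, a, d) = (s.cls e.1, e.2.1, s.cls q)
      · rw [if_pos hkey]
        simp only [Prod.mk.injEq] at hkey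
        obtain ⟨rfl, rfl, rfl⟩ := hkey
        rw [hq₁]
        simp [hif, add_assoc]
      · rw [if_neg hkey, hq₁]
        simp only [Prod.mk.injEq, not_and] at hkey
        by_cases hd : s.cls q = d
        · rw [if_pos hd, if_pos hd, if_neg, add_zero]
          rintro ⟨⟨h1, -⟩, h2⟩
          exact hkey h1.symm h2.symm hd.symm
        · rw [if_neg hd, if_neg hd]
    · rw [if_neg hif, post_tick]
      refine ⟨⟨hs₁, ?_⟩, by omega⟩
      intro c a d
      rw [hq₁, hconcat, if_neg (c := _ ∧ _), add_zero]
      rintro ⟨⟨rfl, h2⟩, -⟩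
      exact hif h2
  · rintro - s₁ t ⟨⟨hs₁, hq₁⟩, ht⟩
    refine ⟨hs₁, hq₁, ?_⟩
    simp at ht
    omega

/-- Only transitions that leave the first state `r` of a class are counted, so the table contains
the signatures of one representative per class. That the choice is immaterial is a matter of
stability, which is not used here. -/
theorem post_buildQuotient [Fintype Q] {𝒜 : WAut K A Q} {inp : Input K A Q}
    (h : inp.Describes 𝒜) {s : Mem K A Q} (hI : LoopInv 𝒜 s) :
    (buildQuotient inp).Post s fun _ s' t => s'.cls = s.cls ∧ s'.numCls = s.numCls ∧
      (∀ c < s.numCls, ∃ r, s.cls r = c ∧ ∀ a d,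
        (s'.quot.lookup (c, a, d)).getD 0 = 𝒜.signature r (classSet s d) a) ∧
      t ≤ 4 + 4 * Fintype.card Q + 7 * ∑ p, (s.inc p).length := by
  simp only [buildQuotient, post_seq]
  refine (post_quotientStep .fin s).mono ?_
  rintro - s₁ t₁ ⟨hs₁, hq₁, ht₁⟩
  rw [hI.quot] at hq₁
  simp only [AList.lookup_empty, Option.getD_none, zero_add] at hq₁
  refine (post_forEach (fun pre s' => s' = { s with quot := s'.quot } ∧
    ∀ c a d, (s'.quot.lookup (c, a, d)).getD 0 =
      (if s.cls .fin = d then firstSum s (s.inc .fin) c a else 0) +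
      (pre.map fun q => if s.cls (.state q) = d then firstSum s (s.inc (.state q)) c a
        else 0).sum) (fun q => 3 + 7 * (s.inc (.state q)).length)
    ⟨hs₁, by simpa using hq₁⟩ ?_).mono ?_
  · rintro pre q post s₂ - ⟨hs₂, hq₂⟩
    refine (post_quotientStep (.state q) s₂).mono ?_
    have hfs : firstSum s₂ = firstSum s := by
      funext l c a
      rw [hs₂]; rfl
    have hcls : s₂.cls = s.cls := by rw [hs₂]
    have hinc : s₂.inc = s.inc := by rw [hs₂]
    rintro - s₃ t₃ ⟨hs₃, hq₃, ht₃⟩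
    rw [hinc] at ht₃
    refine ⟨⟨by rw [hs₃, hs₂], ?_⟩, ht₃⟩
    intro c a d
    rw [hq₃, hq₂, hcls, hinc, hfs]
    simp [add_assoc]
  rintro - s₂ t₂ ⟨⟨hs₂, hq₂⟩, ht₂⟩
  refine ⟨by rw [hs₂], by rw [hs₂], ?_, ?_⟩
  · intro c hc
    obtain ⟨L, hL⟩ := hI.good.isPartition
    obtain ⟨p, hp⟩ := hI.good.nonempty c hc
    have hpL := (hL.mem_iff p c).2 hp
    obtain ⟨r, l, hr⟩ := List.exists_cons_of_ne_nil (List.ne_nil_of_mem hpL)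
    have hrc : s.cls r = c := (hL.mem_iff r c).1 (by rw [hr]; simp)
    have hfr : s.first c = some r := by rw [hL.first c hc, hr]; rfl
    have hfirst : ∀ a q, firstSum s (s.inc q) c a = 𝒜.augE r a q := by
      intro a q
      rw [firstSum, ← hI.isIncoming.sum_eq]
      congr 2
      funext e
      congr 2
      rw [hfr, Option.some.injEq, eq_iff_iff]
      constructor
      · rintro ⟨-, h⟩; exact h.symm
      · intro h; exact ⟨h ▸ hrc, h.symm⟩
    refine ⟨r, hrc, fun a d => ?_⟩
    rw [hq₂, h.sum_states, WAut.signature, classSet, Finset.sum_filter, Aug.sum_eq]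
    -- No transition enters the added initial state, which is why the program need not visit it.
    have h0 : 𝒜.augE r a .ini = 0 := by
      cases r <;> cases a <;> rfl
    simp only [hfirst, h0, ite_self, zero_add]
  · rw [h.sum_states, Finset.sum_add_distrib, Finset.sum_add_distrib] at ht₂
    rw [Aug.sum_eq]
    simp only [Finset.sum_const, Finset.card_univ, smul_eq_mul, ← Finset.mul_sum] at ht₂
    omega

end FPCSA

/-! ### Morphisms and the minimal quotient -/

namespace WAut

variable {K A Q R S : Type*} [Semiring K] [Fintype Q] [Fintype R] [Fintype S]

open Classical in
theorem isMorphism_iff {𝒜 : WAut K A Q} {ℬ : WAut K A R} {φ : Q → R} :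
    𝒜.IsMorphism ℬ φ ↔ Function.Surjective φ ∧
      (∀ r, (∑ q, if φ q = r then 𝒜.I q else 0) = ℬ.I r) ∧
      (∀ a p r, (∑ q, if φ q = r then 𝒜.E a p q else 0) = ℬ.E a (φ p) r) ∧
      ∀ p, 𝒜.T p = ℬ.T (φ p) := by
  have h1 : Matrix.vecMul 𝒜.I (amalgamation K φ) = ℬ.I ↔
      ∀ r, (∑ q, if φ q = r then 𝒜.I q else 0) = ℬ.I r := by
    rw [funext_iff]
    refine forall_congr' fun r => ?_
    simp [Matrix.vecMul, dotProduct, amalgamation]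
  have h2 : (∀ a, 𝒜.E a * amalgamation K φ = amalgamation K φ * ℬ.E a) ↔
      ∀ a p r, (∑ q, if φ q = r then 𝒜.E a p q else 0) = ℬ.E a (φ p) r := by
    refine forall_congr' fun a => ?_
    rw [← Matrix.ext_iff]
    refine forall_congr' fun p => forall_congr' fun r => ?_
    simp [Matrix.mul_apply, amalgamation]
  have h3 : 𝒜.T = Matrix.mulVec (amalgamation K φ) ℬ.T ↔ ∀ p, 𝒜.T p = ℬ.T (φ p) := by
    rw [funext_iff]
    refine forall_congr' fun p => ?_
    simp [Matrix.mulVec, dotProduct, amalgamation]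
  rw [IsMorphism, ConjugateBy, h1, h2, h3]

theorem signature_state_none (𝒜 : WAut K A Q) [DecidableEq Q] (p : Q) (D : Finset (Aug Q)) :
    𝒜.signature (.state p) D none = if Aug.fin ∈ D then 𝒜.T p else 0 := by
  rw [signature, ← Finset.sum_ite_mem_eq, Aug.sum_eq]
  simp [augE]

theorem signature_state_some (𝒜 : WAut K A Q) [DecidableEq Q] (p : Q) (D : Finset (Aug Q)) (a : A) :
    𝒜.signature (.state p) D (some a) = ∑ q, if Aug.state q ∈ D then 𝒜.E a p q else 0 := by
  rw [signature, ← Finset.sum_ite_mem_eq, Aug.sum_eq]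
  simp [augE]

theorem signature_ini_none (𝒜 : WAut K A Q) [DecidableEq Q] (D : Finset (Aug Q)) :
    𝒜.signature .ini D none = ∑ q, if Aug.state q ∈ D then 𝒜.I q else 0 := by
  rw [signature, ← Finset.sum_ite_mem_eq, Aug.sum_eq]
  simp [augE]

/-- A set `D` saturated for `φ` is a union of fibres on true states. Each fibre contributes a single
weight of `ℬ`, which depends on the origin `p` only through `φ p`. -/
theorem IsMorphism.isCongruence {𝒜 : WAut K A Q} {ℬ : WAut K A R} {φ : Q → R}
    (h : 𝒜.IsMorphism ℬ φ) : 𝒜.IsCongruence fun p q => φ p = φ q := by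
  classical
  obtain ⟨-, -, hE, hT⟩ := isMorphism_iff.1 h
  intro p q hpq D hD
  have key : ∀ p a, (∑ q, if Aug.state q ∈ D then 𝒜.E a p q else 0) =
      ∑ r, if ∃ q, φ q = r ∧ Aug.state q ∈ D then ℬ.E a (φ p) r else 0 := by
    intro p a
    simp only [← hE]
    have : ∀ r, (if ∃ q, φ q = r ∧ Aug.state q ∈ D then
        ∑ q, (if φ q = r then 𝒜.E a p q else 0) else 0) =
        ∑ q, if φ q = r then (if Aug.state q ∈ D then 𝒜.E a p q else 0) else 0 := by
      intro r
      split_ifs with hr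
      · obtain ⟨q₀, rfl, hq₀⟩ := hr
        refine Finset.sum_congr rfl fun q _ => ?_
        split_ifs with h1 h2
        · rfl
        · exact absurd ((hD _ _ h1).2 hq₀) h2
        · rfl
      · symm
        refine Finset.sum_eq_zero fun q _ => ?_
        split_ifs with h1 h2
        · exact absurd ⟨q, h1, h2⟩ hr
        · rfl
        · rfl
    rw [Finset.sum_congr rfl fun r _ => this r, Finset.sum_comm]
    simp
  funext a
  cases a with
  | none => rw [signature_state_none, signature_state_none, hT, hT, hpq]
  | some a => rw [signature_state_some, signature_state_some, key, key, hpq]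

-- This is the product rule for amalgamation matrices, $X_\psi X_\theta = X_{\theta\circ\psi}$,
-- applied to a row vector.
open Classical in
theorem sum_ite_comp {ψ : Q → S} {θ : S → R} (f : Q → K) (r : R) :
    (∑ s, if θ s = r then (∑ q, if ψ q = s then f q else 0) else 0) =
      ∑ q, if θ (ψ q) = r then f q else 0 := by
  have : ∀ s, (if θ s = r then (∑ q, if ψ q = s then f q else 0) else 0) =
      ∑ q, if ψ q = s then (if θ (ψ q) = r then f q else 0) else 0 := by
    intro s
    split_ifs with h
    · refine Finset.sum_congr rfl fun q _ => ?_
      split_ifs with h1 h2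
      · rfl
      · exact absurd (h1 ▸ h) h2
      · rfl
    · symm
      refine Finset.sum_eq_zero fun q _ => ?_
      split_ifs with h1 h2
      · exact absurd (h1 ▸ h2) h
      · rfl
      · rfl
  rw [Finset.sum_congr rfl fun s _ => this s, Finset.sum_comm]
  simp

/-- A morphism that is constant on the fibres of another one factors through it. -/
theorem IsMorphism.factor {𝒜 : WAut K A Q} {ℬ : WAut K A R} {𝒞 : WAut K A S} {φ : Q → R}
    {ψ : Q → S} (hφ : 𝒜.IsMorphism ℬ φ) (hψ : 𝒜.IsMorphism 𝒞 ψ)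
    (h : ∀ p q, ψ p = ψ q → φ p = φ q) : ∃ θ : S → R, 𝒞.IsMorphism ℬ θ := by
  classical
  obtain ⟨hs, hI, hE, hT⟩ := isMorphism_iff.1 hφ
  obtain ⟨hs', hI', hE', hT'⟩ := isMorphism_iff.1 hψ
  -- The factor `θ` is `φ` after a section of `ψ`; constancy of `φ` on the fibres of `ψ` gives `θ ∘
  -- ψ = φ`.
  have hθ : ∀ q, φ (Function.surjInv hs' (ψ q)) = φ q := fun q => h _ _ (Function.surjInv_eq hs' _)
  refine ⟨fun s => φ (Function.surjInv hs' s), isMorphism_iff.2 ⟨?_, ?_, ?_, ?_⟩⟩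
  · intro r
    obtain ⟨q, rfl⟩ := hs r
    exact ⟨ψ q, hθ q⟩
  · intro r
    simp only [← hI', ← hI]
    rw [sum_ite_comp (ψ := ψ) (θ := fun s => φ (Function.surjInv hs' s))]
    simp only [hθ]
  · intro a s r
    obtain ⟨p, rfl⟩ := hs' s
    simp only [← hE', hθ, ← hE]
    rw [sum_ite_comp (ψ := ψ) (θ := fun s => φ (Function.surjInv hs' s))]
    simp only [hθ]
  · intro s
    obtain ⟨p, rfl⟩ := hs' s
    rw [hθ, ← hT, ← hT']

end WAut

/-! ### Minimality of the output and the running time of a whole run -/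

namespace FPCSA

open Prog

theorem isMinimalQuotient_of_forall.{y, u₁, u₂, u₃, u₄} {K : Type u₁} {A : Type u₂} {Q : Type u₃}
    {R : Type u₄} [Semiring K] [Fintype Q] [Fintype R] {𝒜 : WAut K A Q} {ℬ : WAut K A R}
    {φ : Q → R} (hφ : 𝒜.IsMorphism ℬ φ)
    (h : ∀ r, 𝒜.IsCongruence r → ∀ p q, r p q → φ p = φ q) :
    WAut.IsMinimalQuotient.{y} ℬ 𝒜 := by
  refine ⟨⟨φ, hφ⟩, ?_⟩
  rintro S _ 𝒞 ⟨ψ, hψ⟩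
  obtain ⟨θ, hθ⟩ := hφ.factor hψ fun p q hpq => h _ hψ.isCongruence p q hpq
  exact ⟨Fintype.card_le_of_surjective θ hθ.1, θ, hθ⟩

section

variable {K A Q : Type*} [DecidableEq Q] [Fintype Q] [Semiring K] [DecidableEq K] [DecidableEq A]

/-- By stability, the representative whose weights were recorded may be replaced by any state of its
class. Classes of true states are numbered from 2, whence the shift. -/
theorem isMorphism_output {𝒜 : WAut K A Q} {s s' : Mem K A Q} (hI : LoopInv 𝒜 s)
    (hst : ∀ c, 1 ≤ c → c < s.numCls → IsStable 𝒜 s.cls (classSet s c))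
    (hnum : s'.numCls = s.numCls)
    (hquot : ∀ c < s.numCls, ∃ r, s.cls r = c ∧ ∀ a d,
      (s'.quot.lookup (c, a, d)).getD 0 = 𝒜.signature r (classSet s d) a)
    {φ : Q → Fin (s'.numCls - 2)} (hφ : ∀ q, s.cls (.state q) = (φ q).val + 2) :
    𝒜.IsMorphism (output s') φ := by
  classical
  have hmem : ∀ q (r : Fin (s'.numCls - 2)),
      Aug.state q ∈ classSet s (r.val + 2) ↔ φ q = r := by
    intro q r
    rw [mem_classSet, hφ, Fin.ext_iff]
    omega
  have hval : ∀ p a d, 1 ≤ d → d < s.numCls →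
      (s'.quot.lookup ((φ p).val + 2, a, d)).getD 0 = 𝒜.signature (.state p) (classSet s d) a := by
    intro p a d hd hd'
    obtain ⟨r, hr, hr'⟩ := hquot ((φ p).val + 2) (by rw [← hφ]; exact hI.good.cls_lt _)
    rw [hr', hst d hd hd' r (.state p) (by rw [hr, hφ])]
  refine WAut.isMorphism_iff.2 ⟨?_, ?_, ?_, ?_⟩
  · intro r
    have hr := r.isLt
    obtain ⟨p, hp⟩ := hI.good.nonempty (r.val + 2) (by omega)
    obtain ⟨q, rfl⟩ := hI.exists_state (p := p) (by omega)
    exact ⟨q, (hmem q r).1 (by simpa using hp)⟩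
  · intro r
    -- Class 0 is a singleton, so its representative is the added initial state, whose signatures
    -- sum up the initial weights.
    obtain ⟨x, hx, hx'⟩ := hquot 0 (by have := hI.two_le; omega)
    rw [(hI.cls_ini x).1 hx] at hx'
    simp only [output, hx', WAut.signature_ini_none, hmem]
    exact Finset.sum_congr rfl fun q _ => by congr
  · intro a p r
    have hr := r.isLt
    simp only [output, Matrix.of_apply]
    rw [hval p (some a) (r.val + 2) (by omega) (by omega), WAut.signature_state_some]
    simp only [hmem]
    exact Finset.sum_congr rfl fun q _ => by congr
  · intro p
    simp only [output]
    rw [hval p none 1 le_rfl (by have := hI.two_le; omega), WAut.signature_state_none,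
      if_pos (by rw [mem_classSet, hI.cls_fin])]

theorem potential_le {s : Mem K A Q} (hs : Good s) (h2 : 2 ≤ Fintype.card Q) :
    potential s ≤ (Fintype.card Q + 2 + ∑ p, (s.inc p).length) *
      (Nat.log 2 (Fintype.card Q) + 2) := by
  have hext : ∀ p, extractions s p ≤ Nat.log 2 (Fintype.card Q) + 2 := by
    intro p
    -- From $n+2\le 2n$, which needs $n\ge 2$; the logarithm grows by one, and the queue bit adds
    -- another one.
    have h1 : s.size (s.cls p) ≤ Fintype.card Q * 2 := by
      rw [hs.size_eq (hs.cls_lt p)]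
      refine (Finset.card_le_univ _).trans ?_
      rw [Aug.card_eq]
      omega
    have h3 := Nat.log_mono_right (b := 2) h1
    rw [Nat.log_mul_base (by omega) (by omega)] at h3
    unfold extractions
    split_ifs <;> omega
  unfold potential
  refine (Finset.sum_le_sum fun p _ => Nat.mul_le_mul_left _ (hext p)).trans (le_of_eq ?_)
  rw [← Finset.sum_mul, Finset.sum_add_distrib]
  simp [Aug.card_eq]

/-- The algorithm halts; the classes are those of a morphism onto the minimal quotient. -/
theorem exists_run (tie : ℕ → ℕ → Bool) {𝒜 : WAut K A Q} (hsimp : 𝒜.SimplifiableSignatures)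
    {inp : Input K A Q} (h : inp.Describes 𝒜) :
    ∃ s t, Run tie inp s t ∧
      (∃ φ : Q → Fin (s.numCls - 2), (∀ q, s.cls (.state q) = (φ q).val + 2) ∧
        𝒜.IsMorphism (output s) φ ∧
        ∀ r, 𝒜.IsCongruence r → ∀ p q, r p q → φ p = φ q) ∧
      (2 ≤ Fintype.card Q → t ≤ 1700 * (𝒜.numTransitions + Fintype.card Q) *
        Nat.log 2 (Fintype.card Q)) := by
  have hprep : ((prepareTransitions inp).seq (preparePartition inp)).Post (Mem.blank K A Q)
      fun _ s t => LoopInv 𝒜 s ∧ s.inc = addIncs (fun _ => []) inp.augTrans ∧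
        t ≤ 46 + 20 * inp.states.length + 4 * inp.trans.length := by
    rw [post_seq]
    refine (post_prepareTransitions inp).mono ?_
    rintro - s₁ t₁ ⟨hs₁, ht₁⟩
    have hinc₁ : s₁.inc = addIncs (fun _ => []) inp.augTrans := by rw [hs₁]
    refine (post_preparePartition h (hinc₁ ▸ h.isIncoming) (by rw [hs₁])).mono ?_
    rintro - s₂ t₂ ⟨hI, hinc₂, ht₂⟩
    exact ⟨hI, hinc₂.trans hinc₁, by omega⟩
  obtain ⟨hI₀, hinc₀, ht₀⟩ := hprep
  obtain ⟨s₁, t₁, hw, hI₁, hinc₁, hst, ht₁⟩ := exists_while_iteration tie hsimp hI₀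
  obtain ⟨hcls, hnum, hquot, htb⟩ := post_buildQuotient h hI₁
  refine ⟨_, _, ⟨s₁, t₁, hw, rfl, rfl⟩, ?_, ?_⟩
  · have hφ : ∀ q, s₁.cls (.state q) - 2 < (buildQuotient inp s₁).1.2.numCls - 2 := by
      intro q
      have := hI₁.good.cls_lt (.state q)
      have := hI₁.two_le_cls q
      omega
    have hφ' : ∀ q, s₁.cls (.state q) = s₁.cls (.state q) - 2 + 2 := by
      intro q
      have := hI₁.two_le_cls q
      omega
    refine ⟨fun q => ⟨s₁.cls (.state q) - 2, hφ q⟩, ?_,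
      isMorphism_output hI₁ hst hnum hquot hφ', ?_⟩
    · intro q
      rw [hcls]
      exact hφ' q
    · intro r hr p q hpq
      simp only [hI₁.congr r hr p q hpq]
  · intro h2
    have hpot := potential_le hI₀.good h2
    have hlen := h.sum_length_inc_le
    rw [hinc₁, hinc₀] at htb
    rw [hinc₀] at hpot
    rw [h.length_states, h.length_trans] at ht₀
    have hl : 1 ≤ Nat.log 2 (Fintype.card Q) := Nat.log_pos (by omega) h2
    set n := Fintype.card Q
    set m := 𝒜.numTransitions
    set l := Nat.log 2 n
    -- As $n\ge 2$ and $l\ge 1$, the factors are at most $4(m+n)$ and $3l$. The loop then takes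
    -- about $128\cdot 12=1536$ times $(m+n)l$ steps, and 1700 leaves room for the linear beginning
    -- and end.
    have hpot' : potential (((prepareTransitions inp).seq (preparePartition inp))
        (Mem.blank K A Q)).1.2 ≤ (4 * (m + n)) * (3 * l) :=
      hpot.trans (Nat.mul_le_mul (by omega) (by omega))
    have hl' : m + n ≤ (m + n) * l := Nat.le_mul_of_pos_right _ hl
    have e1 : 4 * (m + n) * (3 * l) = 12 * ((m + n) * l) := by ring
    have e2 : 1700 * (m + n) * l = 1700 * ((m + n) * l) := by ring
    rw [e1] at hpot'
    rw [e2]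
    omega

end

end FPCSA

theorem theorem6p4 :
    ∃ c : ℝ, 0 < c ∧
      ∀ (K : Type u) (A : Type v) (Q : Type w) [Semiring K] [DecidableEq K] [DecidableEq A]
        [DecidableEq Q] [Fintype Q] (𝒜 : WAut K A Q) (inp : FPCSA.Input K A Q)
        (tie : ℕ → ℕ → Bool),
        𝒜.SimplifiableSignatures → inp.Describes 𝒜 →
        (∃ s t, FPCSA.Run tie inp s t) ∧
        ∀ s t, FPCSA.Run tie inp s t →
          WAut.IsMinimalQuotient.{x} (FPCSA.output s) 𝒜 ∧
          (∃ φ : Q → Fin (s.numCls - 2), (∀ q, s.cls (.state q) = (φ q).val + 2) ∧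
            𝒜.IsMorphism (FPCSA.output s) φ) ∧
          (2 ≤ Fintype.card Q →
            (t : ℝ) ≤ c * ((𝒜.numTransitions + Fintype.card Q : ℕ) : ℝ) *
              Real.log (Fintype.card Q)) := by
  refine ⟨1700 * 2, by norm_num, ?_⟩
  intro K A Q _ _ _ _ _ 𝒜 inp tie hsimp h
  obtain ⟨s₀, t₀, hrun, ⟨φ, hφ, hmor, hcongr⟩, ht⟩ := FPCSA.exists_run tie hsimp h
  refine ⟨⟨s₀, t₀, hrun⟩, ?_⟩
  rintro s t ⟨s₁, t₁, hw, rfl, rfl⟩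
  obtain ⟨s₁', t₁', hw', rfl, rfl⟩ := hrun
  obtain ⟨rfl, rfl⟩ := hw.deterministic hw'
  refine ⟨FPCSA.isMinimalQuotient_of_forall hmor hcongr, ⟨φ, hφ, hmor⟩, fun h2 => ?_⟩
  refine (Nat.cast_le.2 (ht h2)).trans ?_
  -- The second factor of the constant comes from $\ln 2\ge 1/2$, in the change from binary to
  -- natural logarithms.
  have hlog : (Nat.log 2 (Fintype.card Q) : ℝ) ≤ 2 * Real.log (Fintype.card Q) := by
    have h1 : (Nat.log 2 (Fintype.card Q) : ℝ) ≤ Real.logb 2 (Fintype.card Q) :=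
      Real.natLog_le_logb _ _
    have h3 : (1 : ℝ) / 2 ≤ Real.log 2 := by linarith [Real.log_two_gt_d9]
    have h4 : 0 ≤ Real.log (Fintype.card Q) := Real.log_natCast_nonneg _
    rw [Real.logb, le_div_iff₀ (by linarith)] at h1
    have h5 : (0 : ℝ) ≤ Nat.log 2 (Fintype.card Q) := Nat.cast_nonneg _
    nlinarith
  rw [Nat.cast_mul, Nat.cast_mul]
  calc _ ≤ ((1700 : ℕ) : ℝ) * ((𝒜.numTransitions + Fintype.card Q : ℕ) : ℝ) *
        (2 * Real.log (Fintype.card Q)) := by gcongr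
    _ = _ := by push_cast; ring
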